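/- **Setting.** Let $H$ be a separable infinite-dimensional real Hilbert space contained in a vector space $X$ (for instance $H=L^2(\mathbb R^d)^N$ in a space of functions), $\varphi_0\in X$, $E=\varphi_0+H$ with the topology of $H$. Let $A$ be a linear operator in $X$ with a domain, $f$ a map from $E$ to $X$ whose increments $f(u+v)-f(u)$, $v\in H$, lie in $H$, and $T_\alpha$ $(\alpha\in\mathbb R^m)$ linear maps of $X$ that preserve $H$ isometrically, with $T_{\alpha+\beta}=T_\alpha T_\beta$, $AT_\alpha=T_\alpha A$, $f(T_\alpha u)=T_\alpha f(u)$. Put $\varphi_\alpha=T_\alpha\varphi_0$ and assume: * $\varphi_\alpha-\varphi_0\in H$, $A\varphi_\alpha+f(\varphi_\alpha)=0$, and $\alpha\mapsto\varphi_\alpha$ is twice differentiable in the norm of $H$, with globally Lipschitz first and second partial derivatives $\varphi_{\alpha,i},\varphi_{\alpha,ij}$; * the restriction of $A$ to $H$ generates a $C_0$-semigroup $P^A(t)$ on $H$; * $f$ has continuous and bounded Fréchet derivatives $Df,D^{(2)}f,D^{(3)}f$ in directions of $H$; * for some $b>0$ independent of $\alpha$, the spectrum of $\mathcal L_\alpha=A+Df(\varphi_\alpha)$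 lies in $\{\mathrm{Re}\,\lambda\le -b\}\cup\{0\}$, and $0$ is an eigenvalue of multiplicity $m$ with eigenspace spanned by $\varphi_{\alpha,1},\dots,\varphi_{\alpha,m}$; * $\psi^i_\alpha=T_\alpha\psi^i_0\in\ker\mathcal L_\alpha^*$ satisfy $\langle\psi^i_\alpha,\varphi_{\alpha,j}\rangle=\delta_{ij}$, and $\alpha\mapsto\psi^i_\alpha$ is twice differentiable, and is Lipschitz together with its first partial derivatives $\psi^i_{\alpha,j}$ and its second partial derivatives; * with $P_\alpha w=\sum_i\langle\psi^i_\alpha,w\rangle\varphi_{\alpha,i}$ and $\Pi_\alpha=I-P_\alpha$, the resolvent of the part of $\mathcal L_\alpha$ in the range of $\Pi_\alpha$ exists and is bounded by a constant $M$, for all $\alpha$ and all $\lambda\in\mathbb C$ with $\mathrm{Re}\,\lambda\ge -b$; * $B:E\to\mathcal L(H,H)$ is bounded and Lipschitz, and $(e_j)_{j\ge1}$ is an orthonormal basis of $H$ with $\lim_{M\to\infty}\sup_{u\in E}\sum_{j\ge M}\|B(u)e_j\|^2=0$. Let $U_\alpha(t)$ be the semigroup generated by $\mathcal L_\alpha$,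 and $V_\alpha(t)=U_\alpha(t)-P_\alpha$. For $\delta>0$ let $\mathcal R$ be the set of all $u\in E$ for which there is $\beta\in\mathbb R^m$ with $\langle u-\varphi_\beta,\psi^i_\beta\rangle=0$ for all $i$ and $\|u-\varphi_\beta\|\le\delta$. For $u\in E$ let $u_t$ be the mild solution of $\dot u_t=Au_t+f(u_t)$, $u_0=u$, that is $u_t=P^A(t)u+\int_0^tP^A(t-s)f(u_s)\,ds$, which, as $\varphi_0$ is a fixed point, means $u_t-\varphi_0=P^A(t)(u-\varphi_0)+\int_0^tP^A(t-s)\big(f(u_s)-f(\varphi_0)\big)ds$. The isochronal phase $\Theta(u)\in\mathbb R^m$ is defined by $\lim_{t\to\infty}u_t=\varphi_{\Theta(u)}$. If $\alpha\mapsto\varphi_\alpha$ is not injective (a periodic manifold), $\Theta(u)$ is determined only up to periods, and $\Theta$ stands for any continuous determination of it on an open subset $O$ of $E$. **Lemma.** There is $\delta_0>0$ such that for every $\delta\in(0,\delta_0]$ the following holds. For every $u\in\mathcal R$ a phase $\Theta(u)$ exists, and each of its values at $u$ extends to a continuous determination on a neighbourhood of $u$ in $E$; if $\alpha\mapsto\varphi_\alpha$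 is injective, $\Theta(u)$ is unique for each $u\in\mathcal R$ and $\Theta$ is defined and continuous on an open set containing $\mathcal R$. Moreover: (i) $\Theta$ is twice continuously Fréchet differentiable near each $u\in\mathcal R$ (in particular, in the interior of $\mathcal R$), with derivatives $D\Theta(u):H\to\mathbb R^m$ and $D^{(2)}\Theta(u):H\times H\to\mathbb R^m$. (ii) The series $\sum_{j=1}^\infty D^{(2)}\Theta(u)\cdot B(u)e_j\cdot B(u)e_j$ converges for $u\in\mathcal R$; its sum does not depend on the determination of $\Theta$ and is continuous on $\mathcal R$. (iii) There is a constant $C$ such that for all $u\in\mathcal R$, $w\in H$ and $1\le i\le m$, and every determination $\Theta$ near $u$, with $\alpha=\Theta(u)$, $$\big|D\Theta^i(u)\cdot w-\langle\psi^i_\alpha,w\rangle\big|\le C\|u-\varphi_\alpha\|\,\|w\|,$$ $$\Big|D^{(2)}\Theta^i(u)\cdot w\cdot w-2\sum_{j=1}^m\langle\psi^j_\alpha,w\rangle\langle\psi^i_{\alpha,j},w\rangle+\sum_{j,k=1}^m\langle\varphi_{\alpha,j},\psi^i_{\alpha,k}\rangle\langle\psi^j_\alpha,w\rangle\langle\psi^k_\alpha,w\rangle-\int_0^\infty\big\langle\psi^i_\alpha,D^{(2)}f(\varphi_\alpha)\cdot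 V_\alpha(s)w\cdot V_\alpha(s)w\big\rangle ds\Big|\le C\|u-\varphi_\alpha\|\,\|w\|^2,$$ where the integral converges absolutely. -/

import Mathlib

open Set Filter
open scoped Topology

/-- Phases `α ∈ ℝᵐ`, with the Euclidean norm. -/
abbrev Phase (m : ℕ) : Type := EuclideanSpace ℝ (Fin m)

/-- The partial derivative `∂g/∂αᵢ`. -/
noncomputable def partialD {m : ℕ} {F : Type*} [NormedAddCommGroup F] [NormedSpace ℝ F]
    (i : Fin m) (g : Phase m → F) (α : Phase m) : F :=
  fderiv ℝ g α (EuclideanSpace.single i 1)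

/-- `S` (restricted to `t ≥ 0`) is a `C₀`-semigroup on `H` whose infinitesimal generator is the
operator with graph `G` (`G x y` reads: `x` is in the domain, and is sent to `y`). -/
structure IsC0SemigroupWithGenerator {H : Type*} [NormedAddCommGroup H] [NormedSpace ℝ H]
    (S : ℝ → H →L[ℝ] H) (G : H → H → Prop) : Prop where
  zero : S 0 = ContinuousLinearMap.id ℝ H
  add : ∀ s t : ℝ, 0 ≤ s → 0 ≤ t → S (s + t) = (S s).comp (S t)
  cont : ∀ x : H, ContinuousOn (fun t => S t x) (Ici 0)
  gen : ∀ x y : H, G x y ↔ Tendsto (fun t : ℝ => t⁻¹ • (S t x - x)) (𝓝[>] 0) (𝓝 y)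

open Classical in
/-- The `C₀`-semigroup generated by the operator with graph `G` (it is unique at times `t ≥ 0`;
the value is `0` if `G` generates no `C₀`-semigroup). -/
noncomputable def semigroupOf {H : Type*} [NormedAddCommGroup H] [NormedSpace ℝ H]
    (G : H → H → Prop) : ℝ → H →L[ℝ] H :=
  if h : ∃ S : ℝ → H →L[ℝ] H, IsC0SemigroupWithGenerator S G then h.choose else 0

/-- On the complexification of the subspace `W` of the real space `H`, the operator `z - G` is
a bijection from (domain of `G`) `∩ W` onto `W` and its inverse has norm at most `M`.
A vector of the complexification is written `x + i y` with `x y ∈ W`, with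
`‖x + i y‖² = ‖x‖² + ‖y‖²`, and
`(z - G) (x + i y) = (Re z • x - Im z • y - G x) + i (Im z • x + Re z • y - G y)`. -/
def HasResolventBoundOn {H : Type*} [NormedAddCommGroup H] [NormedSpace ℝ H]
    (G : H → H → Prop) (W : Submodule ℝ H) (z : ℂ) (M : ℝ) : Prop :=
  (∀ p ∈ W, ∀ q ∈ W, ∃ x ∈ W, ∃ y ∈ W, ∃ x' y' : H, G x x' ∧ G y y' ∧
      z.re • x - z.im • y - x' = p ∧ z.im • x + z.re • y - y' = q) ∧
  (∀ x ∈ W, ∀ y ∈ W, ∀ x' y' : H, G x x' → G y y' →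
      ‖x‖ ^ 2 + ‖y‖ ^ 2 ≤
        M ^ 2 * (‖z.re • x - z.im • y - x'‖ ^ 2 + ‖z.im • x + z.re • y - y'‖ ^ 2))

/-- The data of a deterministic evolution equation `du/dt = A u + f u` on an affine space
`E = φ₀ + H`, where `H` is a Hilbert space included in a vector space `X` (of functions, say)
to which `φ₀`, `A u` and `f u` belong, together with a family `T α` of symmetries and vectors
`ψ i α` of `H`. The reference pattern `φ₀` need not lie in `H`. Only the values of `f` on `E`
matter. -/
structure PatternSystem (m : ℕ) (H X : Type*) [NormedAddCommGroup H] [InnerProductSpace ℝ H]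
    [AddCommGroup X] [Module ℝ X] where
  /-- the inclusion of `H` in `X` -/
  incl : H →ₗ[ℝ] X
  /-- the reference pattern -/
  φ₀ : X
  /-- the linear, in general unbounded, operator -/
  A : X →ₗ.[ℝ] X
  /-- the nonlinearity -/
  f : X → X
  /-- the symmetries -/
  T : Phase m → X →ₗ[ℝ] X
  /-- the neutral modes of the adjoint linearizations -/
  ψ : Fin m → Phase m → H

namespace PatternSystem

variable {m : ℕ} {H X : Type*} [NormedAddCommGroup H] [InnerProductSpace ℝ H]
  [AddCommGroup X] [Module ℝ X]

/-- The point `φ₀ + v` of `E`. Below, `E` is identified with `H` through `v ↦ φ₀ + v`: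
functions on `E` are written as functions of the coordinate `v`. -/
def point (S : PatternSystem m H X) (v : H) : X := S.φ₀ + S.incl v

/-- The element of `H` that a given element of `X` is, for elements of `X` that lie in `H`. -/
noncomputable def toH (S : PatternSystem m H X) (x : X) : H := Function.invFun S.incl x

/-- The pattern `φ_α = T_α φ₀`. -/
def φ (S : PatternSystem m H X) (α : Phase m) : X := S.T α S.φ₀

/-- The coordinate `φ_α - φ₀ ∈ H` of the pattern `φ_α ∈ E`. -/
noncomputable def shape (S : PatternSystem m H X) (α : Phase m) : H := S.toH (S.φ α - S.φ₀)

/-- The partial derivative `φ_{α,i}`. -/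
noncomputable def dφ (S : PatternSystem m H X) (i : Fin m) (α : Phase m) : H :=
  partialD i S.shape α

/-- The partial derivative `ψ^i_{α,j}`. -/
noncomputable def dψ (S : PatternSystem m H X) (i j : Fin m) (α : Phase m) : H :=
  partialD j (S.ψ i) α

/-- The symmetry `T_α` on `H`. -/
noncomputable def TH (S : PatternSystem m H X) (α : Phase m) (v : H) : H :=
  S.toH (S.T α (S.incl v))

/-- The map `v ↦ f (φ₀ + v) - f φ₀` from `H` to `H`. Its derivatives at `v` are those of `f`
at `φ₀ + v` in directions of `H`. -/
noncomputable def nonlin (S : PatternSystem m H X) (v : H) : H :=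
  S.toH (S.f (S.point v) - S.f S.φ₀)

/-- `Df(φ_α)`. -/
noncomputable def Df (S : PatternSystem m H X) (α : Phase m) : H →L[ℝ] H :=
  fderiv ℝ S.nonlin (S.shape α)

/-- `D²f(φ_α)`. -/
noncomputable def D2f (S : PatternSystem m H X) (α : Phase m) : H →L[ℝ] H →L[ℝ] H :=
  fderiv ℝ (fderiv ℝ S.nonlin) (S.shape α)

/-- The graph of the restriction of `A` to `H`: `x ∈ H` is in the domain of `A` and `A x = y`
is in `H`. -/
def AH (S : PatternSystem m H X) (x y : H) : Prop :=
  ∃ hx : S.incl x ∈ S.A.domain, S.A ⟨S.incl x, hx⟩ = S.incl y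

/-- The semigroup `P^A` generated by `A` on `H`. -/
noncomputable def PA (S : PatternSystem m H X) : ℝ → H →L[ℝ] H := semigroupOf S.AH

/-- The graph of the linearization `L_α = A + Df(φ_α)` on `H`. -/
def L (S : PatternSystem m H X) (α : Phase m) (x y : H) : Prop := S.AH x (y - S.Df α x)

/-- The semigroup `U_α` generated by `L_α`. -/
noncomputable def U (S : PatternSystem m H X) (α : Phase m) : ℝ → H →L[ℝ] H :=
  semigroupOf (S.L α)

/-- `P_α w = ∑ᵢ ⟨ψ^i_α, w⟩ φ_{α,i}`. -/
noncomputable def proj (S : PatternSystem m H X) (α : Phase m) : H →L[ℝ] H :=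
  ∑ i : Fin m, (innerSL ℝ (S.ψ i α)).smulRight (S.dφ i α)

/-- The range of `Π_α = I - P_α`. -/
noncomputable def stableSpace (S : PatternSystem m H X) (α : Phase m) : Submodule ℝ H :=
  LinearMap.range ((ContinuousLinearMap.id ℝ H - S.proj α : H →L[ℝ] H) : H →ₗ[ℝ] H)

/-- `V_α(t) = U_α(t) - P_α`. -/
noncomputable def V (S : PatternSystem m H X) (α : Phase m) (t : ℝ) : H →L[ℝ] H :=
  S.U α t - S.proj α

/-- The standing assumptions. -/
structure Assumptions (S : PatternSystem m H X) (b : ℝ) : Prop where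
  incl_injective : Function.Injective S.incl
  /-- `T_α` is a group of isometries of `H` and of `E` ... -/
  T_add : ∀ (α β : Phase m) (x : X), S.T (α + β) x = S.T α (S.T β x)
  T_isometry : ∀ (α : Phase m) (v : H), ∃ w : H, S.T α (S.incl v) = S.incl w ∧ ‖w‖ = ‖v‖
  φ_mem : ∀ α : Phase m, ∃ v : H, S.φ α - S.φ₀ = S.incl v
  /-- ... that commutes with `A` and `f`. -/
  A_T : ∀ (α : Phase m) (x : X) (hx : x ∈ S.A.domain),
    ∃ hx' : S.T α x ∈ S.A.domain, S.A ⟨S.T α x, hx'⟩ = S.T α (S.A ⟨x, hx⟩)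
  f_T : ∀ (α : Phase m) (v : H), S.f (S.T α (S.point v)) = S.T α (S.f (S.point v))
  /-- The patterns are fixed points. -/
  stationary : ∀ α : Phase m, ∃ h : S.φ α ∈ S.A.domain, S.A ⟨S.φ α, h⟩ + S.f (S.φ α) = 0
  /-- `A` generates a `C₀`-semigroup on `H`. -/
  A_generates : ∃ P : ℝ → H →L[ℝ] H, IsC0SemigroupWithGenerator P S.AH
  /-- `f` is three times continuously differentiable in the directions of `H`, with bounded
  derivatives. -/
  f_mem : ∀ v : H, ∃ w : H, S.f (S.point v) - S.f S.φ₀ = S.incl w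
  f_smooth : ContDiff ℝ 3 S.nonlin
  f_bound : ∃ K : ℝ, ∀ v : H, ‖fderiv ℝ S.nonlin v‖ ≤ K ∧
    ‖iteratedFDeriv ℝ 2 S.nonlin v‖ ≤ K ∧ ‖iteratedFDeriv ℝ 3 S.nonlin v‖ ≤ K
  /-- `α ↦ φ_α` is twice differentiable, with Lipschitz first and second derivatives. -/
  φ_smooth : ContDiff ℝ 2 S.shape
  φ_lipschitz : ∃ K : NNReal, ∀ i j : Fin m,
    LipschitzWith K (S.dφ i) ∧ LipschitzWith K (partialD j (S.dφ i))
  /-- Spectral gap: apart from the eigenvalue `0`, of (algebraic) multiplicity `m` and with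
  eigenspace spanned by the `φ_{α,i}`, the spectrum of `L_α` lies in `{Re z ≤ -b}`. -/
  b_pos : 0 < b
  spectrum_L : ∀ (α : Phase m) (z : ℂ), -b < z.re → z ≠ 0 →
    ∃ M : ℝ, HasResolventBoundOn (S.L α) ⊤ z M
  ker_L : ∀ (α : Phase m) (x : H),
    S.L α x 0 ↔ x ∈ Submodule.span ℝ (Set.range fun i => S.dφ i α)
  dφ_linearIndependent : ∀ α : Phase m, LinearIndependent ℝ fun i => S.dφ i α
  ker_L_sq : ∀ (α : Phase m) (x y : H), S.L α x y → S.L α y 0 → y = 0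
  /-- The `ψ^i_α` are in the kernel of the adjoint of `L_α`, biorthogonal to the `φ_{α,j}` and
  equivariant. -/
  ψ_ker : ∀ (i : Fin m) (α : Phase m) (x y : H), S.L α x y → inner ℝ (S.ψ i α) y = 0
  ψ_dφ : ∀ (i j : Fin m) (α : Phase m),
    inner ℝ (S.ψ i α) (S.dφ j α) = if i = j then 1 else 0
  ψ_T : ∀ (i : Fin m) (α : Phase m), S.ψ i α = S.TH α (S.ψ i 0)
  /-- `α ↦ ψ^i_α` is twice differentiable, Lipschitz, with Lipschitz first and second
  derivatives. -/
  ψ_smooth : ∀ i : Fin m, ContDiff ℝ 2 (S.ψ i)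
  ψ_lipschitz : ∃ K : NNReal, ∀ i j k : Fin m, LipschitzWith K (S.ψ i) ∧
    LipschitzWith K (S.dψ i j) ∧ LipschitzWith K (partialD k (S.dψ i j))
  /-- The resolvent of the part of `L_α` in the range of `Π_α` is bounded on `{Re z ≥ -b}`. -/
  resolvent_bound : ∃ M : ℝ, 0 < M ∧ ∀ (α : Phase m) (z : ℂ), -b ≤ z.re →
    HasResolventBoundOn (S.L α) (S.stableSpace α) z M

/-- `x : [0, ∞) → H` is (in coordinates) the mild solution of `du/dt = A u + f u` started at
`u = φ₀ + v`. As `φ₀` is a fixed point, the equation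
`u_t = P^A(t) u + ∫₀ᵗ P^A(t-s) f(u_s) ds` in `E` is the equation below for `x_t = u_t - φ₀`. -/
def IsMildSolution (S : PatternSystem m H X) (v : H) (x : ℝ → H) : Prop :=
  ContinuousOn x (Ici 0) ∧
    ∀ t : ℝ, 0 ≤ t → x t = S.PA t v + ∫ s in (0 : ℝ)..t, S.PA (t - s) (S.nonlin (x s))

/-- The solution started at `φ₀ + v` converges to the pattern `φ_η`: `η` is an isochronal phase
of `φ₀ + v`. -/
def ConvergesTo (S : PatternSystem m H X) (v : H) (η : Phase m) : Prop :=
  ∃ x : ℝ → H, S.IsMildSolution v x ∧ Tendsto x atTop (𝓝 (S.shape η))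

/-- The set `R` of all `u = φ₀ + v` that have a variational phase `β`, that is
`⟨u - φ_β, ψ^i_β⟩ = 0` for all `i`, with `‖u - φ_β‖ ≤ δ`. -/
def tube (S : PatternSystem m H X) (δ : ℝ) : Set H :=
  {v | ∃ β : Phase m, (∀ i : Fin m, inner ℝ (v - S.shape β) (S.ψ i β) = 0) ∧
    ‖v - S.shape β‖ ≤ δ}

/-- `Θ` is a continuous determination of the isochronal phase on the open set `O` of `E`. -/
def IsPhaseMapOn (S : PatternSystem m H X) (O : Set H) (Θ : H → Phase m) : Prop :=
  IsOpen O ∧ ContinuousOn Θ O ∧ ∀ v ∈ O, S.ConvergesTo v (Θ v)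

end PatternSystem

/-! The symmetries act on $H$ by isometries and carry the whole structure at $\varphi_0$ to that at
$\varphi_\alpha$. It therefore suffices to build one phase map near $\varphi_0$, with values near
$0$, and to move it along the manifold of patterns; this also makes every constant uniform in
$\alpha$. Periods do no harm: by biorthogonality $\alpha\mapsto\varphi_\alpha$ is injective near
$0$, so continuous determinations of the phase are locally unique up to a constant period
(`eventuallyEq_localPhase`).

Linear part. The resolvent bound on the range of $\Pi_0$ over the closed right half plane yields
exponential decay of $V_0(t)$. This is the Gearhart-Prüss theorem, `exists_exp_decay`, proved here
from Parseval's identity for cut-off orbits. Fix $T$ with $\|V_0(T)\|\le 1/4$. Let $F$ be the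
time-$T$ map of the flow, $\sigma(\alpha)=\varphi_\alpha-\varphi_0$, $s=D\sigma(0)$ and
$l=(\langle\psi^i_0,\cdot\rangle)_i$. Then $F$ is $C^3$, every $\sigma(\alpha)$ is a fixed point of
$F$, and $DF(0)=U_0(T)=s\,l+V_0(T)$.

Smoothness of the phase. A manifold of fixed points that attracts to first order attracts
geometrically (`exists_geometric_attraction`). This statement is functorial: the second tangent map
$T^2F$ fixes $T^2\sigma$ pointwise, and its linear part at $0$ has the same contraction constant.
Applied to $T^2F$ it gives geometric convergence of $F^n$, $DF^n$ and $D^2F^n$, uniformly near $0$.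
So $\lim F^n$ is $C^2$, and $\Theta$ is this limit read in the chart $\sigma$
(`exists_fiber_projection`). The $C^3$ regularity of $F$ and the Lipschitz second derivative of
$\sigma$ serve to make $T^2F$ and $T^2\sigma$ strictly differentiable at $0$.

Derivatives at $\varphi_0$. Both $D\Theta(0)$ and $l$ are invariant under $DF(0)$ and are left
inverses of $s$; since $DF(0)-s\,l$ is a contraction they are equal. In stable directions
$D^2\Theta(0)$ comes from differentiating $\Theta\circ\Phi_t=\Theta$ twice and letting $t\to\infty$,
which gives the integral. In neutral directions it comes from differentiating
$D\Theta(\varphi_\alpha)=\langle\psi_\alpha,\cdot\rangle$ in $\alpha$.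

Derivatives away from the manifold. As $\Theta$ is only $C^2$, the estimate for $D^2\Theta$ linear
in $\|u-\varphi_\alpha\|$ is not automatic. On the leaf $\Theta=0$ it follows by transporting
$D^2\Theta$ along the orbit $F^nx\to0$: each step costs $O(2^{-n}\|x\|)$, because $l\,D^2F(0)$
vanishes on pairs of neutral vectors, and continuity of $D^2\Theta$ at $0$ disposes of the end of
the orbit (`exists_leaf_lipschitz`).

The trace series converges uniformly near each point by the uniform tail hypothesis on $B$, whence
its continuity. -/

open scoped NNReal
set_option linter.unusedSectionVars false

/-! ### Semigroups: orbits, domain of the generator, uniqueness -/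

namespace IsC0SemigroupWithGenerator

variable {H : Type*} [NormedAddCommGroup H] [NormedSpace ℝ H]
  {S S' : ℝ → H →L[ℝ] H} {G : H → H → Prop}

theorem apply_zero (h : IsC0SemigroupWithGenerator S G) (x : H) : S 0 x = x := by
  simp [h.zero]

theorem apply_add (h : IsC0SemigroupWithGenerator S G) {s t : ℝ} (hs : 0 ≤ s) (ht : 0 ≤ t)
    (x : H) : S (s + t) x = S s (S t x) := by
  rw [h.add s t hs ht]; rfl

theorem apply_comm (h : IsC0SemigroupWithGenerator S G) {s t : ℝ} (hs : 0 ≤ s) (ht : 0 ≤ t)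
    (x : H) : S s (S t x) = S t (S s x) := by
  rw [← h.apply_add hs ht, ← h.apply_add ht hs, add_comm]

/-- Nothing is known of `S t` for negative `t`. Composing with `max t 0` produces functions
continuous on all of `ℝ`, and the integrals below are rewritten in this form before continuity is
invoked. -/
theorem continuous_apply (h : IsC0SemigroupWithGenerator S G) (x : H) :
    Continuous fun t : ℝ => S (max t 0) x :=
  (h.cont x).comp_continuous (by fun_prop) (fun t => le_max_right t 0)

theorem gen_apply (h : IsC0SemigroupWithGenerator S G) {x y : H} (hxy : G x y) {s : ℝ}
    (hs : 0 ≤ s) : G (S s x) (S s y) := by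
  rw [h.gen] at hxy ⊢
  have := ((S s).continuous.tendsto y).comp hxy
  refine this.congr' ?_
  filter_upwards [self_mem_nhdsWithin] with t ht
  have ht : (0 : ℝ) ≤ t := le_of_lt ht
  simp [h.apply_comm hs ht]

theorem gen_add (h : IsC0SemigroupWithGenerator S G) {x y x' y' : H} (hx : G x x')
    (hy : G y y') : G (x + y) (x' + y') := by
  rw [h.gen] at *
  refine (hx.add hy).congr fun t => ?_
  rw [map_add, ← smul_add]; congr 1; abel

theorem gen_smul (h : IsC0SemigroupWithGenerator S G) {x x' : H} (c : ℝ) (hx : G x x') :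
    G (c • x) (c • x') := by
  rw [h.gen] at *
  refine (hx.const_smul c).congr fun t => ?_
  rw [map_smul, ← smul_sub, smul_comm]

/-- On `[0, t]`, cutting the time at `0` changes nothing. -/
theorem integral_max (S : ℝ → H →L[ℝ] H) (g : ℝ → H) {t : ℝ} (ht : 0 ≤ t) :
    ∫ s in (0 : ℝ)..t, S (t - s) (g s) = ∫ s in (0 : ℝ)..t, S (max (t - s) 0) (g s) := by
  refine intervalIntegral.integral_congr fun s hs => ?_
  rw [uIcc_of_le ht] at hs
  rw [max_eq_left (by linarith [hs.2])]

theorem hasDerivWithinAt_orbit (h : IsC0SemigroupWithGenerator S G) {x y : H} (hxy : G x y)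
    {t : ℝ} (ht : 0 ≤ t) : HasDerivWithinAt (fun t => S t x) (S t y) (Ioi t) t := by
  rw [hasDerivWithinAt_iff_tendsto_slope' (by simp)]
  have h1 := (h.gen _ _).1 (h.gen_apply hxy ht)
  have h2 : Tendsto (fun r : ℝ => r - t) (𝓝[>] t) (𝓝[>] 0) := by
    refine tendsto_nhdsWithin_iff.2 ⟨?_, ?_⟩
    · have : Tendsto (fun r : ℝ => r - t) (𝓝 t) (𝓝 (t - t)) := by
        exact (continuous_id.sub continuous_const).tendsto t
      rw [sub_self] at this
      exact this.mono_left nhdsWithin_le_nhds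
    · filter_upwards [self_mem_nhdsWithin] with r hr
      simpa using hr
  refine (h1.comp h2).congr' ?_
  filter_upwards [self_mem_nhdsWithin] with r hr
  have hr : t < r := hr
  simp only [Function.comp, slope_def_module]
  rw [← h.apply_add (by linarith) ht, sub_add_cancel]

section Complete
variable [CompleteSpace H]

theorem exists_bound (h : IsC0SemigroupWithGenerator S G) (T : ℝ) :
    ∃ M : ℝ, 0 < M ∧ ∀ t ∈ Icc (0 : ℝ) T, ‖S t‖ ≤ M := by
  have : ∀ x : H, ∃ C, ∀ t : Icc (0 : ℝ) T, ‖S t x‖ ≤ C := by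
    intro x
    obtain ⟨C, hC⟩ := (isCompact_Icc (a := (0 : ℝ)) (b := T)).exists_bound_of_continuousOn
      ((h.cont x).mono Icc_subset_Ici_self)
    exact ⟨C, fun t => hC t t.2⟩
  obtain ⟨C, hC⟩ := banach_steinhaus this
  exact ⟨max C 1, by positivity, fun t ht => (hC ⟨t, ht⟩).trans (le_max_left _ _)⟩

/-- Strong continuity together with the uniform bound on bounded time intervals gives joint
continuity; operator-norm continuity in time is not available. -/
theorem continuous_uncurry (h : IsC0SemigroupWithGenerator S G) :
    Continuous fun p : ℝ × H => S (max p.1 0) p.2 := by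
  rw [continuous_iff_continuousAt]
  rintro ⟨t₀, x₀⟩
  obtain ⟨M, hM, hb⟩ := h.exists_bound (|t₀| + 1)
  have h1 : Tendsto (fun p : ℝ × H => M * ‖p.2 - x₀‖ + ‖S (max p.1 0) x₀ - S (max t₀ 0) x₀‖)
      (𝓝 (t₀, x₀)) (𝓝 0) := by
    have hc : Continuous (fun p : ℝ × H =>
        M * ‖p.2 - x₀‖ + ‖S (max p.1 0) x₀ - S (max t₀ 0) x₀‖) := by
      have := (h.continuous_apply x₀).comp (continuous_fst (X := ℝ) (Y := H))
      have h2 : Continuous fun p : ℝ × H => S (max p.1 0) x₀ := this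
      exact ((continuous_const.mul (continuous_snd.sub continuous_const).norm).add
        (h2.sub continuous_const).norm)
    simpa using hc.tendsto (t₀, x₀)
  rw [ContinuousAt, tendsto_iff_norm_sub_tendsto_zero]
  refine squeeze_zero' (Eventually.of_forall fun _ => norm_nonneg _) ?_ h1
  have hev : ∀ᶠ p : ℝ × H in 𝓝 (t₀, x₀), p.1 < t₀ + 1 :=
    (continuous_fst.tendsto (t₀, x₀)).eventually (Iio_mem_nhds (by simp))
  filter_upwards [hev] with p hp
  have hmem : max p.1 0 ∈ Icc (0 : ℝ) (|t₀| + 1) := by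
    refine ⟨le_max_right _ _, max_le ?_ (by positivity)⟩
    linarith [le_abs_self t₀]
  have : S (max p.1 0) p.2 - S (max t₀ 0) x₀
      = S (max p.1 0) (p.2 - x₀) + (S (max p.1 0) x₀ - S (max t₀ 0) x₀) := by
    rw [map_sub]; abel
  rw [this]
  refine (norm_add_le _ _).trans ?_
  gcongr
  exact ((S _).le_opNorm _).trans (by gcongr; exact hb _ hmem)

theorem continuous_comp (h : IsC0SemigroupWithGenerator S G) {Z : Type*} [TopologicalSpace Z]
    {a : Z → ℝ} {g : Z → H} (ha : Continuous a) (hg : Continuous g) :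
    Continuous fun z => S (max (a z) 0) (g z) :=
  h.continuous_uncurry.comp (ha.prodMk hg)

theorem continuous_convolution (h : IsC0SemigroupWithGenerator S G) {g : ℝ → H}
    (hg : Continuous g) :
    Continuous fun t => ∫ s in (0 : ℝ)..t, S (max (t - s) 0) (g s) := by
  have hc : Continuous fun p : ℝ × ℝ => S (max (p.1 - p.2) 0) (g p.2) :=
    h.continuous_comp (by fun_prop) (by fun_prop)
  exact intervalIntegral.continuous_parametric_intervalIntegral_of_continuous
    (f := fun t s => S (max (t - s) 0) (g s)) hc continuous_id

theorem integral_orbit (h : IsC0SemigroupWithGenerator S G) {x y : H} (hxy : G x y)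
    {t : ℝ} (ht : 0 ≤ t) : ∫ s in (0 : ℝ)..t, S s y = S t x - x := by
  have := intervalIntegral.integral_eq_sub_of_hasDeriv_right_of_le ht
    (f := fun t => S t x) (f' := fun t => S t y) ((h.cont x).mono Icc_subset_Ici_self)
    (fun s hs => h.hasDerivWithinAt_orbit hxy hs.1.le)
    (ContinuousOn.intervalIntegrable
      (((h.cont y).mono Icc_subset_Ici_self).mono (by rw [uIcc_of_le ht])))
  rw [this, h.apply_zero]

/-- The generator only controls right derivatives. The orbit is however the integral of the
continuous function `S t y`, so the fundamental theorem of calculus gives a two-sided derivative. -/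
theorem hasDerivAt_orbit (h : IsC0SemigroupWithGenerator S G) {x y : H} (hxy : G x y)
    {t : ℝ} (ht : 0 < t) : HasDerivAt (fun t => S t x) (S t y) t := by
  have hc := h.continuous_apply y
  have h1 := (hc.integral_hasStrictDerivAt 0 t).hasDerivAt
  rw [max_eq_left ht.le] at h1
  have h2 := h1.add_const x
  refine h2.congr_of_eventuallyEq ?_
  filter_upwards [lt_mem_nhds ht] with r hr
  have : ∫ s in (0 : ℝ)..r, S (max s 0) y = ∫ s in (0 : ℝ)..r, S s y := by
    refine intervalIntegral.integral_congr fun s hs => ?_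
    rw [uIcc_of_le hr.le] at hs
    rw [max_eq_left hs.1]
  rw [this, h.integral_orbit hxy hr.le]; simp

/-- Applying `S t` shifts the window of integration by `t`. The difference quotient is thus a
difference of averages at the two end points of the window. -/
theorem gen_integral (h : IsC0SemigroupWithGenerator S G) (x : H) {a : ℝ} (ha : 0 ≤ a) :
    G (∫ s in (0 : ℝ)..a, S (max s 0) x) (S a x - x) := by
  rw [h.gen]
  have hc := h.continuous_apply x
  have h1 := (hc.integral_hasStrictDerivAt 0 a).hasDerivAt
  have h2 := (hc.integral_hasStrictDerivAt 0 0).hasDerivAt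
  rw [max_eq_left ha] at h1
  rw [max_self, h.apply_zero] at h2
  have h1' : HasDerivAt (fun t => ∫ s in (0 : ℝ)..(a + t), S (max s 0) x) (S a x) 0 := by
    have := HasDerivAt.comp_const_add a 0 (by simpa using h1)
    simpa using this
  have h3 := (h1'.sub h2).tendsto_slope_zero_right
  refine h3.congr' ?_
  filter_upwards [self_mem_nhdsWithin] with t ht
  have ht : (0 : ℝ) < t := ht
  congr 1
  have hii : ∀ p q : ℝ, IntervalIntegrable (fun s => S (max s 0) x) MeasureTheory.volume p q :=
    fun p q => hc.intervalIntegrable p q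
  have e1 : S t (∫ s in (0 : ℝ)..a, S (max s 0) x) = ∫ s in (0 : ℝ)..a, S (max (s + t) 0) x := by
    rw [← ContinuousLinearMap.intervalIntegral_comp_comm _ (hii _ _)]
    refine intervalIntegral.integral_congr fun s hs => ?_
    rw [uIcc_of_le ha] at hs
    rw [max_eq_left hs.1, max_eq_left (by linarith [hs.1]), add_comm, h.apply_add ht.le hs.1]
  rw [e1, intervalIntegral.integral_comp_add_right (fun s => S (max s 0) x)]
  simp only [zero_add, Pi.sub_apply, add_zero, intervalIntegral.integral_same, sub_zero]
  rw [← intervalIntegral.integral_add_adjacent_intervals (hii 0 t) (hii t (a + t))]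
  abel

/-- The averages of an orbit over `[0, t]` lie in the domain and tend to its starting point as `t →
0`. -/
theorem dense_domain (h : IsC0SemigroupWithGenerator S G) : Dense {x | ∃ y, G x y} := by
  intro x
  have hc := h.continuous_apply x
  have h2 := (hc.integral_hasStrictDerivAt 0 0).hasDerivAt
  rw [max_self, h.apply_zero] at h2
  have h3 := h2.tendsto_slope_zero_right
  simp only [zero_add, intervalIntegral.integral_same, sub_zero] at h3
  refine mem_closure_of_tendsto h3 ?_
  filter_upwards [self_mem_nhdsWithin] with t ht
  have ht : (0 : ℝ) < t := ht
  have hg := h.gen_integral x ht.le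
  refine ⟨t⁻¹ • (S t x - x), ?_⟩
  rw [h.gen] at hg ⊢
  refine (hg.const_smul t⁻¹).congr fun r => ?_
  rw [map_smul, ← smul_sub, smul_comm]

/-- For `x` in the domain, `s ↦ S (t - s) (S' s x)` has right derivative zero, and its values at `0`
and `t` are the two sides; density of the domain does the rest. -/
theorem eq_of_generator (h : IsC0SemigroupWithGenerator S G)
    (h' : IsC0SemigroupWithGenerator S' G) {t : ℝ} (ht : 0 ≤ t) : S t = S' t := by
  have key : ∀ x ∈ {x | ∃ y, G x y}, S t x = S' t x := by
    rintro x ⟨y, hxy⟩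
    have hcont : Continuous fun s => S (max (t - s) 0) (S' (max s 0) x) :=
      h.continuous_comp (by fun_prop) (h'.continuous_apply x)
    have := constant_of_has_deriv_right_zero (f := fun s => S (max (t - s) 0) (S' (max s 0) x))
      (a := 0) (b := t) hcont.continuousOn ?_ t (right_mem_Icc.2 ht)
    · simpa [h.apply_zero, h'.apply_zero, ht] using this.symm
    · intro s hs
      -- Both difference quotients at `S' s x` tend to the same generator value, so their difference
      -- vanishes in the limit; joint continuity then allows the moving factor `S (t - s - k)` in
      -- front of it.
      have hd : Tendsto (fun k : ℝ => k⁻¹ • (S' (s + k) x - S' s x)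
          - k⁻¹ • (S k (S' s x) - S' s x)) (𝓝[>] 0) (𝓝 0) := by
        have a1 := (h.gen _ _).1 (h'.gen_apply hxy hs.1)
        have a2 := (h'.gen _ _).1 (h'.gen_apply hxy hs.1)
        have a3 := a2.sub a1
        rw [sub_self] at a3
        refine a3.congr' ?_
        filter_upwards [self_mem_nhdsWithin] with k hk
        have hk : (0 : ℝ) < k := hk
        rw [add_comm s k, h'.apply_add hk.le hs.1]
      have hd2 : Tendsto (fun k : ℝ => S (max (t - s - k) 0) (k⁻¹ • (S' (s + k) x - S' s x)
          - k⁻¹ • (S k (S' s x) - S' s x))) (𝓝[>] 0) (𝓝 0) := by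
        have c1 : Tendsto (fun k : ℝ => t - s - k) (𝓝[>] 0) (𝓝 (t - s)) := by
          have : Tendsto (fun k : ℝ => t - s - k) (𝓝 0) (𝓝 (t - s - 0)) :=
            (continuous_const.sub continuous_id).tendsto 0
          rw [sub_zero] at this
          exact this.mono_left nhdsWithin_le_nhds
        have := (h.continuous_uncurry.tendsto (t - s, 0)).comp (c1.prodMk_nhds hd)
        rw [map_zero] at this
        exact this
      rw [← hasDerivWithinAt_Ioi_iff_Ici, hasDerivWithinAt_iff_tendsto_slope' (by simp)]
      have h2 : Tendsto (fun r : ℝ => r - s) (𝓝[>] s) (𝓝[>] 0) := by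
        refine tendsto_nhdsWithin_iff.2 ⟨?_, ?_⟩
        · have : Tendsto (fun r : ℝ => r - s) (𝓝 s) (𝓝 (s - s)) := by
            exact (continuous_id.sub continuous_const).tendsto s
          rw [sub_self] at this
          exact this.mono_left nhdsWithin_le_nhds
        · filter_upwards [self_mem_nhdsWithin] with r hr
          simpa using hr
      refine (hd2.comp h2).congr' ?_
      filter_upwards [Ioo_mem_nhdsGT hs.2] with r hr
      simp only [Function.comp, slope_def_module]
      rw [max_eq_left (by linarith [hr.2] : 0 ≤ t - s - (r - s)),
        max_eq_left (by linarith [hr.2] : 0 ≤ t - r), max_eq_left (by linarith [hs.2] : 0 ≤ t - s),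
        max_eq_left (by linarith [hr.1, hs.1] : 0 ≤ r), max_eq_left hs.1, ← smul_sub, map_smul]
      congr 1
      have : t - s = (t - r) + (r - s) := by ring
      rw [this, h.apply_add (by linarith [hr.2]) (by linarith [hr.1])]
      have e : t - r + (r - s) - (r - s) = t - r := by ring
      rw [e, ← map_sub]
      congr 1
      simp
  ext x
  exact congrFun (Continuous.ext_on h.dense_domain (S t).continuous (S' t).continuous key) x

end Complete

end IsC0SemigroupWithGenerator

theorem semigroupOf_spec {H : Type*} [NormedAddCommGroup H] [NormedSpace ℝ H]
    {G : H → H → Prop} (h : ∃ S : ℝ → H →L[ℝ] H, IsC0SemigroupWithGenerator S G) :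
    IsC0SemigroupWithGenerator (semigroupOf G) G := by
  unfold semigroupOf
  rw [dif_pos h]
  exact h.choose_spec

/-! ### Superposition operators on spaces of continuous functions -/

namespace ContinuousMap

variable {X : Type*} [TopologicalSpace X] [CompactSpace X]
variable {E F : Type*} [NormedAddCommGroup E] [NormedSpace ℝ E] [NormedAddCommGroup F]
  [NormedSpace ℝ F]

/-- Pointwise application of a continuous family of operators. -/
noncomputable def pointwiseApply (X E F : Type*) [TopologicalSpace X] [CompactSpace X]
    [NormedAddCommGroup E] [NormedSpace ℝ E] [NormedAddCommGroup F] [NormedSpace ℝ F] :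
    C(X, E →L[ℝ] F) →L[ℝ] C(X, E) →L[ℝ] C(X, F) :=
  LinearMap.mkContinuous₂
    (LinearMap.mk₂ ℝ (fun (A : C(X, E →L[ℝ] F)) (h : C(X, E)) =>
      (⟨fun s => A s (h s), by fun_prop⟩ : C(X, F)))
      (fun _ _ _ => by ext; simp) (fun _ _ _ => by ext; simp) (fun _ _ _ => by ext; simp)
      (fun _ _ _ => by ext; simp)) 1
    (fun A h => by
      rw [one_mul, ContinuousMap.norm_le _ (by positivity)]
      intro s
      refine ((A s).le_opNorm (h s)).trans ?_
      gcongr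
      · exact A.norm_coe_le_norm s
      · exact h.norm_coe_le_norm s)

@[simp] theorem pointwiseApply_apply (A : C(X, E →L[ℝ] F)) (h : C(X, E)) (s : X) :
    pointwiseApply X E F A h s = A s (h s) := rfl

/-- The superposition operator `x ↦ f ∘ x`. -/
def superpose (X : Type*) [TopologicalSpace X] {E F : Type*} [TopologicalSpace E]
    [TopologicalSpace F] (f : C(E, F)) (x : C(X, E)) : C(X, F) := f.comp x

/-- The pointwise mean value inequality needs `f'` to vary little on a tube around the range of `x`,
uniformly in the parameter. This is continuity of `y ↦ f' ∘ y` at `x` in the sup norm, tested on the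
translates of `x` by constants. -/
theorem hasFDerivAt_superpose (f : C(E, F)) (hf : ContDiff ℝ 1 f) (f' : C(E, E →L[ℝ] F))
    (hf' : ∀ e, f' e = fderiv ℝ f e) (x : C(X, E)) :
    HasFDerivAt (superpose X f) (pointwiseApply X E F (superpose X f' x)) x := by
  rw [hasFDerivAt_iff_isLittleO_nhds_zero, Asymptotics.isLittleO_iff]
  intro ε hε
  have hcont : Continuous (superpose X f') := ContinuousMap.continuous_postcomp f'
  obtain ⟨δ, hδ, hball⟩ : ∃ δ > 0, ∀ y : C(X, E), dist y x < δ →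
      dist (superpose X f' y) (superpose X f' x) < ε := by
    refine Metric.continuousAt_iff.1 ?_ ε hε
    exact hcont.continuousAt
  filter_upwards [Metric.ball_mem_nhds (0 : C(X, E)) hδ] with h hh
  rw [ContinuousMap.norm_le _ (by positivity)]
  intro s
  have hhs : ‖h s‖ < δ := (h.norm_coe_le_norm s).trans_lt (by simpa using hh)
  have hd : ∀ e ∈ Metric.ball (x s) δ, HasFDerivWithinAt f (fderiv ℝ f e) (Metric.ball (x s) δ) e :=
    fun e _ => (hf.differentiable one_ne_zero e).hasFDerivAt.hasFDerivWithinAt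
  have hb : ∀ e ∈ Metric.ball (x s) δ, ‖fderiv ℝ f e - fderiv ℝ f (x s)‖ ≤ ε := by
    intro e he
    have h1 : dist (x + ContinuousMap.const X (e - x s)) x < δ := by
      rw [dist_eq_norm, add_sub_cancel_left]
      refine (ContinuousMap.norm_le _ (norm_nonneg (e - x s))).2 (fun r => le_rfl) |>.trans_lt ?_
      rwa [← dist_eq_norm]
    have h2 := (ContinuousMap.dist_apply_le_dist s).trans_lt (hball _ h1)
    rw [dist_eq_norm] at h2
    simp only [superpose, ContinuousMap.comp_apply, hf', ContinuousMap.add_apply,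
      ContinuousMap.const_apply, add_sub_cancel] at h2
    exact h2.le
  have := (convex_ball (x s) δ).norm_image_sub_le_of_norm_hasFDerivWithin_le' hd hb
    (Metric.mem_ball_self hδ) (y := x s + h s) (by simpa using hhs)
  simp only [add_sub_cancel_left] at this
  simp only [superpose, ContinuousMap.sub_apply, ContinuousMap.comp_apply,
    ContinuousMap.add_apply, pointwiseApply_apply, hf']
  exact this.trans (by gcongr; exact h.norm_coe_le_norm s)

/-- The derivative is a fixed continuous linear map applied to the superposition operator of `f'`,
so induction on the order works once the target is allowed to change from `F` to `E →L[ℝ] F`; hence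
the common universe of `E` and `F`. -/
theorem contDiff_superpose.{u} {X : Type*} [TopologicalSpace X] [CompactSpace X]
    {E F : Type u} [NormedAddCommGroup E] [NormedSpace ℝ E] [NormedAddCommGroup F]
    [NormedSpace ℝ F] (n : ℕ) (f : C(E, F)) (hf : ContDiff ℝ n f) :
    ContDiff ℝ n (superpose X f) := by
  induction n generalizing F with
  | zero => exact contDiff_zero.2 (ContinuousMap.continuous_postcomp f)
  | succ n ih =>
    have hf1 : ContDiff ℝ 1 f := hf.of_le (by norm_cast; omega)
    let f' : C(E, E →L[ℝ] F) := ⟨fderiv ℝ f, hf1.continuous_fderiv one_ne_zero⟩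
    have hd := fun x => hasFDerivAt_superpose (X := X) f hf1 f' (fun _ => rfl) x
    push_cast at hf ⊢
    rw [contDiff_succ_iff_fderiv] at hf ⊢
    refine ⟨fun x => (hd x).differentiableAt, by simp, ?_⟩
    have : fderiv ℝ (superpose X f)
        = fun x => pointwiseApply X E F (superpose X f' x) := funext fun x => (hd x).fderiv
    rw [this]
    exact (pointwiseApply X E F).contDiff.comp (ih f' hf.2.2)

end ContinuousMap

/-! ### The solution map on a bounded time interval -/

namespace IsC0SemigroupWithGenerator

variable {H : Type*} [NormedAddCommGroup H] [NormedSpace ℝ H] [CompleteSpace H]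
  {S : ℝ → H →L[ℝ] H} {G : H → H → Prop}

/-- The orbits of a semigroup on `[0, T]`. -/
noncomputable def orbitMap (h : IsC0SemigroupWithGenerator S G) (T : ℝ) :
    H →L[ℝ] C(Icc (0 : ℝ) T, H) :=
  LinearMap.mkContinuousOfExistsBound
    { toFun := fun v => ⟨fun t => S t v,
        (h.cont v).comp_continuous continuous_subtype_val fun t => t.2.1⟩
      map_add' := fun _ _ => by ext; simp
      map_smul' := fun _ _ => by ext; simp } <| by
    obtain ⟨M, hM, hb⟩ := h.exists_bound T
    refine ⟨M, fun v => (ContinuousMap.norm_le _ (by positivity)).2 fun t => ?_⟩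
    exact ((S t).le_opNorm v).trans (by gcongr; exact hb t t.2)

@[simp] theorem orbitMap_apply (h : IsC0SemigroupWithGenerator S G) (T : ℝ) (v : H)
    (t : Icc (0 : ℝ) T) : h.orbitMap T v t = S t v := rfl

theorem continuous_IccExtend {T : ℝ} (hT : 0 ≤ T) (g : C(Icc (0 : ℝ) T, H)) :
    Continuous (IccExtend hT g) := g.continuous.Icc_extend'

/-- The operator `g ↦ ∫₀ᵗ S(t - s) g(s) ds` on continuous functions on `[0, T]`. -/
noncomputable def duhamelOp (h : IsC0SemigroupWithGenerator S G) {T : ℝ} (hT : 0 ≤ T) :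
    C(Icc (0 : ℝ) T, H) →L[ℝ] C(Icc (0 : ℝ) T, H) :=
  have hc (g : C(Icc (0 : ℝ) T, H)) (t : ℝ) :
      Continuous fun s => S (max (t - s) 0) (IccExtend hT g s) :=
    h.continuous_comp (by fun_prop) (continuous_IccExtend hT g)
  LinearMap.mkContinuousOfExistsBound
    { toFun := fun g => ⟨fun t => ∫ s in (0 : ℝ)..t, S (max (t - s) 0) (IccExtend hT g s),
        (h.continuous_convolution (continuous_IccExtend hT g)).comp continuous_subtype_val⟩
      map_add' := fun g g' => by
        ext t
        simp only [ContinuousMap.coe_mk, ContinuousMap.add_apply]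
        rw [← intervalIntegral.integral_add ((hc g t).intervalIntegrable _ _)
          ((hc g' t).intervalIntegrable _ _)]
        simp [IccExtend]
      map_smul' := fun c g => by
        ext t
        simp only [ContinuousMap.coe_mk, ContinuousMap.smul_apply, RingHom.id_apply]
        rw [← intervalIntegral.integral_smul]
        simp [IccExtend] } <| by
    obtain ⟨M, hM, hb⟩ := h.exists_bound T
    refine ⟨M * T, fun g => (ContinuousMap.norm_le _ (by positivity)).2 fun t => ?_⟩
    have := intervalIntegral.norm_integral_le_of_norm_le_const (a := 0) (b := (t : ℝ))
      (f := fun s => S (max (t - s) 0) (IccExtend hT g s)) (C := M * ‖g‖) (fun s hs => by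
        rw [uIoc_of_le t.2.1] at hs
        refine ((S _).le_opNorm _).trans ?_
        gcongr
        · refine hb _ ⟨le_max_right _ _, max_le ?_ hT⟩
          linarith [hs.1, t.2.2]
        · exact g.norm_coe_le_norm _)
    rw [sub_zero, abs_of_nonneg t.2.1] at this
    calc _ ≤ M * ‖g‖ * t := this
      _ ≤ M * ‖g‖ * T := by gcongr; exact t.2.2
      _ = _ := by ring

theorem duhamelOp_apply (h : IsC0SemigroupWithGenerator S G) {T : ℝ} (hT : 0 ≤ T)
    (g : C(Icc (0 : ℝ) T, H)) (t : Icc (0 : ℝ) T) :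
    h.duhamelOp hT g t = ∫ s in (0 : ℝ)..t, S (max (t - s) 0) (IccExtend hT g s) := rfl

/-- Multiplication by `e^{-l s}`. -/
noncomputable def expWeight (H : Type*) [NormedAddCommGroup H] [NormedSpace ℝ H] (T l : ℝ) :
    C(Icc (0 : ℝ) T, H) →L[ℝ] C(Icc (0 : ℝ) T, H) :=
  ContinuousMap.pointwiseApply (Icc (0 : ℝ) T) H H
    ⟨fun s => Real.exp (-l * s) • ContinuousLinearMap.id ℝ H, by fun_prop⟩

theorem expWeight_apply (T l : ℝ) (g : C(Icc (0 : ℝ) T, H)) (s : Icc (0 : ℝ) T) :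
    expWeight H T l g s = Real.exp (-l * s) • g s := rfl

theorem expWeight_neg_apply (T l : ℝ) (g : C(Icc (0 : ℝ) T, H)) :
    expWeight H T (-l) (expWeight H T l g) = g := by
  ext s
  rw [expWeight_apply, expWeight_apply, smul_smul, ← Real.exp_add]
  simp

/-- In a norm with a large exponential weight the Duhamel operator is small. -/
theorem weighted_duhamel_le (h : IsC0SemigroupWithGenerator S G) {T : ℝ} (hT : 0 ≤ T) {M l : ℝ}
    (hl : 0 < l) (hM : ∀ t ∈ Icc (0 : ℝ) T, ‖S t‖ ≤ M)
    (g : C(Icc (0 : ℝ) T, H)) {c : ℝ} (hc : 0 ≤ c) (hg : ∀ s, ‖g s‖ ≤ Real.exp (l * s) * c) :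
    ‖expWeight H T l (h.duhamelOp hT g)‖ ≤ M / l * c := by
  have hM0 : 0 ≤ M := (norm_nonneg _).trans (hM 0 ⟨le_rfl, hT⟩)
  refine (ContinuousMap.norm_le _ (by positivity)).2 fun t => ?_
  rw [expWeight_apply, duhamelOp_apply, norm_smul, Real.norm_eq_abs, Real.abs_exp]
  have h1 : ‖∫ s in (0 : ℝ)..t, S (max (t - s) 0) (IccExtend hT g s)‖
      ≤ ∫ s in (0 : ℝ)..t, M * c * Real.exp (l * s) := by
    refine intervalIntegral.norm_integral_le_of_norm_le t.2.1 (MeasureTheory.ae_of_all _ ?_)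
      (Continuous.intervalIntegrable (by fun_prop) _ _)
    intro s hs
    refine ((S _).le_opNorm _).trans ?_
    have h2 : ‖S (max (t - s) 0)‖ ≤ M := hM _ ⟨le_max_right _ _, max_le
      (by linarith [hs.1, t.2.2]) hT⟩
    have hs' : s ∈ Icc (0 : ℝ) T := ⟨hs.1.le, hs.2.trans t.2.2⟩
    have h3 : ‖IccExtend hT g s‖ ≤ Real.exp (l * s) * c := by
      rw [IccExtend_of_mem hT g hs']; exact hg ⟨s, hs'⟩
    calc _ ≤ M * (Real.exp (l * s) * c) := by gcongr
      _ = _ := by ring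
  have h2 : ∫ s in (0 : ℝ)..t, M * c * Real.exp (l * s) = M * c * ((Real.exp (l * t) - 1) / l) := by
    rw [intervalIntegral.integral_const_mul,
      intervalIntegral.integral_comp_mul_left (fun x => Real.exp x) hl.ne', integral_exp]
    simp [div_eq_inv_mul]
  rw [h2] at h1
  calc _ ≤ Real.exp (-l * t) * (M * c * ((Real.exp (l * t) - 1) / l)) := by gcongr
    _ = M / l * c * (Real.exp (-l * t) * Real.exp (l * t) - Real.exp (-l * t)) := by
        field_simp
    _ ≤ M / l * c * 1 := by
        gcongr
        rw [← Real.exp_add]; simp [Real.exp_nonneg]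
    _ = _ := mul_one _

-- Conjugation by the weight `e^{-ls}` turns the Duhamel term into a map `B` with Lipschitz constant
-- `1/2` on the whole of `[0, T]`. Then `id - B` is a global homeomorphism with invertible
-- derivatives, and its inverse is as smooth as `B`. Existence, uniqueness and smooth dependence
-- come out together.
open ContinuousMap in
theorem exists_solutionMap (h : IsC0SemigroupWithGenerator S G) {T : ℝ} (hT : 0 ≤ T)
    {N : C(H, H)} (hN : ContDiff ℝ 3 N) {K : ℝ≥0} (hK : LipschitzWith K N) :
    ∃ X : H → C(Icc (0 : ℝ) T, H), ContDiff ℝ 3 X ∧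
      ∀ v x, X v = x ↔ x = h.orbitMap T v + h.duhamelOp hT (superpose _ N x) := by
  obtain ⟨M, hM, hb⟩ := h.exists_bound T
  -- With this weight the Lipschitz constant `M * K / l` of the conjugated Duhamel term is at most
  -- `1/2`.
  set l : ℝ := 2 * M * K + 1 with hl
  have hl0 : 0 < l := by positivity
  let W := expWeight H T l
  let W' := expWeight H T (-l)
  have hWW' : ∀ g, W (W' g) = g := fun g => by
    have := expWeight_neg_apply T (-l) g; rwa [neg_neg] at this
  have hW'W : ∀ g, W' (W g) = g := fun g => expWeight_neg_apply T l g
  let B : C(Icc (0 : ℝ) T, H) → C(Icc (0 : ℝ) T, H) := fun y =>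
    W (h.duhamelOp hT (superpose _ N (W' y)))
  have hBsmooth : ContDiff ℝ 3 B :=
    W.contDiff.comp ((h.duhamelOp hT).contDiff.comp
      ((contDiff_superpose 3 N hN).comp W'.contDiff))
  have hBlip : LipschitzWith (1 / 2) B := by
    refine LipschitzWith.of_dist_le_mul fun y y' => ?_
    rw [dist_eq_norm, dist_eq_norm]
    have e : B y - B y' = W (h.duhamelOp hT (superpose _ N (W' y) - superpose _ N (W' y'))) := by
      simp only [B, map_sub]
    rw [e]
    refine (h.weighted_duhamel_le hT hl0 hb _ (c := K * ‖y - y'‖) (by positivity) ?_).trans ?_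
    · intro s
      have h1 := hK.dist_le_mul (W' y s) (W' y' s)
      rw [dist_eq_norm, dist_eq_norm] at h1
      refine h1.trans ?_
      have h2 : W' y s - W' y' s = Real.exp (l * s) • (y - y') s := by
        simp only [W', expWeight_apply, neg_neg, ContinuousMap.sub_apply, smul_sub]
      rw [h2, norm_smul, Real.norm_eq_abs, Real.abs_exp]
      calc _ ≤ K * (Real.exp (l * s) * ‖y - y'‖) := by
            gcongr; exact (y - y').norm_coe_le_norm s
        _ = _ := by ring
    · rw [← mul_assoc]
      refine mul_le_mul_of_nonneg_right ?_ (norm_nonneg _)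
      rw [div_mul_eq_mul_div, div_le_iff₀ hl0, hl]
      push_cast
      linarith
  have happ : ApproximatesLinearOn (fun y => y - B y)
      ((ContinuousLinearEquiv.refl ℝ C(Icc (0 : ℝ) T, H) :
        C(Icc (0 : ℝ) T, H) ≃L[ℝ] C(Icc (0 : ℝ) T, H)) :
        C(Icc (0 : ℝ) T, H) →L[ℝ] C(Icc (0 : ℝ) T, H))
      univ (1 / 2) := by
    intro y _ y' _
    have := hBlip.dist_le_mul y y'
    rw [dist_eq_norm, dist_eq_norm] at this
    refine le_trans (le_of_eq ?_) this
    rw [← norm_neg]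
    congr 1
    simp only [ContinuousLinearEquiv.coe_refl, ContinuousLinearMap.coe_id', id_eq]
    abel
  have hsmall : Subsingleton C(Icc (0 : ℝ) T, H) ∨ (1 / 2 : ℝ≥0) <
      ‖(((ContinuousLinearEquiv.refl ℝ C(Icc (0 : ℝ) T, H)).symm :
        C(Icc (0 : ℝ) T, H) ≃L[ℝ] C(Icc (0 : ℝ) T, H)) :
        C(Icc (0 : ℝ) T, H) →L[ℝ] C(Icc (0 : ℝ) T, H))‖₊⁻¹ := by
    rcases subsingleton_or_nontrivial C(Icc (0 : ℝ) T, H) with hs | hs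
    · exact Or.inl hs
    · right
      have : ‖(((ContinuousLinearEquiv.refl ℝ C(Icc (0 : ℝ) T, H)).symm :
        C(Icc (0 : ℝ) T, H) ≃L[ℝ] C(Icc (0 : ℝ) T, H)) :
        C(Icc (0 : ℝ) T, H) →L[ℝ] C(Icc (0 : ℝ) T, H))‖₊ = 1 := by
        ext
        exact ContinuousLinearMap.norm_id
      rw [this, inv_one]
      exact NNReal.half_lt_self one_ne_zero
  let Fh : C(Icc (0 : ℝ) T, H) ≃ₜ C(Icc (0 : ℝ) T, H) := happ.toHomeomorph _ hsmall
  have hFh : ∀ y, Fh y = y - B y := fun y => rfl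
  have hderiv : ∀ y, ∃ f' : C(Icc (0 : ℝ) T, H) ≃L[ℝ] C(Icc (0 : ℝ) T, H),
      HasFDerivAt Fh (f' : C(Icc (0 : ℝ) T, H) →L[ℝ] C(Icc (0 : ℝ) T, H)) y := by
    intro y
    have hn : ‖fderiv ℝ B y‖ < 1 := by
      have := norm_fderiv_le_of_lipschitz ℝ hBlip (x₀ := y)
      refine this.trans_lt ?_
      norm_num
    refine ⟨ContinuousLinearEquiv.ofUnit (Units.oneSub (fderiv ℝ B y) hn), ?_⟩
    exact (hasFDerivAt_id y).sub (hBsmooth.differentiable (by norm_num) y).hasFDerivAt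
  choose f' hf' using hderiv
  have hsymm : ContDiff ℝ 3 Fh.symm :=
    Fh.contDiff_symm hf' (contDiff_id.sub hBsmooth)
  refine ⟨fun v => W' (Fh.symm (W (h.orbitMap T v))), ?_, ?_⟩
  · exact W'.contDiff.comp (hsymm.comp (W.contDiff.comp (h.orbitMap T).contDiff))
  · intro v x
    constructor
    · intro hx
      have h1 : Fh.symm (W (h.orbitMap T v)) = W x := by rw [← hx, hWW']
      have h2 : W (h.orbitMap T v) = Fh (W x) := by rw [← h1, Fh.apply_symm_apply]
      rw [hFh, eq_sub_iff_add_eq] at h2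
      have h3 := congrArg W' h2
      simp only [B, map_add, hW'W] at h3
      exact h3.symm
    · intro hx
      have h2 : W (h.orbitMap T v) = Fh (W x) := by
        rw [hFh, eq_sub_iff_add_eq]
        simp only [B, hW'W]
        rw [← map_add, ← hx]
      change W' (Fh.symm (W (h.orbitMap T v))) = x
      rw [h2, Fh.symm_apply_apply, hW'W]

end IsC0SemigroupWithGenerator

/-- `x` is the mild solution of `dx/dt = G x + N x`, `x 0 = v`, where `G` generates `S`. -/
def IsMild {H : Type*} [NormedAddCommGroup H] [NormedSpace ℝ H] (S : ℝ → H →L[ℝ] H)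
    (N : H → H) (v : H) (x : ℝ → H) : Prop :=
  ContinuousOn x (Ici 0) ∧
    ∀ t : ℝ, 0 ≤ t → x t = S t v + ∫ s in (0 : ℝ)..t, S (t - s) (N (x s))

/-- `Φ` is the semiflow of mild solutions of `dx/dt = G x + N x`, where `G` generates `S`. -/
structure IsMildFlow {H : Type*} [NormedAddCommGroup H] [NormedSpace ℝ H] (S : ℝ → H →L[ℝ] H)
    (N : H → H) (Φ : ℝ → H → H) : Prop where
  mild : ∀ v, IsMild S N v fun t => Φ t v
  unique : ∀ v x, IsMild S N v x → ∀ t, 0 ≤ t → x t = Φ t v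

/-! ### The semiflow of mild solutions and its derivatives -/

section MildFlow

variable {H : Type*} [NormedAddCommGroup H] [NormedSpace ℝ H] [CompleteSpace H]
  {S : ℝ → H →L[ℝ] H} {G : H → H → Prop}

namespace IsC0SemigroupWithGenerator

theorem convolution_add (h : IsC0SemigroupWithGenerator S G) {g : ℝ → H} (hg : Continuous g)
    {a t : ℝ} (ha : 0 ≤ a) (ht : 0 ≤ t) :
    ∫ s in (0 : ℝ)..(a + t), S (a + t - s) (g s)
      = S t (∫ s in (0 : ℝ)..a, S (a - s) (g s)) + ∫ s in (0 : ℝ)..t, S (t - s) (g (a + s)) := by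
  have hc : Continuous fun s => S (max (a + t - s) 0) (g s) :=
    h.continuous_comp (by fun_prop) hg
  have hc' : Continuous fun s => S (max (a - s) 0) (g s) :=
    h.continuous_comp (by fun_prop) hg
  rw [integral_max S g (by positivity : 0 ≤ a + t), integral_max S g ha,
    ← intervalIntegral.integral_add_adjacent_intervals (hc.intervalIntegrable 0 a)
      (hc.intervalIntegrable a (a + t)),
    ← ContinuousLinearMap.intervalIntegral_comp_comm _ (hc'.intervalIntegrable _ _)]
  congr 1
  · refine intervalIntegral.integral_congr fun s hs => ?_
    rw [uIcc_of_le ha] at hs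
    rw [max_eq_left (by linarith [hs.2]), max_eq_left (by linarith [hs.2]),
      ← h.apply_add ht (by linarith [hs.2])]
    congr 2; ring
  · have := intervalIntegral.integral_comp_add_left (a := 0) (b := t)
      (fun s => S (max (a + t - s) 0) (g s)) a
    rw [add_zero] at this
    rw [← this]
    refine intervalIntegral.integral_congr fun s hs => ?_
    rw [uIcc_of_le ht] at hs
    rw [max_eq_left (by linarith [hs.2])]
    congr 2; ring

end IsC0SemigroupWithGenerator

theorem integral_congr_max {S : ℝ → H →L[ℝ] H} {x : ℝ → H} {N : H → H} {t : ℝ} (ht : 0 ≤ t) :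
    ∫ s in (0 : ℝ)..t, S (t - s) (N (x s)) = ∫ s in (0 : ℝ)..t, S (t - s) (N (x (max s 0))) := by
  refine intervalIntegral.integral_congr fun s hs => ?_
  rw [uIcc_of_le ht] at hs
  rw [max_eq_left hs.1]

theorem ContinuousOn.comp_max {x : ℝ → H} (hx : ContinuousOn x (Ici 0)) :
    Continuous fun s => x (max s 0) :=
  hx.comp_continuous (by fun_prop) fun s => le_max_right s 0

theorem IsMild.shift {N : H → H} {v : H} {x : ℝ → H} (hx : IsMild S N v x)
    (h : IsC0SemigroupWithGenerator S G) (hN : Continuous N) {a : ℝ} (ha : 0 ≤ a) :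
    IsMild S N (x a) fun t => x (a + t) := by
  have hg : Continuous fun s => N (x (max s 0)) := hN.comp hx.1.comp_max
  refine ⟨hx.1.comp (by fun_prop) fun t ht => add_nonneg ha ht, fun t ht => ?_⟩
  beta_reduce
  rw [hx.2 (a + t) (add_nonneg ha ht), hx.2 a ha, integral_congr_max (add_nonneg ha ht),
    integral_congr_max ha, h.convolution_add hg ha ht, map_add, add_comm a t, h.apply_add ht ha,
    add_assoc]
  congr 2
  refine intervalIntegral.integral_congr fun s hs => ?_
  rw [uIcc_of_le ht] at hs
  rw [max_eq_left (add_nonneg ha hs.1)]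

theorem HasFDerivAt.apply_const {E F E' : Type*} [NormedAddCommGroup E] [NormedSpace ℝ E]
    [NormedAddCommGroup F] [NormedSpace ℝ F] [NormedAddCommGroup E'] [NormedSpace ℝ E']
    {A : E → F →L[ℝ] E'} {A' : E →L[ℝ] F →L[ℝ] E'} {x : E} (hA : HasFDerivAt A A' x) (l : F) :
    HasFDerivAt (fun y => A y l) (A'.flip l) x :=
  (ContinuousLinearMap.apply ℝ E' l).hasFDerivAt.comp x hA

section Flow
variable {N : C(H, H)} {K : ℝ≥0}

theorem solutionMap_eq_of_mild (h : IsC0SemigroupWithGenerator S G) {T : ℝ} (hT : 0 ≤ T)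
    {X : H → C(Icc (0 : ℝ) T, H)}
    (hX : ∀ v x, X v = x ↔ x = h.orbitMap T v + h.duhamelOp hT (ContinuousMap.superpose _ N x))
    {v : H} {x : ℝ → H} (hx : ContinuousOn x (Icc 0 T))
    (hx' : ∀ t ∈ Icc (0 : ℝ) T, x t = S t v + ∫ s in (0 : ℝ)..t, S (t - s) (N (x s)))
    (t : Icc (0 : ℝ) T) : X v t = x t := by
  let y : C(Icc (0 : ℝ) T, H) := ⟨fun t => x t, hx.domRestrict⟩
  suffices X v = y by rw [this]; rfl
  rw [hX]
  ext t
  simp only [ContinuousMap.add_apply, h.orbitMap_apply, h.duhamelOp_apply]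
  change x t = _
  rw [hx' t t.2]
  congr 1
  refine intervalIntegral.integral_congr fun s hs => ?_
  rw [uIcc_of_le t.2.1] at hs
  have hs' : s ∈ Icc (0 : ℝ) T := ⟨hs.1, hs.2.trans t.2.2⟩
  rw [max_eq_left (by linarith [hs.2]), IccExtend_of_mem hT _ hs']
  rfl

theorem solutionMap_apply (h : IsC0SemigroupWithGenerator S G) {T : ℝ} (hT : 0 ≤ T)
    {X : H → C(Icc (0 : ℝ) T, H)}
    (hX : ∀ v, X v = h.orbitMap T v + h.duhamelOp hT (ContinuousMap.superpose _ N (X v)))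
    (v : H) {t : ℝ} (ht : t ∈ Icc (0 : ℝ) T) :
    IccExtend hT (X v) t = S t v + ∫ s in (0 : ℝ)..t, S (t - s) (N (IccExtend hT (X v) s)) := by
  rw [IccExtend_of_mem hT _ ht]
  conv_lhs => rw [hX v]
  simp only [ContinuousMap.add_apply, h.orbitMap_apply, h.duhamelOp_apply]
  congr 1
  refine intervalIntegral.integral_congr fun s hs => ?_
  rw [uIcc_of_le ht.1] at hs
  rw [max_eq_left (by linarith [hs.2])]
  rfl

theorem exists_mildFlow (h : IsC0SemigroupWithGenerator S G) (hN : ContDiff ℝ 3 N)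
    (hK : LipschitzWith K N) :
    ∃ Φ : ℝ → H → H, IsMildFlow S N Φ := by
  have hex := fun (T : ℝ) (hT : 0 ≤ T) => h.exists_solutionMap hT hN hK
  choose X hXs hX using hex
  have hXv := fun T hT v => (hX T hT v _).1 rfl
  have hres : ∀ (T : ℝ) (hT : 0 ≤ T) (v : H) (t : ℝ) (ht : t ∈ Icc (0 : ℝ) T),
      X t ht.1 v ⟨t, ht.1, le_rfl⟩ = IccExtend hT (X T hT v) t := by
    intro T hT v t ht
    refine solutionMap_eq_of_mild h ht.1 (hX t ht.1) (v := v) (x := IccExtend hT (X T hT v))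
      (IsC0SemigroupWithGenerator.continuous_IccExtend hT _).continuousOn (fun s hs => ?_) ⟨t, ht.1, le_rfl⟩
    exact solutionMap_apply h hT (hXv T hT) v ⟨hs.1, hs.2.trans ht.2⟩
  -- The value at time `t` is the end value of the solution on `[0, t]`; by uniqueness the solution
  -- on any longer interval gives the same value, which is `hΦ`. Negative times are sent to `0`.
  let Φ : ℝ → H → H := fun t v => X (max t 0) (le_max_right _ _) v
    ⟨max t 0, le_max_right _ _, le_rfl⟩
  have hΦ : ∀ (T : ℝ) (hT : 0 ≤ T) (v : H) (t : ℝ), t ∈ Icc (0 : ℝ) T →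
      Φ t v = IccExtend hT (X T hT v) t := by
    intro T hT v t ht
    have hm : max t 0 = t := max_eq_left ht.1
    have := hres T hT v (max t 0) (by rwa [hm])
    simp only [Φ]
    rw [this, hm]
  refine ⟨Φ, fun v => ⟨fun t₀ ht₀ => ?_, fun t ht => ?_⟩, fun v x hx t ht => ?_⟩
  · have ht₀ : 0 ≤ t₀ := ht₀
    have hT : 0 ≤ t₀ + 1 := by linarith
    refine ((IsC0SemigroupWithGenerator.continuous_IccExtend hT (X _ hT v)).continuousWithinAt).congr_of_eventuallyEq ?_
      (hΦ _ hT v t₀ ⟨ht₀, by linarith⟩)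
    filter_upwards [self_mem_nhdsWithin, mem_nhdsWithin_of_mem_nhds (Iio_mem_nhds
      (by linarith : t₀ < t₀ + 1))] with t h1 h2
    exact hΦ _ hT v t ⟨h1, le_of_lt h2⟩
  · change Φ t v = _
    rw [hΦ t ht v t ⟨ht, le_rfl⟩, solutionMap_apply h ht (hXv t ht) v ⟨ht, le_rfl⟩]
    congr 1
    refine intervalIntegral.integral_congr fun s hs => ?_
    rw [uIcc_of_le ht] at hs
    beta_reduce
    rw [hΦ t ht v s hs]
  · rw [hΦ t ht v t ⟨ht, le_rfl⟩, IccExtend_of_mem ht _ ⟨ht, le_rfl⟩]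
    exact (solutionMap_eq_of_mild h ht (hX t ht) (hx.1.mono Icc_subset_Ici_self)
      (fun s hs => hx.2 s hs.1) ⟨t, ht, le_rfl⟩).symm

namespace IsMildFlow
variable {Φ : ℝ → H → H}

theorem apply_zero (hΦ : IsMildFlow S N Φ) (h : IsC0SemigroupWithGenerator S G) (v : H) :
    Φ 0 v = v := by
  have := (hΦ.mild v).2 0 le_rfl
  simpa [h.apply_zero] using this

theorem apply_add (hΦ : IsMildFlow S N Φ) (h : IsC0SemigroupWithGenerator S G) {s t : ℝ}
    (hs : 0 ≤ s) (ht : 0 ≤ t) (v : H) : Φ (s + t) v = Φ t (Φ s v) :=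
  hΦ.unique _ _ ((hΦ.mild v).shift h N.continuous hs) t ht

/-- On a bounded time interval the solution, as a continuous function, is a smooth function of
the initial value. -/
theorem exists_solutionMap (hΦ : IsMildFlow S N Φ) (h : IsC0SemigroupWithGenerator S G)
    (hN : ContDiff ℝ 3 N) (hK : LipschitzWith K N) {T : ℝ} (hT : 0 ≤ T) :
    ∃ X : H → C(Icc (0 : ℝ) T, H), ContDiff ℝ 3 X ∧
      (∀ v, X v = h.orbitMap T v + h.duhamelOp hT (ContinuousMap.superpose _ N (X v))) ∧
      ∀ v (t : Icc (0 : ℝ) T), X v t = Φ t v := by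
  obtain ⟨X, hXs, hX⟩ := h.exists_solutionMap hT hN hK
  refine ⟨X, hXs, fun v => (hX v _).1 rfl, fun v t => ?_⟩
  exact solutionMap_eq_of_mild h hT hX ((hΦ.mild v).1.mono Icc_subset_Ici_self)
      (fun s hs => (hΦ.mild v).2 s hs.1) t

theorem contDiff (hΦ : IsMildFlow S N Φ) (h : IsC0SemigroupWithGenerator S G)
    (hN : ContDiff ℝ 3 N) (hK : LipschitzWith K N) {T : ℝ} (hT : 0 ≤ T) :
    ContDiff ℝ 3 (Φ T) := by
  obtain ⟨X, hXs, -, hX⟩ := hΦ.exists_solutionMap h hN hK hT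
  have : Φ T = fun v => ContinuousMap.evalCLM ℝ (⟨T, hT, le_rfl⟩ : Icc (0 : ℝ) T) (X v) := by
    ext v; exact (hX v ⟨T, hT, le_rfl⟩).symm
  rw [this]
  exact (ContinuousMap.evalCLM ℝ _).contDiff.comp hXs

/-- Uniformity over `[0, T]` is what later upgrades convergence along the times `n * T` to
convergence of the whole orbit. -/
theorem eventually_forall_dist_lt (hΦ : IsMildFlow S N Φ) (h : IsC0SemigroupWithGenerator S G)
    (hN : ContDiff ℝ 3 N) (hK : LipschitzWith K N) {T : ℝ} (hT : 0 ≤ T) (z : H) {ε : ℝ}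
    (hε : 0 < ε) : ∀ᶠ v in 𝓝 z, ∀ t ∈ Icc (0 : ℝ) T, dist (Φ t v) (Φ t z) < ε := by
  obtain ⟨X, hXs, -, hX⟩ := hΦ.exists_solutionMap h hN hK hT
  filter_upwards [Metric.tendsto_nhds.1 (hXs.continuous.tendsto z) ε hε] with v hv t ht
  rw [← hX v ⟨t, ht⟩, ← hX z ⟨t, ht⟩]
  exact (ContinuousMap.dist_apply_le_dist _).trans_lt hv

open ContinuousMap in
/-- The first two derivatives of the flow at a rest point at which the nonlinearity has no linear
part. -/
theorem fderiv_at_zero (hΦ : IsMildFlow S N Φ) (h : IsC0SemigroupWithGenerator S G)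
    (hN : ContDiff ℝ 3 N) (hK : LipschitzWith K N) (hN0 : N 0 = 0) (hN1 : fderiv ℝ N 0 = 0)
    {T : ℝ} (hT : 0 ≤ T) :
    fderiv ℝ (Φ T) 0 = S T ∧ ∀ w w', fderiv ℝ (fderiv ℝ (Φ T)) 0 w w'
      = ∫ s in (0 : ℝ)..T, S (T - s) (fderiv ℝ (fderiv ℝ N) 0 (S s w) (S s w')) := by
  obtain ⟨X, hXs, hX, hXΦ⟩ := hΦ.exists_solutionMap h hN hK hT
  let 𝒩 : C(Icc (0 : ℝ) T, H) → C(Icc (0 : ℝ) T, H) := superpose _ N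
  have h𝒩 : ContDiff ℝ 3 𝒩 := contDiff_superpose 3 N hN
  have hD𝒩 : ContDiff ℝ 2 (fderiv ℝ 𝒩) := h𝒩.fderiv_right (by norm_num)
  have hDX : ContDiff ℝ 2 (fderiv ℝ X) := hXs.fderiv_right (by norm_num)
  let ev : Icc (0 : ℝ) T → C(Icc (0 : ℝ) T, H) →L[ℝ] H := fun s => evalCLM ℝ s
  have hdN : ∀ x, HasFDerivAt N (fderiv ℝ N x) x := fun x =>
    (hN.differentiable (by norm_num) x).hasFDerivAt
  have hd𝒩 : ∀ x, HasFDerivAt 𝒩 (fderiv ℝ 𝒩 x) x := fun x =>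
    (h𝒩.differentiable (by norm_num) x).hasFDerivAt
  have hdX : ∀ x, HasFDerivAt X (fderiv ℝ X x) x := fun x =>
    (hXs.differentiable (by norm_num) x).hasFDerivAt
  -- Derivatives of the superposition operator are identified by composing with evaluation at `s`,
  -- which is linear and turns it into `N` itself.
  have e1 : ∀ x k s, fderiv ℝ 𝒩 x k s = fderiv ℝ N (x s) (k s) := by
    intro x k s
    have a1 : HasFDerivAt (fun x => ev s (𝒩 x)) ((ev s).comp (fderiv ℝ 𝒩 x)) x :=
      (ev s).hasFDerivAt.comp x (hd𝒩 x)
    have a2 : HasFDerivAt (fun x => N (ev s x)) ((fderiv ℝ N (x s)).comp (ev s)) x :=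
      (hdN (x s)).comp x (ev s).hasFDerivAt
    exact congrArg (fun A : C(Icc (0 : ℝ) T, H) →L[ℝ] H => A k) (a1.unique a2)
  have e2 : ∀ x k l s, fderiv ℝ (fderiv ℝ 𝒩) x k l s
      = fderiv ℝ (fderiv ℝ N) (x s) (k s) (l s) := by
    intro x k l s
    have a1 : HasFDerivAt (fun x => ev s (fderiv ℝ 𝒩 x l))
        ((ev s).comp ((fderiv ℝ (fderiv ℝ 𝒩) x).flip l)) x :=
      (ev s).hasFDerivAt.comp x
        ((hD𝒩.differentiable (by norm_num) x).hasFDerivAt.apply_const l)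
    have a2 : HasFDerivAt (fun x => fderiv ℝ N (ev s x) (l s))
        ((((fderiv ℝ (fderiv ℝ N) (x s)).comp (ev s)).flip (l s))) x := by
      have hDN : ContDiff ℝ 2 (fderiv ℝ N) := hN.fderiv_right (by norm_num)
      exact ((hDN.differentiable (by norm_num) (ev s x)).hasFDerivAt.comp x
        (ev s).hasFDerivAt).apply_const (l s)
    have a3 : (fun x => ev s (fderiv ℝ 𝒩 x l)) = fun x => fderiv ℝ N (ev s x) (l s) :=
      funext fun x => e1 x l s
    rw [a3] at a1
    exact congrArg (fun A : C(Icc (0 : ℝ) T, H) →L[ℝ] H => A k) (a1.unique a2)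
  have hX0 : X 0 = 0 := by
    ext t
    rw [hXΦ]
    refine (hΦ.unique 0 (fun _ => 0) ⟨continuousOn_const, fun t ht => ?_⟩ t t.2.1).symm
    simp [hN0]
  have e𝒩0 : fderiv ℝ 𝒩 0 = 0 := by
    ext k s
    rw [e1]; simp [hN1]
  -- The fixed-point equation for `X` is differentiated. At `0` the derivative of the superposition
  -- operator vanishes, so only the linear orbit survives at first order and a single Duhamel term
  -- at second order.
  have hfX : ∀ v, fderiv ℝ X v = h.orbitMap T
      + (h.duhamelOp hT).comp ((fderiv ℝ 𝒩 (X v)).comp (fderiv ℝ X v)) := by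
    intro v
    have a1 : HasFDerivAt (fun v => h.orbitMap T v + h.duhamelOp hT (𝒩 (X v)))
        (h.orbitMap T
          + (h.duhamelOp hT).comp ((fderiv ℝ 𝒩 (X v)).comp (fderiv ℝ X v))) v :=
      (h.orbitMap T).hasFDerivAt.add
        ((h.duhamelOp hT).hasFDerivAt.comp v ((hd𝒩 (X v)).comp v (hdX v)))
    have a2 : X = fun v => h.orbitMap T v + h.duhamelOp hT (𝒩 (X v)) := funext hX
    rw [← a2] at a1
    exact a1.fderiv
  have hfX0 : fderiv ℝ X 0 = h.orbitMap T := by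
    rw [hfX, hX0, e𝒩0]; simp
  have hffX : ∀ w w', fderiv ℝ (fderiv ℝ X) 0 w w'
      = h.duhamelOp hT (fderiv ℝ (fderiv ℝ 𝒩) 0 (h.orbitMap T w) (h.orbitMap T w')) := by
    intro w w'
    have a0 : HasFDerivAt (fun v => fderiv ℝ 𝒩 (X v))
        ((fderiv ℝ (fderiv ℝ 𝒩) 0).comp (h.orbitMap T)) 0 := by
      have := (hD𝒩.differentiable (by norm_num) (X 0)).hasFDerivAt.comp 0 (hdX 0)
      rwa [hX0, hfX0] at this
    have a1 := a0.clm_comp (hDX.differentiable (by norm_num) 0).hasFDerivAt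
    have a2 : HasFDerivAt (fun v => h.orbitMap T w'
        + h.duhamelOp hT (((fderiv ℝ 𝒩 (X v)).comp (fderiv ℝ X v)) w')) _ 0 :=
      ((h.duhamelOp hT).hasFDerivAt.comp 0 (a1.apply_const w')).const_add _
    have a3 : (fun v => fderiv ℝ X v w') = (fun v => h.orbitMap T w'
        + h.duhamelOp hT (((fderiv ℝ 𝒩 (X v)).comp (fderiv ℝ X v)) w')) := by
      ext1 v
      conv_lhs => rw [hfX v]
      simp
    rw [← a3] at a2
    have a4 := (hDX.differentiable (by norm_num) 0).hasFDerivAt.apply_const w'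
    have := congrArg (fun A : H →L[ℝ] C(Icc (0 : ℝ) T, H) => A w) (a4.unique a2)
    simpa [e𝒩0, hX0, hfX0] using this
  let τ : Icc (0 : ℝ) T := ⟨T, hT, le_rfl⟩
  have hΦT : Φ T = fun v => ev τ (X v) := by
    ext v; exact (hXΦ v τ).symm
  have hfΦ : ∀ v, fderiv ℝ (Φ T) v = (ev τ).comp (fderiv ℝ X v) := by
    intro v
    rw [hΦT]
    exact ((ev τ).hasFDerivAt.comp v (hdX v)).fderiv
  refine ⟨by rw [hfΦ, hfX0]; rfl, fun w w' => ?_⟩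
  have : fderiv ℝ (Φ T) = fun v => (ev τ).comp (fderiv ℝ X v) := funext hfΦ
  rw [this]
  have b1 := (hasFDerivAt_const (ev τ) (0 : H)).clm_comp
    (hDX.differentiable (by norm_num) 0).hasFDerivAt
  rw [b1.fderiv]
  have : ev τ (fderiv ℝ (fderiv ℝ X) 0 w w') = ∫ s in (0 : ℝ)..T,
      S (T - s) (fderiv ℝ (fderiv ℝ N) 0 (S s w) (S s w')) := by
    rw [hffX]
    change h.duhamelOp hT _ τ = _
    rw [h.duhamelOp_apply]
    refine intervalIntegral.integral_congr fun s hs => ?_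
    rw [uIcc_of_le hT] at hs
    rw [IccExtend_of_mem hT _ hs, e2, max_eq_left]
    · rfl
    · simp only [τ]; linarith [hs.2]
  simpa using this

end IsMildFlow
end Flow

end MildFlow

/-! ### Bounded perturbations of generators and variation of constants -/

open MeasureTheory in
theorem integral_triangle_swap {E : Type*} [NormedAddCommGroup E] [NormedSpace ℝ E]
    {F : ℝ → ℝ → E} (hF : Continuous (Function.uncurry F)) {t : ℝ} (ht : 0 ≤ t) :
    ∫ s in (0 : ℝ)..t, ∫ r in (0 : ℝ)..s, F s r = ∫ r in (0 : ℝ)..t, ∫ s in r..t, F s r := by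
  let A : ℝ → ℝ → E := fun s r => indicator {r | r ≤ s} (F s) r
  have hA : A.uncurry = indicator {p : ℝ × ℝ | p.2 ≤ p.1} F.uncurry := by
    ext p
    simp [A, indicator, Function.uncurry]
  have hint : IntegrableOn A.uncurry (uIoc 0 t ×ˢ uIoc 0 t) := by
    rw [hA, uIoc_of_le ht]
    refine Integrable.indicator ?_ (measurableSet_le measurable_snd measurable_fst)
    refine IntegrableOn.mono_set (t := Icc 0 t ×ˢ Icc 0 t) ?_
      (prod_mono Ioc_subset_Icc_self Ioc_subset_Icc_self)
    exact hF.continuousOn.integrableOn_compact (isCompact_Icc.prod isCompact_Icc)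
  have h1 : ∫ s in (0 : ℝ)..t, ∫ r in (0 : ℝ)..s, F s r
      = ∫ s in (0 : ℝ)..t, ∫ r in (0 : ℝ)..t, A s r := by
    refine intervalIntegral.integral_congr fun s hs => ?_
    rw [uIcc_of_le ht] at hs
    exact (intervalIntegral.integral_indicator hs).symm
  rw [h1, intervalIntegral_intervalIntegral_swap hint]
  refine intervalIntegral.integral_congr_ae (ae_of_all _ fun r hr => ?_)
  rw [uIoc_of_le ht] at hr
  have h2 : (fun s => A s r) = indicator (Ici r) (fun s => F s r) := by
    ext s
    simp [A, indicator]
  rw [h2, intervalIntegral.integral_of_le ht, setIntegral_indicator measurableSet_Ici,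
    intervalIntegral.integral_of_le hr.2, ← integral_Icc_eq_integral_Ioc]
  congr 2
  ext s
  simp only [mem_inter_iff, mem_Ioc, mem_Ici, mem_Icc]
  constructor
  · rintro ⟨⟨_, h⟩, h'⟩; exact ⟨h', h⟩
  · rintro ⟨h, h'⟩; exact ⟨⟨hr.1.trans_le h, h'⟩, h⟩

section Perturbation
variable {H : Type*} [NormedAddCommGroup H] [NormedSpace ℝ H] [CompleteSpace H]
  {S U : ℝ → H →L[ℝ] H} {G G' : H → H → Prop}

namespace IsC0SemigroupWithGenerator

/-- The substitution `s = t * r` turns the average into an integral over the fixed interval `[0, 1]`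
that depends continuously on `t`, including at `t = 0`. -/
theorem tendsto_average_convolution (h : IsC0SemigroupWithGenerator S G) {g : ℝ → H}
    (hg : Continuous g) :
    Tendsto (fun t : ℝ => t⁻¹ • ∫ s in (0 : ℝ)..t, S (max (t - s) 0) (g s)) (𝓝[>] 0) (𝓝 (g 0)) := by
  have hc : Continuous fun p : ℝ × ℝ => S (max (p.1 - p.1 * p.2) 0) (g (p.1 * p.2)) :=
    h.continuous_comp (by fun_prop) (by fun_prop)
  have h1 : Continuous fun t : ℝ => ∫ r in (0 : ℝ)..1, S (max (t - t * r) 0) (g (t * r)) :=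
    intervalIntegral.continuous_parametric_intervalIntegral_of_continuous
      (f := fun t r => S (max (t - t * r) 0) (g (t * r))) hc continuous_const
  have h2 := (h1.tendsto 0).mono_left (nhdsWithin_le_nhds (s := Ioi 0))
  simp only [zero_mul, sub_self, max_self, h.apply_zero, intervalIntegral.integral_const,
    sub_zero, one_smul] at h2
  refine h2.congr' ?_
  filter_upwards [self_mem_nhdsWithin] with t ht
  have ht : (0 : ℝ) < t := ht
  have := intervalIntegral.smul_integral_comp_mul_left (a := 0) (b := 1)
    (fun s => S (max (t - s) 0) (g s)) t
  rw [mul_zero, mul_one] at this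
  rw [← this, inv_smul_smul₀ ht.ne']

/-- Bounded perturbations of generators are generators. -/
theorem exists_perturbation (h : IsC0SemigroupWithGenerator S G) (D : H →L[ℝ] H) :
    ∃ U : ℝ → H →L[ℝ] H, IsC0SemigroupWithGenerator U (fun x y => G x (y - D x)) ∧
      ∀ t, 0 ≤ t → ∀ x, U t x = S t x + ∫ s in (0 : ℝ)..t, S (t - s) (D (U s x)) := by
  -- The perturbed semigroup is the mild flow with nonlinearity `D`; its linearity in the initial
  -- value follows from uniqueness of mild solutions.
  let N : C(H, H) := ⟨D, D.continuous⟩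
  have hN : ContDiff ℝ 3 N := D.contDiff
  have hK : LipschitzWith ‖D‖₊ N := D.lipschitz
  obtain ⟨Φ, hΦ⟩ := exists_mildFlow h hN hK
  have hint : ∀ (v : H) {t : ℝ}, 0 ≤ t →
      IntervalIntegrable (fun s => S (max (t - s) 0) (D (Φ (max s 0) v))) MeasureTheory.volume 0 t :=
    fun v t _ => (h.continuous_comp (by fun_prop)
      (D.continuous.comp (hΦ.mild v).1.comp_max)).intervalIntegrable _ _
  have hval : ∀ (v : H) {t : ℝ}, 0 ≤ t →
      Φ t v = S t v + ∫ s in (0 : ℝ)..t, S (max (t - s) 0) (D (Φ (max s 0) v)) := by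
    intro v t ht
    have h1 : Φ t v = _ := (hΦ.mild v).2 t ht
    rw [h1, integral_congr_max (x := fun t => Φ t v) ht, integral_max S _ ht]
    rfl
  have hadd : ∀ {t : ℝ}, 0 ≤ t → ∀ v w, Φ t (v + w) = Φ t v + Φ t w := by
    intro t ht v w
    refine (hΦ.unique (v + w) (fun t => Φ t v + Φ t w)
      ⟨(hΦ.mild v).1.add (hΦ.mild w).1, fun t ht => ?_⟩ t ht).symm
    rw [integral_congr_max (x := fun t => Φ t v + Φ t w) (N := N) ht,
      integral_max S (fun s => N (Φ (max s 0) v + Φ (max s 0) w)) ht]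
    beta_reduce
    rw [hval v ht, hval w ht, map_add, add_add_add_comm,
      ← intervalIntegral.integral_add (hint v ht) (hint w ht)]
    simp [N]
  have hsmul : ∀ {t : ℝ}, 0 ≤ t → ∀ (c : ℝ) v, Φ t (c • v) = c • Φ t v := by
    intro t ht c v
    refine (hΦ.unique (c • v) (fun t => c • Φ t v)
      ⟨(hΦ.mild v).1.const_smul c, fun t ht => ?_⟩ t ht).symm
    rw [integral_congr_max (x := fun t => c • Φ t v) (N := N) ht,
      integral_max S (fun s => N (c • Φ (max s 0) v)) ht]
    beta_reduce
    rw [hval v ht, map_smul, smul_add, ← intervalIntegral.integral_smul]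
    simp [N]
  let U : ℝ → H →L[ℝ] H := fun t =>
    { toFun := Φ (max t 0)
      map_add' := hadd (le_max_right _ _)
      map_smul' := hsmul (le_max_right _ _)
      cont := (hΦ.contDiff h hN hK (le_max_right t 0)).continuous }
  have hU : ∀ {t : ℝ}, 0 ≤ t → ∀ v, U t v = Φ t v := fun ht v => by
    change Φ (max _ 0) v = _
    rw [max_eq_left ht]
  have hduh : ∀ t, 0 ≤ t → ∀ x, U t x = S t x + ∫ s in (0 : ℝ)..t, S (t - s) (D (U s x)) := by
    intro t ht x
    have h1 : Φ t x = _ := (hΦ.mild x).2 t ht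
    rw [hU ht, h1]
    congr 1
    refine intervalIntegral.integral_congr fun s hs => ?_
    rw [uIcc_of_le ht] at hs
    beta_reduce
    rw [hU hs.1]
    rfl
  refine ⟨U, ⟨?_, ?_, ?_, ?_⟩, hduh⟩
  · ext v
    rw [hU le_rfl, hΦ.apply_zero h]; rfl
  · intro s t hs ht
    ext v
    change _ = U s (U t v)
    rw [hU (add_nonneg hs ht), hU hs, hU ht, add_comm, hΦ.apply_add h ht hs]
  · intro x
    exact (hΦ.mild x).1.congr fun t ht => hU ht x
  · intro x y
    -- The difference quotients of `U` and `S` at `x` differ by an averaged Duhamel term, which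
    -- tends to `D x`. Hence one converges exactly when the other does.
    have hlim := h.tendsto_average_convolution (D.continuous.comp (hΦ.mild x).1.comp_max)
    simp only [Function.comp, max_self, hΦ.apply_zero h] at hlim
    have hev : ∀ᶠ t : ℝ in 𝓝[>] 0, t⁻¹ • (U t x - x) = t⁻¹ • (S t x - x)
        + t⁻¹ • ∫ s in (0 : ℝ)..t, S (max (t - s) 0) (D (Φ (max s 0) x)) := by
      filter_upwards [self_mem_nhdsWithin] with t ht
      have ht : (0 : ℝ) < t := ht
      rw [hU ht.le, hval x ht.le, ← smul_add]
      congr 1; abel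
    rw [h.gen, tendsto_congr' hev]
    constructor
    · intro h1
      simpa using h1.add hlim
    · intro h1
      simpa using h1.sub hlim

/-- Variation of constants: solutions for the perturbed semigroup are solutions for the
unperturbed one. -/
theorem variation_of_constants (h : IsC0SemigroupWithGenerator S G)
    (hU : IsC0SemigroupWithGenerator U G') {D : H →L[ℝ] H}
    (hD : ∀ t, 0 ≤ t → ∀ x, U t x = S t x + ∫ s in (0 : ℝ)..t, S (t - s) (D (U s x)))
    {v : H} {g y : ℝ → H} (hg : Continuous g)
    (hy' : ∀ t, 0 ≤ t → y t = U t v + ∫ s in (0 : ℝ)..t, U (t - s) (g s)) {t : ℝ} (ht : 0 ≤ t) :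
    y t = S t v + ∫ s in (0 : ℝ)..t, S (t - s) (D (y s) + g s) := by
  let c : ℝ → H := fun s => ∫ r in (0 : ℝ)..s, U (max (s - r) 0) (g r)
  have hc : Continuous c := hU.continuous_convolution hg
  have hyc : ∀ s, 0 ≤ s → y s = U s v + c s := fun s hs => by
    rw [hy' s hs, integral_max U g hs]
  have hUv : Continuous fun s => U (max s 0) v := hU.continuous_apply v
  have i1 : Continuous fun s => S (max (t - s) 0) (D (U (max s 0) v)) :=
    h.continuous_comp (by fun_prop) (D.continuous.comp hUv)
  have i2 : Continuous fun s => S (max (t - s) 0) (D (c s)) :=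
    h.continuous_comp (by fun_prop) (D.continuous.comp hc)
  have i3 : Continuous fun s => S (max (t - s) 0) (g s) := h.continuous_comp (by fun_prop) hg
  have i4 : Continuous fun s => U (max (t - s) 0) (g s) := hU.continuous_comp (by fun_prop) hg
  have e1 : ∫ s in (0 : ℝ)..t, S (t - s) (D (y s) + g s)
      = (∫ s in (0 : ℝ)..t, S (max (t - s) 0) (D (U (max s 0) v)))
        + (∫ s in (0 : ℝ)..t, S (max (t - s) 0) (D (c s)))
        + ∫ s in (0 : ℝ)..t, S (max (t - s) 0) (g s) := by
    rw [← intervalIntegral.integral_add (i1.intervalIntegrable _ _) (i2.intervalIntegrable _ _),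
      ← intervalIntegral.integral_add ((i1.fun_add i2).intervalIntegrable _ _)
        (i3.intervalIntegrable _ _)]
    refine intervalIntegral.integral_congr fun s hs => ?_
    rw [uIcc_of_le ht] at hs
    rw [max_eq_left (by linarith [hs.2]), max_eq_left hs.1, hyc s hs.1]
    simp only [map_add]
  have e2 : ∫ s in (0 : ℝ)..t, S (max (t - s) 0) (D (U (max s 0) v)) = U t v - S t v := by
    rw [hD t ht v, add_sub_cancel_left]
    refine intervalIntegral.integral_congr fun s hs => ?_
    rw [uIcc_of_le ht] at hs
    rw [max_eq_left (by linarith [hs.2]), max_eq_left hs.1]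
  have hF : Continuous (Function.uncurry fun s r : ℝ =>
      S (max (t - s) 0) (D (U (max (s - r) 0) (g r)))) :=
    h.continuous_comp (by fun_prop) (D.continuous.comp (hU.continuous_comp (by fun_prop)
      (hg.comp continuous_snd)))
  -- After exchanging the order of integration, the inner integral is the Duhamel term of the orbit
  -- of `g r` over a time `t - r`, that is, the difference of the two semigroups applied to `g r`.
  have e3 : ∫ s in (0 : ℝ)..t, S (max (t - s) 0) (D (c s))
      = ∫ r in (0 : ℝ)..t, (U (max (t - r) 0) (g r) - S (max (t - r) 0) (g r)) := by
    have a1 : ∫ s in (0 : ℝ)..t, S (max (t - s) 0) (D (c s)) = ∫ s in (0 : ℝ)..t,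
        ∫ r in (0 : ℝ)..s, S (max (t - s) 0) (D (U (max (s - r) 0) (g r))) := by
      refine intervalIntegral.integral_congr fun s _ => ?_
      have i5 : Continuous fun r => U (max (s - r) 0) (g r) := hU.continuous_comp (by fun_prop) hg
      exact (((S (max (t - s) 0)).comp D).intervalIntegral_comp_comm
        (i5.intervalIntegrable 0 s)).symm
    rw [a1, integral_triangle_swap hF ht]
    refine intervalIntegral.integral_congr fun r hr => ?_
    rw [uIcc_of_le ht] at hr
    have hr' : 0 ≤ t - r := by linarith [hr.2]
    rw [max_eq_left hr', hD (t - r) hr', add_sub_cancel_left]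
    have := intervalIntegral.integral_comp_add_right (a := 0) (b := t - r)
      (fun s => S (max (t - s) 0) (D (U (max (s - r) 0) (g r)))) r
    rw [zero_add, sub_add_cancel] at this
    rw [← this]
    refine intervalIntegral.integral_congr fun s hs => ?_
    rw [uIcc_of_le hr'] at hs
    rw [add_sub_cancel_right, max_eq_left hs.1, max_eq_left (by linarith [hs.2]),
      show t - (s + r) = t - r - s by ring]
  rw [e1, e2, e3, intervalIntegral.integral_sub (i4.intervalIntegrable _ _)
    (i3.intervalIntegrable _ _), hyc t ht]
  change U t v + ∫ r in (0 : ℝ)..t, U (max (t - r) 0) (g r) = _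
  abel

end IsC0SemigroupWithGenerator

/-- Moving a bounded linear part of the nonlinearity to the semigroup. -/
theorem IsMild.of_perturbation (h : IsC0SemigroupWithGenerator S G)
    (hU : IsC0SemigroupWithGenerator U G') {D : H →L[ℝ] H}
    (hD : ∀ t, 0 ≤ t → ∀ x, U t x = S t x + ∫ s in (0 : ℝ)..t, S (t - s) (D (U s x)))
    {N : H → H} (hN : Continuous N) {v : H} {x : ℝ → H}
    (hx : IsMild U (fun u => N u - D u) v x) : IsMild S N v x := by
  refine ⟨hx.1, fun t ht => ?_⟩
  have hg : Continuous fun s => N (x (max s 0)) - D (x (max s 0)) :=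
    (hN.comp hx.1.comp_max).sub (D.continuous.comp hx.1.comp_max)
  rw [h.variation_of_constants hU hD (v := v) (y := x) hg (fun t ht => ?_) ht]
  · congr 1
    refine intervalIntegral.integral_congr fun s hs => ?_
    rw [uIcc_of_le ht] at hs
    rw [max_eq_left hs.1]
    congr 1
    abel
  · rw [hx.2 t ht, integral_congr_max (N := fun u => N u - D u) ht]

end Perturbation

/-! ### Parseval's identity for functions with values in a real Hilbert space -/

section Parseval
open MeasureTheory

/-- The squared modulus of each complex coefficient is split into its cosine and sine parts, so that
the identity can be applied coordinate by coordinate in a real Hilbert space. -/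
theorem hasSum_sq_fourier_real {f : ℝ → ℝ} (hf : Continuous f) {Λ : ℝ} (hΛ : 0 < Λ) :
    HasSum (fun k : ℤ => (∫ t in (0 : ℝ)..Λ, Real.cos (2 * Real.pi * k / Λ * t) * f t) ^ 2
      + (∫ t in (0 : ℝ)..Λ, Real.sin (2 * Real.pi * k / Λ * t) * f t) ^ 2)
      (Λ * ∫ t in (0 : ℝ)..Λ, f t ^ 2) := by
  have hmem : MemLp (fun t => (f t : ℂ)) 2 (volume.restrict (Ioc 0 Λ)) := by
    have hc : Continuous fun t => (f t : ℂ) := Complex.continuous_ofReal.comp hf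
    obtain ⟨C, hC⟩ := (isCompact_Icc (a := 0) (b := Λ)).exists_bound_of_continuousOn hc.continuousOn
    refine MemLp.of_bound hc.aestronglyMeasurable C ?_
    filter_upwards [ae_restrict_mem measurableSet_Ioc] with t ht
    exact hC t (Ioc_subset_Icc_self ht)
  have h := (hasSum_sq_fourierCoeffOn hΛ hmem).mul_left (Λ ^ 2)
  have e1 : Λ ^ 2 * ((Λ - 0)⁻¹ • ∫ t in (0 : ℝ)..Λ, ‖(f t : ℂ)‖ ^ 2)
      = Λ * ∫ t in (0 : ℝ)..Λ, f t ^ 2 := by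
    simp only [Complex.norm_real, Real.norm_eq_abs, sq_abs, sub_zero, smul_eq_mul]
    field_simp
  rw [e1] at h
  refine h.congr_fun fun k => ?_
  rw [fourierCoeffOn_eq_integral]
  have e2 : ∀ t : ℝ, fourier (-k) (t : AddCircle (Λ - 0)) • (f t : ℂ)
      = ((Real.cos (2 * Real.pi * k / Λ * t) * f t : ℝ) : ℂ)
        - ((Real.sin (2 * Real.pi * k / Λ * t) * f t : ℝ) : ℂ) * Complex.I := by
    intro t
    rw [fourier_coe_apply]
    have : 2 * (Real.pi : ℂ) * Complex.I * ((-k : ℤ) : ℂ) * t / ((Λ - 0 : ℝ) : ℂ)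
        = ((-(2 * Real.pi * k / Λ * t) : ℝ) : ℂ) * Complex.I := by
      push_cast; rw [sub_zero]; ring
    rw [this, Complex.exp_ofReal_mul_I, smul_eq_mul]
    push_cast
    rw [Complex.cos_neg, Complex.sin_neg]
    ring
  simp_rw [e2]
  have c1 : Continuous fun t => Real.cos (2 * Real.pi * k / Λ * t) * f t := by fun_prop
  have c2 : Continuous fun t => Real.sin (2 * Real.pi * k / Λ * t) * f t := by fun_prop
  have d1 : Continuous fun t =>
      ((Real.cos (2 * Real.pi * k / Λ * t) * f t : ℝ) : ℂ) := Complex.continuous_ofReal.comp c1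
  have d2 : Continuous fun t =>
      ((Real.sin (2 * Real.pi * k / Λ * t) * f t : ℝ) : ℂ) * Complex.I :=
    (Complex.continuous_ofReal.comp c2).mul continuous_const
  rw [intervalIntegral.integral_sub (d1.intervalIntegrable _ _) (d2.intervalIntegrable _ _),
    intervalIntegral.integral_mul_const, intervalIntegral.integral_ofReal,
    intervalIntegral.integral_ofReal, norm_smul, mul_pow, ← Complex.normSq_eq_norm_sq,
    Complex.normSq_apply]
  simp
  field_simp

variable {H : Type*} [NormedAddCommGroup H] [InnerProductSpace ℝ H] [CompleteSpace H]

theorem tsum_ofReal_inner_sq (e : HilbertBasis ℕ ℝ H) (x : H) :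
    ∑' j, ENNReal.ofReal (inner ℝ (e j) x ^ 2) = ENNReal.ofReal (‖x‖ ^ 2) := by
  have h := e.hasSum_inner_mul_inner x x
  have h' : HasSum (fun j => inner ℝ (e j) x ^ 2) (‖x‖ ^ 2) := by
    rw [real_inner_self_eq_norm_sq] at h
    refine h.congr_fun fun j => ?_
    rw [real_inner_comm, sq]
  rw [← ENNReal.ofReal_tsum_of_nonneg (fun j => sq_nonneg _) h'.summable, h'.tsum_eq]

/-- Parseval's identity for a function with values in a Hilbert space. -/
theorem tsum_sq_fourier_hilbert (e : HilbertBasis ℕ ℝ H) {u : ℝ → H} (hu : Continuous u) {Λ : ℝ}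
    (hΛ : 0 < Λ) :
    ∑' k : ℤ, ENNReal.ofReal (‖∫ t in (0 : ℝ)..Λ, Real.cos (2 * Real.pi * k / Λ * t) • u t‖ ^ 2
      + ‖∫ t in (0 : ℝ)..Λ, Real.sin (2 * Real.pi * k / Λ * t) • u t‖ ^ 2)
      = ENNReal.ofReal (Λ * ∫ t in (0 : ℝ)..Λ, ‖u t‖ ^ 2) := by
  have hf : ∀ j, Continuous fun t => inner ℝ (e j) (u t) := fun j => by fun_prop
  have hco : ∀ (c : ℝ → ℝ), Continuous c → ∀ j, inner ℝ (e j) (∫ t in (0 : ℝ)..Λ, c t • u t)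
      = ∫ t in (0 : ℝ)..Λ, c t * inner ℝ (e j) (u t) := by
    intro c hc j
    have := (innerSL ℝ (e j)).intervalIntegral_comp_comm
      ((hc.smul hu).intervalIntegrable (μ := volume) 0 Λ)
    simp only [innerSL_apply_apply, Pi.smul_apply'] at this
    rw [← this]
    simp [inner_smul_right]
  have hcos : ∀ k : ℤ, Continuous fun t : ℝ => Real.cos (2 * Real.pi * k / Λ * t) :=
    fun k => by fun_prop
  have hsin : ∀ k : ℤ, Continuous fun t : ℝ => Real.sin (2 * Real.pi * k / Λ * t) :=
    fun k => by fun_prop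
  have h1 : ∀ k : ℤ,
      ENNReal.ofReal (‖∫ t in (0 : ℝ)..Λ, Real.cos (2 * Real.pi * k / Λ * t) • u t‖ ^ 2
      + ‖∫ t in (0 : ℝ)..Λ, Real.sin (2 * Real.pi * k / Λ * t) • u t‖ ^ 2)
      = ∑' j, ENNReal.ofReal
        ((∫ t in (0 : ℝ)..Λ, Real.cos (2 * Real.pi * k / Λ * t) * inner ℝ (e j) (u t)) ^ 2
        + (∫ t in (0 : ℝ)..Λ, Real.sin (2 * Real.pi * k / Λ * t) * inner ℝ (e j) (u t)) ^ 2) := by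
    intro k
    rw [ENNReal.ofReal_add (sq_nonneg _) (sq_nonneg _), ← tsum_ofReal_inner_sq e,
      ← tsum_ofReal_inner_sq e, ← ENNReal.tsum_add]
    refine tsum_congr fun j => ?_
    rw [← ENNReal.ofReal_add (sq_nonneg _) (sq_nonneg _), hco _ (hcos k), hco _ (hsin k)]
  simp_rw [h1]
  rw [ENNReal.tsum_comm]
  have h2 : ∀ j, ∑' k : ℤ, ENNReal.ofReal
        ((∫ t in (0 : ℝ)..Λ, Real.cos (2 * Real.pi * k / Λ * t) * inner ℝ (e j) (u t)) ^ 2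
        + (∫ t in (0 : ℝ)..Λ, Real.sin (2 * Real.pi * k / Λ * t) * inner ℝ (e j) (u t)) ^ 2)
      = ENNReal.ofReal Λ * ∫⁻ t in Ioc 0 Λ, ENNReal.ofReal (inner ℝ (e j) (u t) ^ 2) := by
    intro j
    have h := hasSum_sq_fourier_real (hf j) hΛ
    rw [← ENNReal.ofReal_tsum_of_nonneg (fun k => by positivity) h.summable, h.tsum_eq,
      ENNReal.ofReal_mul hΛ.le, intervalIntegral.integral_of_le hΛ.le,
      ofReal_integral_eq_lintegral_ofReal]
    · exact ((hf j).pow 2).integrableOn_Ioc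
    · exact ae_of_all _ fun t => sq_nonneg _
  simp_rw [h2]
  have hm : ∀ j, AEMeasurable (fun t => ENNReal.ofReal (inner ℝ (e j) (u t) ^ 2))
      (volume.restrict (Ioc 0 Λ)) := fun j =>
    ((ENNReal.continuous_ofReal.comp ((hf j).pow 2)).measurable).aemeasurable
  rw [ENNReal.tsum_mul_left, ← lintegral_tsum hm]
  simp_rw [tsum_ofReal_inner_sq e]
  rw [ENNReal.ofReal_mul hΛ.le, intervalIntegral.integral_of_le hΛ.le,
      ofReal_integral_eq_lintegral_ofReal]
  · exact (hu.norm.pow 2).integrableOn_Ioc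
  · exact ae_of_all _ fun t => sq_nonneg _

end Parseval

/-! ### Exponential decay from resolvent bounds (Gearhart-Prüss) -/

namespace IsC0SemigroupWithGenerator

variable {H : Type*} [NormedAddCommGroup H] [NormedSpace ℝ H] [CompleteSpace H]
  {S : ℝ → H →L[ℝ] H} {G : H → H → Prop}

theorem continuous_smul_orbit (h : IsC0SemigroupWithGenerator S G) {c : ℝ → ℝ}
    (hc : Continuous c) (z : H) : Continuous fun t => c t • S (max t 0) z :=
  hc.smul (h.continuous_apply z)

/-- Weighted means of an orbit in the domain are in the domain. -/
theorem gen_integral_smul (h : IsC0SemigroupWithGenerator S G) {w y : H} (hwy : G w y)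
    {c : ℝ → ℝ} (hc : Continuous c) {Λ : ℝ} (hΛ : 0 ≤ Λ) :
    G (∫ t in (0 : ℝ)..Λ, c t • S (max t 0) w) (∫ t in (0 : ℝ)..Λ, c t • S (max t 0) y) := by
  have hint : ∀ z, IntervalIntegrable (fun t => c t • S (max t 0) z) MeasureTheory.volume 0 Λ :=
    fun z => (h.continuous_smul_orbit hc z).intervalIntegrable _ _
  let J : H →L[ℝ] H := LinearMap.mkContinuousOfExistsBound
    { toFun := fun z => ∫ t in (0 : ℝ)..Λ, c t • S (max t 0) z
      map_add' := fun z z' => by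
        rw [← intervalIntegral.integral_add (hint z) (hint z')]; simp
      map_smul' := fun r z => by
        rw [← intervalIntegral.integral_smul]; simp [smul_comm r] } <| by
    obtain ⟨M, hM, hb⟩ := h.exists_bound Λ
    obtain ⟨C, hC⟩ := (isCompact_Icc (a := 0) (b := Λ)).exists_bound_of_continuousOn
      hc.continuousOn
    refine ⟨C * M * Λ, fun z => ?_⟩
    have := intervalIntegral.norm_integral_le_of_norm_le_const (a := 0) (b := Λ)
      (f := fun t => c t • S (max t 0) z) (C := C * (M * ‖z‖)) (fun s hs => by
        rw [uIoc_of_le hΛ] at hs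
        rw [norm_smul]
        have h1 := hC s ⟨hs.1.le, hs.2⟩
        refine mul_le_mul h1 ?_ (norm_nonneg _) ((norm_nonneg _).trans h1)
        refine ((S _).le_opNorm _).trans ?_
        gcongr
        exact hb _ ⟨le_max_right _ _, max_le hs.2 hΛ⟩)
    rw [sub_zero, abs_of_nonneg hΛ] at this
    refine this.trans (le_of_eq (by ring))
  rw [h.gen] at hwy ⊢
  have h1 := (J.continuous.tendsto y).comp hwy
  refine h1.congr' ?_
  filter_upwards [self_mem_nhdsWithin] with r hr
  have hr : (0 : ℝ) < r := hr
  simp only [Function.comp, map_smul, map_sub]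
  congr 2
  change ∫ t in (0 : ℝ)..Λ, c t • S (max t 0) (S r w) = _
  rw [← ContinuousLinearMap.intervalIntegral_comp_comm _ (hint w)]
  refine intervalIntegral.integral_congr fun t ht => ?_
  rw [uIcc_of_le hΛ] at ht
  rw [map_smul, h.apply_comm hr.le (le_max_right _ _)]

/-- Integration by parts for an orbit in the domain. -/
theorem integral_smul_gen (h : IsC0SemigroupWithGenerator S G) {w y : H} (hwy : G w y)
    {p p' : ℝ → ℝ} (hp : ∀ t, HasDerivAt p (p' t) t) (hp' : Continuous p') {Λ : ℝ} (hΛ : 0 ≤ Λ)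
    (h0 : p 0 = 0) (h1 : p Λ = 0) :
    ∫ t in (0 : ℝ)..Λ, p t • S (max t 0) y = -∫ t in (0 : ℝ)..Λ, p' t • S (max t 0) w := by
  have hpc : Continuous p := continuous_iff_continuousAt.2 fun t => (hp t).continuousAt
  have c1 := h.continuous_smul_orbit hpc y
  have c2 := h.continuous_smul_orbit hp' w
  have := intervalIntegral.integral_eq_sub_of_hasDerivAt_of_le hΛ
    (f := fun t => p t • S (max t 0) w)
    (f' := fun t => p t • S (max t 0) y + p' t • S (max t 0) w)
    (h.continuous_smul_orbit hpc w).continuousOn (fun t ht => ?_)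
    ((c1.add c2).intervalIntegrable _ _)
  · rw [intervalIntegral.integral_add (c1.intervalIntegrable _ _) (c2.intervalIntegrable _ _),
      h0, h1, zero_smul, zero_smul, sub_zero] at this
    exact eq_neg_of_add_eq_zero_left this
  · have hd : HasDerivAt (fun t => S (max t 0) w) (S (max t 0) y) t := by
      have := h.hasDerivAt_orbit hwy ht.1
      rw [max_eq_left ht.1.le]
      refine this.congr_of_eventuallyEq ?_
      filter_upwards [lt_mem_nhds ht.1] with r hr
      rw [max_eq_left hr.le]
    exact (hp t).smul hd

end IsC0SemigroupWithGenerator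

namespace IsC0SemigroupWithGenerator
variable {H : Type*} [NormedAddCommGroup H] [InnerProductSpace ℝ H] [CompleteSpace H]
  {S : ℝ → H →L[ℝ] H} {G : H → H → Prop}

/-- A resolvent bound on the line `Re z = a` gives an `L²` bound for cut-off orbits. -/
theorem integral_cutoff_le (h : IsC0SemigroupWithGenerator S G) (e : HilbertBasis ℕ ℝ H)
    {Q : H →L[ℝ] H} (hQS : ∀ t, 0 ≤ t → ∀ x, Q (S t x) = S t (Q x))
    {M a : ℝ}
    (hres : ∀ z : ℂ, z.re = a → HasResolventBoundOn G (LinearMap.range (Q : H →ₗ[ℝ] H)) z M)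
    {w y : H} (hw : Q w = w) (hwy : G w y) {χ χ' : ℝ → ℝ} (hχ : ∀ t, HasDerivAt χ (χ' t) t)
    (hχ' : Continuous χ') {Λ : ℝ} (hΛ : 0 < Λ) (h0 : χ 0 = 0) (h1 : χ Λ = 0) :
    ∫ t in (0 : ℝ)..Λ, ‖(χ t * Real.exp (-a * t)) • S (max t 0) w‖ ^ 2
      ≤ M ^ 2 * ∫ t in (0 : ℝ)..Λ, ‖(χ' t * Real.exp (-a * t)) • S (max t 0) w‖ ^ 2 := by
  have hχc : Continuous χ := continuous_iff_continuousAt.2 fun t => (hχ t).continuousAt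
  have hmem : ∀ c : ℝ → ℝ, Continuous c → ∫ t in (0 : ℝ)..Λ, c t • S (max t 0) w
      ∈ LinearMap.range (Q : H →ₗ[ℝ] H) := by
    intro c hc
    refine ⟨∫ t in (0 : ℝ)..Λ, c t • S (max t 0) w, ?_⟩
    change Q _ = _
    rw [← ContinuousLinearMap.intervalIntegral_comp_comm _
      ((h.continuous_smul_orbit hc w).intervalIntegrable _ _)]
    refine intervalIntegral.integral_congr fun t _ => ?_
    rw [map_smul, hQS _ (le_max_right _ _), hw]
  let u : ℝ → H := fun t => (χ t * Real.exp (-a * t)) • S (max t 0) w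
  let g : ℝ → H := fun t => (χ' t * Real.exp (-a * t)) • S (max t 0) w
  have hu : Continuous u := h.continuous_smul_orbit (by fun_prop) w
  have hg : Continuous g := h.continuous_smul_orbit (by fun_prop) w
  -- Integration by parts, with no boundary terms because the cut-off vanishes at both ends, shows
  -- that `z - G` sends the `k`-th Fourier coefficient of `u` to that of `g`, where `z = a + iω`.
  -- The resolvent bound then compares the two coefficients, and Parseval sums the comparison.
  have key : ∀ k : ℤ, ‖∫ t in (0 : ℝ)..Λ, Real.cos (2 * Real.pi * k / Λ * t) • u t‖ ^ 2
      + ‖∫ t in (0 : ℝ)..Λ, Real.sin (2 * Real.pi * k / Λ * t) • u t‖ ^ 2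
      ≤ M ^ 2 * (‖∫ t in (0 : ℝ)..Λ, Real.cos (2 * Real.pi * k / Λ * t) • g t‖ ^ 2
      + ‖∫ t in (0 : ℝ)..Λ, Real.sin (2 * Real.pi * k / Λ * t) • g t‖ ^ 2) := by
    intro k
    set ω : ℝ := 2 * Real.pi * k / Λ with hω
    have hexp : ∀ t, HasDerivAt (fun t => Real.exp (-a * t)) (Real.exp (-a * t) * (-a)) t := by
      intro t
      simpa using ((hasDerivAt_id t).const_mul (-a)).exp
    have hcos : ∀ t, HasDerivAt (fun t => Real.cos (ω * t)) (-Real.sin (ω * t) * ω) t := by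
      intro t
      simpa using ((hasDerivAt_id t).const_mul ω).cos
    have hsin : ∀ t, HasDerivAt (fun t => Real.sin (ω * t)) (Real.cos (ω * t) * ω) t := by
      intro t
      simpa using ((hasDerivAt_id t).const_mul ω).sin
    let p₁ : ℝ → ℝ := fun t => χ t * Real.exp (-a * t) * Real.cos (ω * t)
    let p₂ : ℝ → ℝ := fun t => χ t * Real.exp (-a * t) * Real.sin (ω * t)
    let q₁ : ℝ → ℝ := fun t => χ' t * Real.exp (-a * t) * Real.cos (ω * t)
    let q₂ : ℝ → ℝ := fun t => χ' t * Real.exp (-a * t) * Real.sin (ω * t)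
    have hp₁ : ∀ t, HasDerivAt p₁ (q₁ t - a * p₁ t - ω * p₂ t) t := by
      intro t
      refine (((hχ t).fun_mul (hexp t)).fun_mul (hcos t)).congr_deriv ?_
      change _ = χ' t * Real.exp (-a * t) * Real.cos (ω * t)
        - a * (χ t * Real.exp (-a * t) * Real.cos (ω * t))
        - ω * (χ t * Real.exp (-a * t) * Real.sin (ω * t))
      ring
    have hp₂ : ∀ t, HasDerivAt p₂ (q₂ t - a * p₂ t + ω * p₁ t) t := by
      intro t
      refine (((hχ t).fun_mul (hexp t)).fun_mul (hsin t)).congr_deriv ?_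
      change _ = χ' t * Real.exp (-a * t) * Real.sin (ω * t)
        - a * (χ t * Real.exp (-a * t) * Real.sin (ω * t))
        + ω * (χ t * Real.exp (-a * t) * Real.cos (ω * t))
      ring
    have cp₁ : Continuous p₁ := by fun_prop
    have cp₂ : Continuous p₂ := by fun_prop
    have cq₁ : Continuous q₁ := by fun_prop
    have cq₂ : Continuous q₂ := by fun_prop
    let I : (ℝ → ℝ) → H := fun p => ∫ t in (0 : ℝ)..Λ, p t • S (max t 0) w
    have hII : ∀ p, Continuous p →
        IntervalIntegrable (fun t => p t • S (max t 0) w) MeasureTheory.volume 0 Λ :=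
      fun p hp => (h.continuous_smul_orbit hp w).intervalIntegrable _ _
    have g₁ := h.gen_integral_smul hwy cp₁ hΛ.le
    rw [h.integral_smul_gen hwy hp₁ (by fun_prop) hΛ.le (by simp [p₁, h0]) (by simp [p₁, h1])] at g₁
    have g₂ := h.gen_integral_smul hwy cp₂ hΛ.le
    rw [h.integral_smul_gen hwy hp₂ (by fun_prop) hΛ.le (by simp [p₂, h0]) (by simp [p₂, h1])] at g₂
    have lin : ∀ (p q r : ℝ → ℝ) (c d : ℝ), Continuous p → Continuous q → Continuous r →
        ∫ t in (0 : ℝ)..Λ, (p t - c * q t + d * r t) • S (max t 0) w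
          = I p - c • I q + d • I r := by
      intro p q r c d hp hq hr
      have i₁ : Continuous fun t => c • q t • S (max t 0) w :=
        (h.continuous_smul_orbit hq w).const_smul c
      have i₂ : Continuous fun t => d • r t • S (max t 0) w :=
        (h.continuous_smul_orbit hr w).const_smul d
      have i₃ : Continuous fun t => p t • S (max t 0) w - c • q t • S (max t 0) w :=
        (h.continuous_smul_orbit hp w).sub i₁
      simp_rw [add_smul, sub_smul, mul_smul]
      rw [intervalIntegral.integral_add (i₃.intervalIntegrable _ _) (i₂.intervalIntegrable _ _),
        intervalIntegral.integral_sub (hII p hp) (i₁.intervalIntegrable _ _),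
        intervalIntegral.integral_smul, intervalIntegral.integral_smul]
    have l₁ : ∫ t in (0 : ℝ)..Λ, (q₁ t - a * p₁ t - ω * p₂ t) • S (max t 0) w
        = I q₁ - a • I p₁ + (-ω) • I p₂ := by
      rw [← lin _ _ _ _ _ cq₁ cp₁ cp₂]
      simp only [neg_mul, ← sub_eq_add_neg]
    have l₂ := lin _ _ _ a ω cq₂ cp₂ cp₁
    rw [l₁] at g₁
    rw [l₂] at g₂
    have g₃ := h.gen_smul (-1) g₂
    -- The pair `(I p₁, -I p₂)` is the real form of the coefficient against `e^{-iωt}`, which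
    -- explains the sign.
    have hfin := (hres ⟨a, ω⟩ rfl).2 (I p₁) (hmem _ cp₁) ((-1 : ℝ) • I p₂)
      (Submodule.smul_mem _ _ (hmem _ cp₂)) _ _ g₁ g₃
    have r₁ : a • I p₁ - ω • (-1 : ℝ) • I p₂ - -(I q₁ - a • I p₁ + (-ω) • I p₂) = I q₁ := by
      module
    have r₂ : ω • I p₁ + a • (-1 : ℝ) • I p₂ - (-1 : ℝ) • -(I q₂ - a • I p₂ + ω • I p₁)
        = -I q₂ := by
      module
    rw [r₁, r₂, neg_one_smul, norm_neg, norm_neg] at hfin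
    have s₁ : ∀ t, Real.cos (ω * t) • u t = p₁ t • S (max t 0) w := fun t => by
      simp only [u, p₁, smul_smul]; congr 1; ring
    have s₂ : ∀ t, Real.sin (ω * t) • u t = p₂ t • S (max t 0) w := fun t => by
      simp only [u, p₂, smul_smul]; congr 1; ring
    have s₃ : ∀ t, Real.cos (ω * t) • g t = q₁ t • S (max t 0) w := fun t => by
      simp only [g, q₁, smul_smul]; congr 1; ring
    have s₄ : ∀ t, Real.sin (ω * t) • g t = q₂ t • S (max t 0) w := fun t => by
      simp only [g, q₂, smul_smul]; congr 1; ring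
    simp only [s₁, s₂, s₃, s₄]
    exact hfin
  have hnn : 0 ≤ ∫ t in (0 : ℝ)..Λ, ‖g t‖ ^ 2 :=
    intervalIntegral.integral_nonneg hΛ.le fun t _ => sq_nonneg _
  have hsum : ENNReal.ofReal (Λ * ∫ t in (0 : ℝ)..Λ, ‖u t‖ ^ 2)
      ≤ ENNReal.ofReal (M ^ 2 * (Λ * ∫ t in (0 : ℝ)..Λ, ‖g t‖ ^ 2)) := by
    rw [ENNReal.ofReal_mul (sq_nonneg M), ← tsum_sq_fourier_hilbert e hu hΛ,
      ← tsum_sq_fourier_hilbert e hg hΛ, ← ENNReal.tsum_mul_left]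
    refine ENNReal.tsum_le_tsum fun k => ?_
    rw [← ENNReal.ofReal_mul (sq_nonneg M)]
    exact ENNReal.ofReal_le_ofReal (key k)
  rw [ENNReal.ofReal_le_ofReal_iff (by positivity)] at hsum
  refine le_of_mul_le_mul_left (a := Λ) ?_ hΛ
  calc _ ≤ _ := hsum
    _ = _ := by ring

end IsC0SemigroupWithGenerator

/-- Write `t = n t₀ + r` with `0 ≤ r ≤ t₀` and iterate. The factor `1 / q` in the constant pays for
replacing the integer part `n` by `t / t₀ - 1`. -/
theorem exists_exp_bound_of_submultiplicative {φ : ℝ → ℝ} (hφ : ∀ t, 0 ≤ φ t)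
    (hm : ∀ s t, 0 ≤ s → 0 ≤ t → φ (s + t) ≤ φ s * φ t) {t₀ K q : ℝ} (ht₀ : 0 < t₀)
    (hK : ∀ t ∈ Icc 0 t₀, φ t ≤ K) (hq0 : 0 < q) (hq1 : q < 1) (h : φ t₀ ≤ q) :
    ∃ C c : ℝ, 0 ≤ C ∧ 0 < c ∧ ∀ t, 0 ≤ t → φ t ≤ C * Real.exp (-c * t) := by
  have hK0 : 0 ≤ K := (hφ 0).trans (hK 0 ⟨le_rfl, ht₀.le⟩)
  have hlog : Real.log q < 0 := Real.log_neg hq0 hq1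
  refine ⟨K / q, -Real.log q / t₀, by positivity, by
    have : 0 < -Real.log q := by linarith
    positivity, fun t ht => ?_⟩
  have hn : ∀ (n : ℕ) (r : ℝ), 0 ≤ r → φ (n * t₀ + r) ≤ q ^ n * φ r := by
    intro n r hr
    induction n with
    | zero => simp
    | succ n ih =>
      have : ((n + 1 : ℕ) : ℝ) * t₀ + r = t₀ + (n * t₀ + r) := by push_cast; ring
      rw [this]
      calc _ ≤ φ t₀ * φ (n * t₀ + r) := hm _ _ ht₀.le (by positivity)
        _ ≤ q * (q ^ n * φ r) := mul_le_mul h ih (hφ _) hq0.le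
        _ = _ := by ring
  let n := ⌊t / t₀⌋₊
  have h1 : (n : ℝ) ≤ t / t₀ := Nat.floor_le (by positivity)
  have h2 : t / t₀ < n + 1 := Nat.lt_floor_add_one _
  rw [le_div_iff₀ ht₀] at h1
  have h3 : t - n * t₀ ≤ t₀ := by
    rw [div_lt_iff₀ ht₀] at h2; linarith
  have h4 := hn n (t - n * t₀) (by linarith)
  rw [add_sub_cancel] at h4
  have h5 : q ^ n = Real.exp (n * Real.log q) := by
    rw [mul_comm, Real.exp_mul, Real.exp_log hq0, Real.rpow_natCast]
  have h6 : q ^ n ≤ Real.exp (-(-Real.log q / t₀) * t) / q := by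
    rw [h5, le_div_iff₀ hq0]
    nth_rewrite 2 [← Real.exp_log hq0]
    rw [← Real.exp_add, Real.exp_le_exp]
    have : -(-Real.log q / t₀) * t = Real.log q * (t / t₀) := by ring
    rw [this]
    nlinarith
  calc _ ≤ q ^ n * φ (t - n * t₀) := h4
    _ ≤ (Real.exp (-(-Real.log q / t₀) * t) / q) * K :=
        mul_le_mul h6 (hK _ ⟨by linarith, h3⟩) (hφ _) (by positivity)
    _ = _ := by ring

/-- Iterating the inequality sums a geometric series of ratio `1/4`. The a priori bound `C` enters
with a factor `4⁻ⁿ` and disappears, so the conclusion does not depend on it; the continuation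
argument for the decay rests on this. -/
theorem le_of_le_add_quarter {J : ℝ → ℝ} {L C : ℝ} (hL : 0 ≤ L)
    (hJ : ∀ Λ, L ≤ Λ → J Λ ≤ J L + J (2 * Λ) / 4) (hC : ∀ Λ, L ≤ Λ → J Λ ≤ C) {Λ : ℝ}
    (hΛ : L ≤ Λ) (h0 : 0 ≤ J L) : J Λ ≤ 4 / 3 * J L := by
  have h : ∀ (n : ℕ) (Λ : ℝ), L ≤ Λ → J Λ ≤ 4 / 3 * J L + C * (1 / 4) ^ n := by
    intro n
    induction n with
    | zero => intro Λ hΛ; have := hC Λ hΛ; simp; linarith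
    | succ n ih =>
      intro Λ hΛ
      have h1 := hJ Λ hΛ
      have h2 := ih (2 * Λ) (by linarith)
      rw [pow_succ]
      linarith
  have hlim : Tendsto (fun n : ℕ => 4 / 3 * J L + C * (1 / 4 : ℝ) ^ n) atTop
      (𝓝 (4 / 3 * J L + C * 0)) :=
    ((tendsto_pow_atTop_nhds_zero_of_lt_one (by norm_num) (by norm_num)).const_mul C).const_add _
  rw [mul_zero, add_zero] at hlim
  exact ge_of_tendsto' hlim fun n => h n Λ hΛ

namespace IsC0SemigroupWithGenerator
variable {H : Type*} [NormedAddCommGroup H] [InnerProductSpace ℝ H] [CompleteSpace H]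
  {S : ℝ → H →L[ℝ] H} {G : H → H → Prop}

/-- The `L²` norm of a weighted orbit on `[0, Λ]`. -/
noncomputable def orbitEnergy (S : ℝ → H →L[ℝ] H) (a : ℝ) (w : H) (Λ : ℝ) : ℝ :=
  ∫ t in (0 : ℝ)..Λ, ‖Real.exp (-a * t) • S (max t 0) w‖ ^ 2

theorem continuous_energy (h : IsC0SemigroupWithGenerator S G) (a : ℝ) (w : H) :
    Continuous fun t => ‖Real.exp (-a * t) • S (max t 0) w‖ ^ 2 :=
  (h.continuous_smul_orbit (by fun_prop) w).norm.pow 2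

/-- The cut-off is `χ t = t - t² / (2Λ)` on `[0, 2Λ]`. It satisfies `|χ'| ≤ 1` everywhere and `χ ≥ t
/ 2 ≥ 2M` on `[4M, Λ]`, so the cut-off inequality bounds `4M²` times the energy on `[4M, Λ]` by `M²`
times the energy on `[0, 2Λ]`. -/
theorem orbitEnergy_le_add (h : IsC0SemigroupWithGenerator S G) (e : HilbertBasis ℕ ℝ H)
    {Q : H →L[ℝ] H} (hQS : ∀ t, 0 ≤ t → ∀ x, Q (S t x) = S t (Q x))
    {M a : ℝ} (hM : 0 < M)
    (hres : ∀ z : ℂ, z.re = a → HasResolventBoundOn G (LinearMap.range (Q : H →ₗ[ℝ] H)) z M)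
    {w y : H} (hw : Q w = w) (hwy : G w y) {Λ : ℝ} (hΛ : 4 * M ≤ Λ) :
    orbitEnergy S a w Λ ≤ orbitEnergy S a w (4 * M) + orbitEnergy S a w (2 * Λ) / 4 := by
  have hΛ0 : 0 < Λ := by linarith
  let f : ℝ → ℝ := fun t => ‖Real.exp (-a * t) • S (max t 0) w‖ ^ 2
  have hf : Continuous f := h.continuous_energy a w
  have hf0 : ∀ t, 0 ≤ f t := fun t => sq_nonneg _
  have hχ : ∀ t : ℝ, HasDerivAt (fun t => t - t ^ 2 / (2 * Λ)) (1 - t / Λ) t := by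
    intro t
    refine ((hasDerivAt_id t).sub (((hasDerivAt_id t).pow 2).div_const (2 * Λ))).congr_deriv ?_
    simp
    field_simp
  have hcut := h.integral_cutoff_le e hQS hres hw hwy hχ (by fun_prop)
    (by positivity : 0 < 2 * Λ) (by simp) (by field_simp; ring)
  have hsplit : ∀ (c : ℝ → ℝ) t, ‖(c t * Real.exp (-a * t)) • S (max t 0) w‖ ^ 2
      = c t ^ 2 * f t := by
    intro c t
    simp only [f]
    rw [mul_smul, norm_smul, mul_pow, Real.norm_eq_abs, sq_abs]
  simp only [hsplit (fun t => t - t ^ 2 / (2 * Λ)), hsplit (fun t => 1 - t / Λ)] at hcut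
  have hi : ∀ p q : ℝ, IntervalIntegrable f MeasureTheory.volume p q :=
    fun p q => hf.intervalIntegrable p q
  have c1 : Continuous fun t : ℝ => (t - t ^ 2 / (2 * Λ)) ^ 2 * f t := by fun_prop
  have c2 : Continuous fun t : ℝ => (1 - t / Λ) ^ 2 * f t := by fun_prop
  have b1 : ∫ t in (0 : ℝ)..(2 * Λ), (1 - t / Λ) ^ 2 * f t ≤ ∫ t in (0 : ℝ)..(2 * Λ), f t := by
    refine intervalIntegral.integral_mono_on (by positivity) (c2.intervalIntegrable _ _) (hi _ _)
      fun t ht => ?_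
    refine mul_le_of_le_one_left (hf0 t) ?_
    have : t / Λ ≤ 2 := by rw [div_le_iff₀ hΛ0]; linarith [ht.2]
    have : 0 ≤ t / Λ := div_nonneg ht.1 hΛ0.le
    nlinarith
  have b2 : ∫ t in (4 * M)..Λ, (4 * M ^ 2) * f t
      ≤ ∫ t in (4 * M)..Λ, (t - t ^ 2 / (2 * Λ)) ^ 2 * f t := by
    refine intervalIntegral.integral_mono_on hΛ ((hi _ _).const_mul _) (c1.intervalIntegrable _ _)
      fun t ht => ?_
    refine mul_le_mul_of_nonneg_right ?_ (hf0 t)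
    have h1 : t ^ 2 / (2 * Λ) ≤ t / 2 := by
      rw [div_le_div_iff₀ (by positivity) (by norm_num)]
      nlinarith [ht.1, ht.2]
    have h2 : 2 * M ≤ t - t ^ 2 / (2 * Λ) := by linarith [ht.1]
    nlinarith
  have b3 : ∫ t in (4 * M)..Λ, (t - t ^ 2 / (2 * Λ)) ^ 2 * f t
      ≤ ∫ t in (0 : ℝ)..(2 * Λ), (t - t ^ 2 / (2 * Λ)) ^ 2 * f t := by
    refine intervalIntegral.integral_mono_interval (by positivity) hΛ (by linarith)
      (Eventually.of_forall fun t => mul_nonneg (sq_nonneg _) (hf0 t)) (c1.intervalIntegrable _ _)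
  rw [intervalIntegral.integral_const_mul] at b2
  have b4 : orbitEnergy S a w (4 * M) + ∫ t in (4 * M)..Λ, f t = orbitEnergy S a w Λ :=
    intervalIntegral.integral_add_adjacent_intervals (hi _ _) (hi _ _)
  have b5 : 4 * M ^ 2 * ∫ t in (4 * M)..Λ, f t ≤ M ^ 2 * orbitEnergy S a w (2 * Λ) := by
    refine (b2.trans (b3.trans hcut)).trans ?_
    gcongr
    exact b1
  have b6 : 4 * ∫ t in (4 * M)..Λ, f t ≤ orbitEnergy S a w (2 * Λ) := by
    refine le_of_mul_le_mul_left (a := M ^ 2) ?_ (by positivity)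
    linarith
  linarith

theorem orbitEnergy_mono (h : IsC0SemigroupWithGenerator S G) (a : ℝ) (w : H) {s t : ℝ}
    (hs : 0 ≤ s) (hst : s ≤ t) : orbitEnergy S a w s ≤ orbitEnergy S a w t :=
  intervalIntegral.integral_mono_interval le_rfl hs hst
    (Eventually.of_forall fun _ => sq_nonneg _) ((h.continuous_energy a w).intervalIntegrable _ _)

theorem orbitEnergy_le_of_le (h : IsC0SemigroupWithGenerator S G) {a : ℝ} {w : H} {Λ B : ℝ}
    (hΛ : 0 ≤ Λ) (hB : ∀ t ∈ Icc (0 : ℝ) Λ, ‖Real.exp (-a * t) • S t w‖ ≤ B) :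
    orbitEnergy S a w Λ ≤ Λ * B ^ 2 := by
  have := intervalIntegral.integral_mono_on hΛ
    ((h.continuous_energy a w).intervalIntegrable _ _)
    (intervalIntegrable_const (μ := MeasureTheory.volume) (c := B ^ 2)) (fun t ht => by
      rw [max_eq_left ht.1]
      exact pow_le_pow_left₀ (norm_nonneg _) (hB t ht) 2)
  simpa [orbitEnergy] using this

/-- A pointwise bound at the end of a time interval by the energy on it. -/
theorem sub_mul_sq_le_orbitEnergy (h : IsC0SemigroupWithGenerator S G) {a : ℝ}
    {Q : H →L[ℝ] H} (hQS : ∀ t, 0 ≤ t → ∀ x, Q (S t x) = S t (Q x)) {w : H} (hw : Q w = w)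
    {r t B : ℝ} (hr : 0 ≤ r) (hrt : r ≤ t)
    (hB : ∀ s ∈ Icc 0 (t - r), Real.exp (-a * s) * ‖(S s).comp Q‖ ≤ B) :
    (t - r) * ‖Real.exp (-a * t) • S t w‖ ^ 2 ≤ B ^ 2 * orbitEnergy S a w t := by
  have h1 : ∫ s in r..t, ‖Real.exp (-a * t) • S t w‖ ^ 2
      ≤ ∫ s in r..t, B ^ 2 * ‖Real.exp (-a * s) • S (max s 0) w‖ ^ 2 := by
    refine intervalIntegral.integral_mono_on hrt intervalIntegrable_const
      (((h.continuous_energy a w).intervalIntegrable _ _).const_mul _) fun s hs => ?_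
    have hs0 : 0 ≤ s := hr.trans hs.1
    rw [max_eq_left hs0, ← mul_pow]
    refine pow_le_pow_left₀ (norm_nonneg _) ?_ 2
    have e1 : S t w = (S (t - s)).comp Q (S s w) := by
      rw [ContinuousLinearMap.comp_apply, hQS s hs0, hw, ← h.apply_add (by linarith [hs.2]) hs0,
        sub_add_cancel]
    have e2 : Real.exp (-a * t) = Real.exp (-a * (t - s)) * Real.exp (-a * s) := by
      rw [← Real.exp_add]; congr 1; ring
    rw [e1, norm_smul, norm_smul, Real.norm_eq_abs, Real.norm_eq_abs, Real.abs_exp, Real.abs_exp,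
      e2]
    calc _ ≤ Real.exp (-a * (t - s)) * Real.exp (-a * s) * (‖(S (t - s)).comp Q‖ * ‖S s w‖) := by
          gcongr; exact ContinuousLinearMap.le_opNorm _ _
      _ = (Real.exp (-a * (t - s)) * ‖(S (t - s)).comp Q‖) * (Real.exp (-a * s) * ‖S s w‖) := by
          ring
      _ ≤ _ := by
          gcongr
          exact hB _ ⟨by linarith [hs.2], by linarith [hs.1]⟩
  rw [intervalIntegral.integral_const, smul_eq_mul, intervalIntegral.integral_const_mul] at h1
  refine h1.trans ?_
  gcongr
  exact intervalIntegral.integral_mono_interval hr hrt le_rfl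
    (Eventually.of_forall fun _ => sq_nonneg _) ((h.continuous_energy a w).intervalIntegrable _ _)

theorem opNorm_le_of_dense {E F : Type*} [NormedAddCommGroup E] [NormedSpace ℝ E]
    [NormedAddCommGroup F] [NormedSpace ℝ F] {A : E →L[ℝ] F} {D : Set E} (hD : Dense D) {C : ℝ}
    (hC : 0 ≤ C) (h : ∀ x ∈ D, ‖A x‖ ≤ C * ‖x‖) : ‖A‖ ≤ C :=
  A.opNorm_le_bound hC fun x => closure_minimal (t := {x | ‖A x‖ ≤ C * ‖x‖}) h
    (isClosed_le (by fun_prop) (by fun_prop)) (hD x)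

/-- The Gearhart-Prüss theorem: on the range of a projection that commutes with the semigroup
and on which the resolvent is bounded on the right half plane, the semigroup decays
exponentially. -/
theorem exists_exp_decay (h : IsC0SemigroupWithGenerator S G) (e : HilbertBasis ℕ ℝ H)
    {Q : H →L[ℝ] H} (hQQ : ∀ x, Q (Q x) = Q x) (hQS : ∀ t, 0 ≤ t → ∀ x, Q (S t x) = S t (Q x))
    (hQG : ∀ x y, G x y → ∃ y', G (Q x) y') {M : ℝ} (hM : 0 < M)
    (hres : ∀ z : ℂ, 0 ≤ z.re →
      HasResolventBoundOn G (LinearMap.range (Q : H →ₗ[ℝ] H)) z M) :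
    ∃ C c : ℝ, 0 ≤ C ∧ 0 < c ∧ ∀ t, 0 ≤ t → ‖(S t).comp Q‖ ≤ C * Real.exp (-c * t) := by
  let φ : ℝ → ℝ → ℝ := fun a t => Real.exp (-a * t) * ‖(S t).comp Q‖
  have hφ0 : ∀ a t, 0 ≤ φ a t := fun a t => by positivity
  have hφm : ∀ a s t, 0 ≤ s → 0 ≤ t → φ a (s + t) ≤ φ a s * φ a t := by
    intro a s t hs ht
    have e1 : (S (s + t)).comp Q = ((S s).comp Q).comp ((S t).comp Q) := by
      ext x
      simp only [ContinuousLinearMap.comp_apply]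
      rw [hQS t ht, hQQ, h.apply_add hs ht]
    have e2 : Real.exp (-a * (s + t)) = Real.exp (-a * s) * Real.exp (-a * t) := by
      rw [← Real.exp_add]; congr 1; ring
    simp only [φ]
    rw [e1, e2]
    calc _ ≤ Real.exp (-a * s) * Real.exp (-a * t) * (‖(S s).comp Q‖ * ‖(S t).comp Q‖) := by
          gcongr; exact ContinuousLinearMap.opNorm_comp_le _ _
      _ = _ := by ring
  have hbd : ∀ T : ℝ, ∃ K : ℝ, 0 < K ∧ ∀ a, 0 ≤ a → ∀ t ∈ Icc 0 T, φ a t ≤ K := by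
    intro T
    obtain ⟨K, hK, hb⟩ := h.exists_bound T
    refine ⟨K * (‖Q‖ + 1), by positivity, fun a ha t ht => ?_⟩
    have h1 : Real.exp (-a * t) ≤ 1 := Real.exp_le_one_iff.2 (by nlinarith [ht.1])
    have h2 : ‖(S t).comp Q‖ ≤ K * (‖Q‖ + 1) := by
      refine (ContinuousLinearMap.opNorm_comp_le _ _).trans ?_
      exact mul_le_mul (hb t ht) (by linarith) (norm_nonneg _) hK.le
    calc _ ≤ 1 * (K * (‖Q‖ + 1)) := mul_le_mul h1 h2 (norm_nonneg _) zero_le_one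
      _ = _ := one_mul _
  -- Continuation in the weight. `P a` holds for large `a`, and the bounds derived from it below are
  -- independent of `a` and of the constants `C`, `c` in it. The weight can therefore be lowered by
  -- a fixed amount `ε` at a time, down to `a = 0`.
  let P : ℝ → Prop := fun a =>
    ∃ C c : ℝ, 0 ≤ C ∧ 0 < c ∧ ∀ t, 0 ≤ t → φ a t ≤ C * Real.exp (-c * t)
  have hP : ∀ a, 0 ≤ a → ∀ t₀, 0 < t₀ → φ a t₀ ≤ 3 / 4 → P a := by
    intro a ha t₀ ht₀ hle
    obtain ⟨K, -, hK⟩ := hbd t₀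
    exact exists_exp_bound_of_submultiplicative (hφ0 a) (hφm a) ht₀ (hK a ha)
      (by norm_num) (by norm_num) hle
  have hval : ∀ a t w, Q w = w → ‖Real.exp (-a * t) • S t w‖ ≤ φ a t * ‖w‖ := by
    intro a t w hw
    rw [norm_smul, Real.norm_eq_abs, Real.abs_exp, mul_assoc]
    gcongr
    have : S t w = (S t).comp Q w := by rw [ContinuousLinearMap.comp_apply, hw]
    rw [this]
    exact ContinuousLinearMap.le_opNorm _ _
  obtain ⟨K, hK0, hK⟩ := hbd (4 * M)
  obtain ⟨K₁, hK₁0, hK₁⟩ := hbd 1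
  -- The energy on `[0, 4M]` is at most `4 * M * K ^ 2 * ‖w‖ ^ 2`, and `le_of_le_add_quarter`
  -- extends this to all times at the cost of the factor `4 / 3`. `P a` is used only for an a priori
  -- bound that is lost in the limit.
  let C₁ : ℝ := 4 / 3 * (4 * M * K ^ 2)
  have hC₁ : 0 < C₁ := by positivity
  have henergy : ∀ a, 0 ≤ a → P a → ∀ w y, Q w = w → G w y → ∀ Λ, 0 ≤ Λ →
      orbitEnergy S a w Λ ≤ C₁ * ‖w‖ ^ 2 := by
    rintro a ha ⟨C, c, hC, hc, hdec⟩ w y hw hwy Λ hΛ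
    have h1 : orbitEnergy S a w (4 * M) ≤ 4 * M * (K * ‖w‖) ^ 2 :=
      h.orbitEnergy_le_of_le (by positivity) fun t ht => (hval a t w hw).trans (by
        gcongr; exact hK a ha t ht)
    have h2 : ∀ Λ, 4 * M ≤ Λ → orbitEnergy S a w Λ ≤ (C * ‖w‖) ^ 2 / (2 * c) := by
      intro Λ hΛ
      have hΛ0 : 0 ≤ Λ := by linarith
      have := intervalIntegral.integral_mono_on hΛ0
        ((h.continuous_energy a w).intervalIntegrable _ _)
        (Continuous.intervalIntegrable (μ := MeasureTheory.volume)
          (u := fun t => (C * ‖w‖) ^ 2 * Real.exp (-(2 * c) * t)) (by fun_prop) _ _)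
        (fun t ht => by
          rw [max_eq_left ht.1]
          have h3 := (hval a t w hw).trans
            (mul_le_mul_of_nonneg_right (hdec t ht.1) (norm_nonneg w))
          refine (pow_le_pow_left₀ (norm_nonneg _) h3 2).trans (le_of_eq ?_)
          have : Real.exp (-(2 * c) * t) = Real.exp (-c * t) ^ 2 := by
            rw [← Real.exp_nat_mul]; congr 1; push_cast; ring
          rw [this]; ring)
      refine this.trans ?_
      rw [intervalIntegral.integral_const_mul, intervalIntegral.integral_comp_mul_left
        (fun x => Real.exp x) (by linarith : -(2 * c) ≠ 0), integral_exp, div_eq_mul_inv]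
      gcongr
      rw [mul_zero, Real.exp_zero, smul_eq_mul]
      have h4 := Real.exp_pos (-(2 * c) * Λ)
      have h5 : (-(2 * c))⁻¹ = -(2 * c)⁻¹ := by rw [inv_neg]
      have h6 : 0 < (2 * c)⁻¹ := by positivity
      rw [h5]
      nlinarith
    have h0 : 0 ≤ orbitEnergy S a w (4 * M) :=
      intervalIntegral.integral_nonneg (by positivity) fun _ _ => sq_nonneg _
    have h3 := fun (Λ : ℝ) (hΛ : 4 * M ≤ Λ) => le_of_le_add_quarter (by positivity)
      (fun Λ hΛ => h.orbitEnergy_le_add e hQS hM (a := a) (fun z hz => hres z (hz ▸ ha)) hw hwy hΛ)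
      h2 hΛ h0
    calc _ ≤ orbitEnergy S a w (max Λ (4 * M)) := h.orbitEnergy_mono a w hΛ (le_max_left _ _)
      _ ≤ 4 / 3 * orbitEnergy S a w (4 * M) := h3 _ (le_max_right _ _)
      _ ≤ 4 / 3 * (4 * M * (K * ‖w‖) ^ 2) := by gcongr
      _ = _ := by simp only [C₁]; ring
  let B : ℝ := max K₁ (K₁ * √C₁ * ‖Q‖)
  have hB0 : 0 < B := lt_max_of_lt_left hK₁0
  have hB : ∀ a, 0 ≤ a → P a → ∀ t, 0 ≤ t → φ a t ≤ B := by
    intro a ha hPa t ht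
    rcases le_or_gt t 1 with h1 | h1
    · exact (hK₁ a ha t ⟨ht, h1⟩).trans (le_max_left _ _)
    refine le_trans ?_ (le_max_right _ _)
    have : φ a t = ‖Real.exp (-a * t) • (S t).comp Q‖ := by
      rw [norm_smul, Real.norm_eq_abs, Real.abs_exp]
    rw [this]
    refine opNorm_le_of_dense h.dense_domain (by positivity) ?_
    rintro x ⟨y, hxy⟩
    obtain ⟨y', hy'⟩ := hQG x y hxy
    have h2 := h.sub_mul_sq_le_orbitEnergy (a := a) hQS (hQQ x) (r := t - 1) (t := t) (B := K₁)
      (by linarith) (by linarith) (fun s hs => hK₁ a ha s (by simpa using hs))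
    rw [sub_sub_cancel, one_mul] at h2
    have h3 : ‖Real.exp (-a * t) • S t (Q x)‖ ^ 2 ≤ (K₁ * √C₁ * ‖Q‖ * ‖x‖) ^ 2 := by
      calc _ ≤ K₁ ^ 2 * orbitEnergy S a (Q x) t := h2
        _ ≤ K₁ ^ 2 * (C₁ * ‖Q x‖ ^ 2) := by
            gcongr; exact henergy a ha hPa (Q x) y' (hQQ x) hy' t ht
        _ ≤ K₁ ^ 2 * (C₁ * (‖Q‖ * ‖x‖) ^ 2) := by gcongr; exact Q.le_opNorm x
        _ = _ := by
            rw [mul_pow, mul_pow, mul_pow, mul_pow, Real.sq_sqrt hC₁.le]; ring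
    exact abs_le_of_sq_le_sq' h3 (by positivity) |>.2
  -- Averaging over `[0, t₀]` gives `t₀ ‖·‖² ≤ B² C₁ ‖Q‖² ‖x‖² = (t₀ - 1) / 4 * ‖x‖²`, hence a norm
  -- at most `1/2` at time `t₀`.
  let t₀ : ℝ := 4 * (B ^ 2 * (C₁ * ‖Q‖ ^ 2)) + 1
  have ht₀ : 0 < t₀ := by positivity
  have hhalf : ∀ a, 0 ≤ a → P a → φ a t₀ ≤ 1 / 2 := by
    intro a ha hPa
    have : φ a t₀ = ‖Real.exp (-a * t₀) • (S t₀).comp Q‖ := by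
      rw [norm_smul, Real.norm_eq_abs, Real.abs_exp]
    rw [this]
    refine opNorm_le_of_dense h.dense_domain (by positivity) ?_
    rintro x ⟨y, hxy⟩
    obtain ⟨y', hy'⟩ := hQG x y hxy
    have h2 := h.sub_mul_sq_le_orbitEnergy (a := a) hQS (hQQ x) (r := 0) (t := t₀) (B := B)
      le_rfl ht₀.le (fun s hs => hB a ha hPa s hs.1)
    rw [sub_zero] at h2
    have h3 : t₀ * ‖Real.exp (-a * t₀) • S t₀ (Q x)‖ ^ 2 ≤ t₀ * (1 / 2 * ‖x‖) ^ 2 := by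
      calc _ ≤ B ^ 2 * orbitEnergy S a (Q x) t₀ := h2
        _ ≤ B ^ 2 * (C₁ * ‖Q x‖ ^ 2) := by
            gcongr; exact henergy a ha hPa (Q x) y' (hQQ x) hy' t₀ ht₀.le
        _ ≤ B ^ 2 * (C₁ * (‖Q‖ * ‖x‖) ^ 2) := by gcongr; exact Q.le_opNorm x
        _ = (t₀ - 1) * (1 / 2 * ‖x‖) ^ 2 := by simp only [t₀]; ring
        _ ≤ _ := by gcongr; linarith
    exact abs_le_of_sq_le_sq' (le_of_mul_le_mul_left h3 ht₀) (by positivity) |>.2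
  -- Lowering the weight by `ε` multiplies the norm at time `t₀` by at most `3/2`, and `3/2 * 1/2 =
  -- 3/4` still suffices for decay.
  let ε : ℝ := Real.log (3 / 2) / t₀
  have hε : 0 < ε := div_pos (Real.log_pos (by norm_num)) ht₀
  have hstep : ∀ a, 0 ≤ a → P a → ∀ a', 0 ≤ a' → a - ε ≤ a' → P a' := by
    intro a ha hPa a' ha' hle
    refine hP a' ha' t₀ ht₀ ?_
    have h1 : φ a' t₀ = Real.exp ((a - a') * t₀) * φ a t₀ := by
      simp only [φ]
      rw [← mul_assoc, ← Real.exp_add]; congr 2; ring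
    have h2 : Real.exp ((a - a') * t₀) ≤ 3 / 2 := by
      rw [← Real.le_log_iff_exp_le (by norm_num), ← le_div_iff₀ ht₀]
      change a - a' ≤ ε
      linarith
    rw [h1]
    calc _ ≤ 3 / 2 * (1 / 2 : ℝ) := mul_le_mul h2 (hhalf a ha hPa) (hφ0 _ _) (by norm_num)
      _ = _ := by norm_num
  -- A weight this large beats the bound `K₁` of the projected semigroup at time `1`.
  obtain ⟨a₀, ha₀, hPa₀⟩ : ∃ a₀, 0 ≤ a₀ ∧ P a₀ := by
    have h0 : 0 ≤ Real.log (2 * K₁ + 2) := Real.log_nonneg (by linarith)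
    refine ⟨Real.log (2 * K₁ + 2), h0, hP _ h0 1 one_pos ?_⟩
    have h1 := hK₁ 0 le_rfl 1 ⟨zero_le_one, le_rfl⟩
    simp only [φ, neg_zero, zero_mul, Real.exp_zero, one_mul] at h1
    simp only [φ, mul_one]
    rw [Real.exp_neg, Real.exp_log (by linarith), inv_mul_le_iff₀ (by linarith)]
    linarith
  have hind : ∀ n : ℕ, P (max 0 (a₀ - n * ε)) := by
    intro n
    induction n with
    | zero => simpa [ha₀] using hPa₀
    | succ n ih =>
      refine hstep _ (le_max_left _ _) ih _ (le_max_left _ _) ?_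
      rcases le_total (a₀ - n * ε) 0 with h1 | h1
      · rw [max_eq_left h1]
        exact le_max_of_le_left (by linarith)
      · rw [max_eq_right h1]
        refine le_max_of_le_right ?_
        push_cast; linarith
  obtain ⟨n, hn⟩ := exists_nat_gt (a₀ / ε)
  have h1 := hind n
  rw [max_eq_left (by rw [div_lt_iff₀ hε] at hn; linarith)] at h1
  obtain ⟨C, c, hC, hc, hdec⟩ := h1
  refine ⟨C, c, hC, hc, fun t ht => ?_⟩
  simpa [φ] using hdec t ht

end IsC0SemigroupWithGenerator

/-! ### Geometric attraction to a manifold of fixed points -/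

section Attraction
variable {E Y : Type*} [NormedAddCommGroup E] [NormedSpace ℝ E] [CompleteSpace E]
  [NormedAddCommGroup Y] [NormedSpace ℝ Y] [CompleteSpace Y]

/-- A manifold of fixed points that attracts to first order attracts: iterates that start near it
converge geometrically to points of it. -/
theorem exists_geometric_attraction {F : E → E} {σ : Y → E} {Q : E →L[ℝ] E} {s : Y →L[ℝ] E}
    {l : E →L[ℝ] Y} (hF : HasStrictFDerivAt F Q 0) (hσ : HasStrictFDerivAt σ s 0) (hσ0 : σ 0 = 0)
    (hfix : ∀ η, F (σ η) = σ η) (hls : ∀ η, l (s η) = η) (hlQ : ∀ x, l (Q x) = l x)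
    (hV : ‖Q - s.comp l‖ ≤ 1 / 4) :
    ∃ r > 0, ∃ C ≥ 0, ∀ x, ‖x‖ < r → ∃ p, ‖p‖ ≤ C * ‖x‖ ∧
      ∀ n, ‖F^[n] x - σ p‖ ≤ C * (1 / 2) ^ n * ‖x‖ := by
  have hF0 : F 0 = 0 := by have := hfix 0; rwa [hσ0] at this
  have hg : HasStrictFDerivAt (fun η => l (σ η))
      ((ContinuousLinearEquiv.refl ℝ Y : Y ≃L[ℝ] Y) : Y →L[ℝ] Y) 0 := by
    have h1 : HasStrictFDerivAt (fun η => l (σ η)) (l.comp s) 0 :=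
      l.hasStrictFDerivAt.comp 0 hσ
    refine h1.congr_fderiv ?_
    ext η; simp [hls]
  let k : Y → Y := hg.localInverse (fun η => l (σ η)) _ 0
  have hk0 : k 0 = 0 := by
    have := hg.localInverse_apply_image
    simpa [hσ0] using this
  have hkd : HasStrictFDerivAt k (ContinuousLinearMap.id ℝ Y) (l 0) := by
    have := hg.to_localInverse
    simp only [hσ0] at this
    exact this
  have hkr : ∀ᶠ y in 𝓝 (0 : Y), l (σ (k y)) = y := by
    have := hg.eventually_right_inverse
    simpa only [hσ0, map_zero] using this
  let κ : E → Y := fun x => k (l x)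
  have hκ : HasStrictFDerivAt κ l 0 := by
    have : HasStrictFDerivAt κ ((ContinuousLinearMap.id ℝ Y).comp l) 0 :=
      hkd.comp 0 l.hasStrictFDerivAt
    exact this.congr_fderiv (by ext; simp)
  have hκ0 : κ 0 = 0 := by simp [κ, hk0]
  -- `ρ` retracts a neighbourhood of `0` onto the manifold of fixed points, so `x - ρ x` measures
  -- the distance from it.
  let ρ : E → E := fun x => σ (κ x)
  have hρ : HasStrictFDerivAt ρ (s.comp l) 0 := by
    have h1 : HasStrictFDerivAt σ s (κ 0) := by rwa [hκ0]
    exact h1.comp 0 hκ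
  have hρ0 : ρ 0 = 0 := by simp [ρ, hκ0, hσ0]
  have hlρ : ∀ᶠ x in 𝓝 (0 : E), ρ (ρ x) = ρ x := by
    have : Tendsto l (𝓝 0) (𝓝 0) := by simpa using l.continuous.tendsto 0
    filter_upwards [this.eventually hkr] with x hx
    have : l (ρ x) = l x := hx
    simp only [ρ, κ] at this ⊢
    rw [this]
  have hFρ : ∀ x, F (ρ x) = ρ x := fun x => hfix _
  -- This map vanishes at `ρ x`, and its derivative at `0` is the contraction `Q - s.comp l`. A
  -- Lipschitz constant `1/2` between `x` and `ρ x` thus says that `F` halves the distance from the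
  -- manifold.
  have hh : HasStrictFDerivAt (fun x => F x - ρ (F x)) (Q - s.comp l) 0 := by
    have h1 : HasStrictFDerivAt ρ (s.comp l) (F 0) := by rwa [hF0]
    refine (hF.sub (h1.comp 0 hF)).congr_fderiv ?_
    ext x; simp [hlQ]
  obtain ⟨U₁, hU₁, hL₁⟩ := hh.exists_lipschitzOnWith_of_nnnorm_lt (1 / 2) (by
    rw [← NNReal.coe_lt_coe]
    refine lt_of_le_of_lt hV ?_
    norm_num)
  obtain ⟨C₁, U₂, hU₂, hL₂⟩ := (hF.sub (hasStrictFDerivAt_id 0)).exists_lipschitzOnWith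
  obtain ⟨C₂, U₃, hU₃, hL₃⟩ := ((hasStrictFDerivAt_id (0 : E)).sub hρ).exists_lipschitzOnWith
  obtain ⟨C₃, U₄, hU₄, hL₄⟩ := hκ.exists_lipschitzOnWith
  have hρc : Tendsto ρ (𝓝 0) (𝓝 0) := by
    have := hρ.continuousAt.tendsto; rwa [hρ0] at this
  have hall : ∀ᶠ x in 𝓝 (0 : E), (ρ (ρ x) = ρ x ∧ x ∈ U₁ ∧ ρ x ∈ U₁) ∧
      (x ∈ U₂ ∧ ρ x ∈ U₂) ∧ x ∈ U₃ ∧ x ∈ U₄ :=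
    (hlρ.and (.and hU₁ (hρc.eventually hU₁))).and
      ((Filter.Eventually.and hU₂ (hρc.eventually hU₂)).and (.and hU₃ hU₄))
  obtain ⟨R, hR, hball⟩ := Metric.eventually_nhds_iff_ball.1 hall
  have hball' : ∀ x : E, ‖x‖ < R → _ := fun x hx => hball x (by simpa using hx)
  have b1 : ∀ x, ‖x‖ < R → ‖F x - ρ (F x)‖ ≤ 1 / 2 * ‖x - ρ x‖ := by
    intro x hx
    obtain ⟨⟨e1, e2, e3⟩, -⟩ := hball' x hx
    have := hL₁.dist_le_mul x e2 (ρ x) e3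
    simpa [dist_eq_norm, hFρ, e1] using this
  have b2 : ∀ x, ‖x‖ < R → ‖F x - x‖ ≤ C₁ * ‖x - ρ x‖ := by
    intro x hx
    obtain ⟨-, ⟨e2, e3⟩, -⟩ := hball' x hx
    have := hL₂.dist_le_mul x e2 (ρ x) e3
    simpa [dist_eq_norm, hFρ] using this
  have z3 : (0 : E) ∈ U₃ := mem_of_mem_nhds hU₃
  have z4 : (0 : E) ∈ U₄ := mem_of_mem_nhds hU₄
  have b3 : ∀ x, ‖x‖ < R → ‖x - ρ x‖ ≤ C₂ * ‖x‖ := by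
    intro x hx
    have := hL₃.dist_le_mul x (hball' x hx).2.2.1 0 z3
    simpa [dist_eq_norm, hρ0] using this
  have b4 : ∀ x, ‖x‖ < R → ‖κ x‖ ≤ C₃ * ‖x‖ := by
    intro x hx
    have := hL₄.dist_le_mul x (hball' x hx).2.2.2 0 z4
    simpa [dist_eq_norm, hκ0] using this
  -- The displacements `F y - y` along the orbit are geometrically small and add up to at most `2 C₁
  -- C₂ ‖x‖`. Starting within `R / D` keeps the orbit in the ball of radius `R` where the estimates
  -- hold.
  let D : ℝ := 1 + 2 * (C₁ * C₂)
  have hD : 0 < D := by positivity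
  refine ⟨R / D, by positivity, 2 * (C₁ * C₂) + C₃ * D, by positivity, fun x hx => ?_⟩
  rw [lt_div_iff₀ hD] at hx
  have hind : ∀ n, ‖F^[n] x - x‖ ≤ C₁ * C₂ * ‖x‖ * (2 - 2 * (1 / 2) ^ n) ∧
      ‖F^[n] x - ρ (F^[n] x)‖ ≤ (1 / 2) ^ n * (C₂ * ‖x‖) := by
    have hin : ∀ n, ‖F^[n] x - x‖ ≤ C₁ * C₂ * ‖x‖ * (2 - 2 * (1 / 2) ^ n) → ‖F^[n] x‖ < R := by
      intro n hn
      have h1 : (0 : ℝ) ≤ (1 / 2) ^ n := by positivity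
      calc ‖F^[n] x‖ = ‖(F^[n] x - x) + x‖ := by rw [sub_add_cancel]
        _ ≤ C₁ * C₂ * ‖x‖ * (2 - 2 * (1 / 2) ^ n) + ‖x‖ := (norm_add_le _ _).trans (by gcongr)
        _ ≤ C₁ * C₂ * ‖x‖ * 2 + ‖x‖ := by gcongr; linarith
        _ = ‖x‖ * D := by simp only [D]; ring
        _ < R := hx
    intro n
    induction n with
    | zero =>
      simp only [Function.iterate_zero, id_eq, sub_self, norm_zero, pow_zero, one_mul, mul_one]
      refine ⟨by simp, b3 x ?_⟩
      simpa using hin 0 (by simp)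
    | succ n ih =>
      have hn := hin n ih.1
      rw [Function.iterate_succ_apply']
      constructor
      · calc ‖F (F^[n] x) - x‖ = ‖(F (F^[n] x) - F^[n] x) + (F^[n] x - x)‖ := by
              rw [sub_add_sub_cancel]
          _ ≤ C₁ * ((1 / 2) ^ n * (C₂ * ‖x‖)) + C₁ * C₂ * ‖x‖ * (2 - 2 * (1 / 2) ^ n) := by
              refine (norm_add_le _ _).trans (add_le_add ((b2 _ hn).trans ?_) ih.1)
              gcongr; exact ih.2
          _ = _ := by rw [pow_succ]; ring
      · calc _ ≤ 1 / 2 * ‖F^[n] x - ρ (F^[n] x)‖ := b1 _ hn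
          _ ≤ 1 / 2 * ((1 / 2) ^ n * (C₂ * ‖x‖)) := by gcongr; exact ih.2
          _ = _ := by rw [pow_succ]; ring
  have hbd : ∀ n, ‖F^[n] x - x‖ ≤ 2 * (C₁ * C₂) * ‖x‖ := by
    intro n
    refine (hind n).1.trans ?_
    have h1 : (0 : ℝ) ≤ (1 / 2) ^ n := by positivity
    calc _ ≤ C₁ * C₂ * ‖x‖ * 2 := by gcongr; linarith
      _ = _ := by ring
  have hle : ∀ y, ‖y - x‖ ≤ 2 * (C₁ * C₂) * ‖x‖ → ‖y‖ ≤ D * ‖x‖ := by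
    intro y hy
    calc ‖y‖ = ‖(y - x) + x‖ := by rw [sub_add_cancel]
      _ ≤ 2 * (C₁ * C₂) * ‖x‖ + ‖x‖ := (norm_add_le _ _).trans (by gcongr)
      _ = _ := by simp only [D]; ring
  have hstep : ∀ n, dist (F^[n] x) (F^[n + 1] x) ≤ (C₁ * C₂ * ‖x‖) * (1 / 2) ^ n := by
    intro n
    rw [dist_comm, dist_eq_norm, Function.iterate_succ_apply']
    have hn : ‖F^[n] x‖ < R := (hle _ (hbd n)).trans_lt (by rwa [mul_comm])
    refine (b2 _ hn).trans ?_
    calc _ ≤ C₁ * ((1 / 2) ^ n * (C₂ * ‖x‖)) := by gcongr; exact (hind n).2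
      _ = _ := by ring
  obtain ⟨z, hz⟩ := cauchySeq_tendsto_of_complete
    (cauchySeq_of_le_geometric (1 / 2) _ (by norm_num) hstep)
  have hzx : ‖z - x‖ ≤ 2 * (C₁ * C₂) * ‖x‖ :=
    le_of_tendsto' (hz.sub_const x).norm hbd
  have hzR : ‖z‖ < R := (hle z hzx).trans_lt (by rwa [mul_comm])
  -- The distance from the manifold tends to zero along the orbit, so the limit lies on the
  -- manifold.
  have hzρ : z = ρ z := by
    have hc : ContinuousAt (fun x => x - ρ x) z :=
      (hL₃.continuousOn).continuousAt (mem_of_superset (Metric.isOpen_ball.mem_nhds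
        (by simpa using hzR : z ∈ Metric.ball (0 : E) R)) fun y hy =>
          (hball y hy).2.2.1)
    have h1 := hc.tendsto.comp hz
    have h2 : Tendsto (fun n => (1 / 2 : ℝ) ^ n * (C₂ * ‖x‖)) atTop (𝓝 0) := by
      simpa using (tendsto_pow_atTop_nhds_zero_of_lt_one (r := (1 / 2 : ℝ)) (by norm_num)
        (by norm_num)).mul_const (C₂ * ‖x‖)
    have h3 := squeeze_zero_norm (fun n => (hind n).2) h2
    exact sub_eq_zero.1 (tendsto_nhds_unique h1 h3)
  refine ⟨κ z, ?_, fun n => ?_⟩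
  · calc _ ≤ C₃ * ‖z‖ := b4 z hzR
      _ ≤ C₃ * (D * ‖x‖) := by gcongr; exact hle z hzx
      _ ≤ (2 * (C₁ * C₂) + C₃ * D) * ‖x‖ := by
          have : 0 ≤ 2 * ((C₁ : ℝ) * C₂) * ‖x‖ := by positivity
          linarith
  · change ‖F^[n] x - ρ z‖ ≤ _
    rw [← hzρ, ← dist_eq_norm]
    refine (dist_le_of_le_geometric_of_tendsto (1 / 2) _ (by norm_num) hstep hz n).trans ?_
    have : 0 ≤ (C₃ : ℝ) * D * (1 / 2) ^ n * ‖x‖ := by positivity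
    calc _ = 2 * (C₁ * C₂) * (1 / 2) ^ n * ‖x‖ := by ring
      _ ≤ _ := by linarith

end Attraction

/-! ### Limits of geometrically convergent sequences of smooth maps -/

section GeometricLimits
variable {E G : Type*} [NormedAddCommGroup E] [NormedSpace ℝ E]
  [NormedAddCommGroup G] [NormedSpace ℝ G]

theorem exists_limit_of_geometric [CompleteSpace G] {α : Type*} {U : Set α} {F : ℕ → α → G} {K : ℝ}
    (h : ∀ x ∈ U, ∀ n, ‖F n x - F (n + 1) x‖ ≤ K * (1 / 2) ^ n) :
    ∃ Φ : α → G, ∀ x ∈ U, ∀ n, ‖F n x - Φ x‖ ≤ 2 * K * (1 / 2) ^ n := by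
  have : ∀ x, ∃ z, x ∈ U → ∀ n, ‖F n x - z‖ ≤ 2 * K * (1 / 2) ^ n := by
    intro x
    by_cases hx : x ∈ U
    · have hd : ∀ n, dist (F n x) (F (n + 1) x) ≤ K * (1 / 2) ^ n := fun n => by
        rw [dist_eq_norm]; exact h x hx n
      obtain ⟨z, hz⟩ := cauchySeq_tendsto_of_complete
        (cauchySeq_of_le_geometric (1 / 2) _ (by norm_num) hd)
      refine ⟨z, fun _ n => ?_⟩
      rw [← dist_eq_norm]
      refine (dist_le_of_le_geometric_of_tendsto (1 / 2) _ (by norm_num) hd hz n).trans_eq ?_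
      ring
    · exact ⟨0, fun h => absurd h hx⟩
  choose Φ hΦ using this
  exact ⟨Φ, hΦ⟩

theorem tendstoUniformlyOn_of_geometric {α : Type*} {U : Set α} {F : ℕ → α → G} {Φ : α → G} {K : ℝ}
    (h : ∀ x ∈ U, ∀ n, ‖F n x - Φ x‖ ≤ 2 * K * (1 / 2) ^ n) :
    TendstoUniformlyOn F Φ atTop U := by
  rw [Metric.tendstoUniformlyOn_iff]
  intro ε hε
  have h2 : Tendsto (fun n => 2 * K * (1 / 2 : ℝ) ^ n) atTop (𝓝 0) := by
    simpa using (tendsto_pow_atTop_nhds_zero_of_lt_one (r := (1 / 2 : ℝ)) (by norm_num)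
      (by norm_num)).const_mul (2 * K)
  filter_upwards [h2.eventually_lt_const hε] with n hn x hx
  rw [dist_comm, dist_eq_norm]
  exact (h x hx n).trans_lt hn

theorem contDiffOn_succ_of_hasFDerivAt {n : ℕ} {U : Set E} (hU : IsOpen U) {Φ : E → G}
    {Φ' : E → E →L[ℝ] G} (h : ∀ x ∈ U, HasFDerivAt Φ (Φ' x) x) (h' : ContDiffOn ℝ n Φ' U) :
    ContDiffOn ℝ (n + 1) Φ U := by
  rw [contDiffOn_succ_iff_fderiv_of_isOpen hU]
  refine ⟨fun x hx => (h x hx).differentiableAt.differentiableWithinAt, by simp, ?_⟩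
  exact h'.congr fun x hx => (h x hx).fderiv

theorem exists_contDiffOn_two_of_geometric [CompleteSpace G] {U : Set E} (hU : IsOpen U)
    {F : ℕ → E → G} (hF : ∀ n, ContDiff ℝ 2 (F n)) {K : ℝ}
    (h0 : ∀ x ∈ U, ∀ n, ‖F n x - F (n + 1) x‖ ≤ K * (1 / 2) ^ n)
    (h1 : ∀ x ∈ U, ∀ n, ‖fderiv ℝ (F n) x - fderiv ℝ (F (n + 1)) x‖ ≤ K * (1 / 2) ^ n)
    (h2 : ∀ x ∈ U, ∀ n, ‖fderiv ℝ (fderiv ℝ (F n)) x - fderiv ℝ (fderiv ℝ (F (n + 1))) x‖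
      ≤ K * (1 / 2) ^ n) :
    ∃ Φ : E → G, ContDiffOn ℝ 2 Φ U ∧ ∀ x ∈ U, ∀ n, ‖F n x - Φ x‖ ≤ 2 * K * (1 / 2) ^ n ∧
      ‖fderiv ℝ (F n) x - fderiv ℝ Φ x‖ ≤ 2 * K * (1 / 2) ^ n := by
  obtain ⟨Φ, hΦ⟩ := exists_limit_of_geometric h0
  obtain ⟨Φ₁, hΦ₁⟩ := exists_limit_of_geometric h1
  obtain ⟨Φ₂, hΦ₂⟩ := exists_limit_of_geometric (F := fun n => fderiv ℝ (fderiv ℝ (F n))) h2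
  have u0 := tendstoUniformlyOn_of_geometric hΦ
  have u1 := tendstoUniformlyOn_of_geometric hΦ₁
  have u2 := tendstoUniformlyOn_of_geometric hΦ₂
  have hF1 : ∀ n, ContDiff ℝ 1 (fderiv ℝ (F n)) := fun n =>
    (hF n).fderiv_right (by norm_num)
  have d1 : ∀ x ∈ U, HasFDerivAt Φ₁ (Φ₂ x) x := fun x hx =>
    hasFDerivAt_of_tendstoUniformlyOn hU u2
      (fun n x _ => ((hF1 n).differentiable (by norm_num) x).hasFDerivAt)
      (fun x hx => u1.tendsto_at hx) hx
  have d0 : ∀ x ∈ U, HasFDerivAt Φ (Φ₁ x) x := fun x hx =>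
    hasFDerivAt_of_tendstoUniformlyOn hU u1
      (fun n x _ => ((hF n).differentiable (by norm_num) x).hasFDerivAt)
      (fun x hx => u0.tendsto_at hx) hx
  have c2 : ContinuousOn Φ₂ U := u2.continuousOn (Frequently.of_forall fun n =>
    ((hF1 n).continuous_fderiv (by norm_num)).continuousOn)
  have c1 : ContDiffOn ℝ 1 Φ₁ U := by
    have := contDiffOn_succ_of_hasFDerivAt (n := 0) hU d1 (contDiffOn_zero.2 c2)
    simpa using this
  refine ⟨Φ, ?_, fun x hx n => ⟨hΦ x hx n, ?_⟩⟩
  · have := contDiffOn_succ_of_hasFDerivAt (n := 1) hU d0 (by exact_mod_cast c1)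
    have e : ((1 : ℕ) : WithTop ℕ∞) + 1 = 2 := by norm_num
    rwa [e] at this
  · rw [(d0 x hx).fderiv]; exact hΦ₁ x hx n

end GeometricLimits

/-! ### Tangent maps -/

section Tangent
variable {E G : Type*} [NormedAddCommGroup E] [NormedSpace ℝ E]
  [NormedAddCommGroup G] [NormedSpace ℝ G]

/-- The tangent map `(x, a) ↦ (F x, DF(x) a)`. -/
noncomputable def tmap (F : E → G) (p : E × E) : G × G := (F p.1, fderiv ℝ F p.1 p.2)

theorem contDiff_tmap {n : ℕ} {F : E → G} (hF : ContDiff ℝ (n + 1) F) : ContDiff ℝ n (tmap F) :=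
  ((hF.of_le (by exact_mod_cast Nat.le_succ n)).comp contDiff_fst).prodMk
    (hF.contDiff_fderiv_apply le_rfl)

theorem tmap_comp {E' : Type*} [NormedAddCommGroup E'] [NormedSpace ℝ E'] {F : E → G} {F' : E' → E}
    (hF : Differentiable ℝ F) (hF' : Differentiable ℝ F') :
    tmap (F ∘ F') = tmap F ∘ tmap F' := by
  ext p
  · rfl
  · simp [tmap, fderiv_comp _ (hF _) (hF' _)]

theorem tmap_iterate {F : E → E} (hF : Differentiable ℝ F) (n : ℕ) :
    tmap (F^[n]) = (tmap F)^[n] := by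
  induction n with
  | zero => ext p <;> simp [tmap]
  | succ n ih => rw [Function.iterate_succ', tmap_comp hF (hF.iterate n), ih,
      ← Function.iterate_succ']

theorem hasFDerivAt_tmap {F : E → G} (hF : ContDiff ℝ 2 F) (p : E × E) :
    HasFDerivAt (tmap F) (((fderiv ℝ F p.1).comp (.fst ℝ E E)).prod
      (((fderiv ℝ (fderiv ℝ F) p.1).flip p.2).comp (.fst ℝ E E)
        + (fderiv ℝ F p.1).comp (.snd ℝ E E))) p := by
  have h1 : HasFDerivAt F (fderiv ℝ F p.1) p.1 :=
    (hF.differentiable (by norm_num) _).hasFDerivAt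
  have h2 : HasFDerivAt (fderiv ℝ F) (fderiv ℝ (fderiv ℝ F) p.1) p.1 :=
    ((hF.fderiv_right (m := 1) (by norm_num)).differentiable (by norm_num) _).hasFDerivAt
  have hf : HasFDerivAt (fun p : E × E => p.1) (.fst ℝ E E) p := hasFDerivAt_fst
  have hs : HasFDerivAt (fun p : E × E => p.2) (.snd ℝ E E) p := hasFDerivAt_snd
  refine (HasFDerivAt.prodMk (h1.comp p hf) ((h2.comp p hf).clm_apply hs)).congr_fderiv ?_
  ext q <;> simp [add_comm]

theorem fderiv_tmap_apply {F : E → G} (hF : ContDiff ℝ 2 F) (p q : E × E) :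
    fderiv ℝ (tmap F) p q =
      (fderiv ℝ F p.1 q.1, fderiv ℝ (fderiv ℝ F) p.1 q.1 p.2 + fderiv ℝ F p.1 q.2) := by
  rw [(hasFDerivAt_tmap hF p).fderiv]; simp

theorem fderiv_tmap_zero {F : E → G} (hF : ContDiff ℝ 2 F) :
    fderiv ℝ (tmap F) 0 = (fderiv ℝ F 0).prodMap (fderiv ℝ F 0) := by
  ext q <;> simp [fderiv_tmap_apply hF]

/-- The fiber component is linear in the fiber, so the error is a Lipschitz constant of the
derivative times a small fiber vector or a small base point; no second derivative is needed. It is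
applied to `tmap σ`, whose tangent map need not be `C¹` when `σ` is only `C²`. -/
theorem hasStrictFDerivAt_tmap {σ : E → G} (hσ : HasStrictFDerivAt σ (fderiv ℝ σ 0) 0) {K : ℝ≥0}
    {t : Set E} (ht : t ∈ 𝓝 0) (hK : LipschitzOnWith K (fderiv ℝ σ) t) :
    HasStrictFDerivAt (tmap σ) ((fderiv ℝ σ 0).prodMap (fderiv ℝ σ 0)) 0 := by
  have h1 : HasStrictFDerivAt (fun p : E × E => σ p.1) ((fderiv ℝ σ 0).comp (.fst ℝ E E)) 0 :=
    HasStrictFDerivAt.comp (0 : E × E) hσ hasStrictFDerivAt_fst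
  have h2 : HasStrictFDerivAt (fun p : E × E => fderiv ℝ σ p.1 p.2)
      ((fderiv ℝ σ 0).comp (.snd ℝ E E)) 0 := by
    refine .of_isLittleO ?_
    rw [Asymptotics.isLittleO_iff]
    intro c hc
    have hU : ∀ᶠ p in 𝓝 (0 : E × E), p.1 ∈ t ∧ ‖p‖ < c / (2 * (K + 1)) := by
      have hc' : 0 < c / (2 * ((K : ℝ) + 1)) := by positivity
      have := continuous_fst.tendsto (0 : E × E)
      exact (this.eventually ht).and (by
        filter_upwards [Metric.ball_mem_nhds (0 : E × E) hc'] with p hp; simpa using hp)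
    rw [show 𝓝 ((0, 0) : (E × E) × (E × E)) = 𝓝 0 ×ˢ 𝓝 0 from nhds_prod_eq]
    filter_upwards [hU.prod_mk hU] with ⟨p, q⟩ ⟨⟨p1, p2⟩, q1, q2⟩
    have e : fderiv ℝ σ p.1 p.2 - fderiv ℝ σ q.1 q.2
        - ((fderiv ℝ σ 0).comp (.snd ℝ E E)) (p - q)
        = (fderiv ℝ σ p.1 - fderiv ℝ σ q.1) p.2 + (fderiv ℝ σ q.1 - fderiv ℝ σ 0) (p.2 - q.2) := by
      simp; abel
    have l1 : ‖fderiv ℝ σ p.1 - fderiv ℝ σ q.1‖ ≤ K * ‖p - q‖ := by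
      refine (hK.norm_sub_le p1 q1).trans ?_
      gcongr; exact norm_fst_le (p - q)
    have l2 : ‖fderiv ℝ σ q.1 - fderiv ℝ σ 0‖ ≤ K * ‖q‖ := by
      refine (hK.norm_sub_le q1 (mem_of_mem_nhds ht)).trans ?_
      rw [sub_zero]; gcongr; exact norm_fst_le q
    change ‖fderiv ℝ σ p.1 p.2 - fderiv ℝ σ q.1 q.2
        - ((fderiv ℝ σ 0).comp (.snd ℝ E E)) (p - q)‖ ≤ c * ‖p - q‖
    rw [e]
    have hc2 : (K : ℝ) * (c / (2 * (K + 1))) ≤ c / 2 := by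
      rw [mul_div_assoc', div_le_div_iff₀ (by positivity) (by positivity)]
      nlinarith [K.coe_nonneg]
    calc _ ≤ ‖fderiv ℝ σ p.1 - fderiv ℝ σ q.1‖ * ‖p.2‖
          + ‖fderiv ℝ σ q.1 - fderiv ℝ σ 0‖ * ‖p.2 - q.2‖ :=
          (norm_add_le _ _).trans (add_le_add (ContinuousLinearMap.le_opNorm _ _)
            (ContinuousLinearMap.le_opNorm _ _))
      _ ≤ K * ‖p - q‖ * (c / (2 * (K + 1))) + K * (c / (2 * (K + 1))) * ‖p - q‖ := by
          gcongr
          · exact (norm_snd_le p).trans p2.le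
          · exact l2.trans (by gcongr)
          · exact norm_snd_le (p - q)
      _ = 2 * ((K : ℝ) * (c / (2 * (K + 1)))) * ‖p - q‖ := by ring
      _ ≤ c * ‖p - q‖ := by gcongr; linarith
  exact h1.prodMk h2

/-- The derivative of the tangent map contains the term `D²σ(x) · a`, a product of a Lipschitz
factor and the fiber vector. It is Lipschitz only where the fiber vector is bounded, hence the unit
ball. -/
theorem exists_lipschitzOnWith_fderiv_tmap {σ : E → G} (hσ : ContDiff ℝ 2 σ) {K : ℝ≥0}
    (hK : LipschitzWith K (fderiv ℝ (fderiv ℝ σ))) :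
    ∃ K' : ℝ≥0, ∃ t ∈ 𝓝 (0 : E × E), LipschitzOnWith K' (fderiv ℝ (tmap σ)) t := by
  have h1 : ContDiff ℝ 1 (fderiv ℝ σ) := hσ.fderiv_right (by norm_num)
  obtain ⟨K₁, t₁, ht₁, hL₁⟩ := h1.contDiffAt.exists_lipschitzOnWith (x := 0)
  let N : ℝ≥0 := ‖fderiv ℝ (fderiv ℝ σ) 0‖₊
  refine ⟨K₁ + (K + (N + K) + K₁), (Prod.fst ⁻¹' t₁) ∩ Metric.ball 0 1,
    inter_mem (continuous_fst.tendsto (0 : E × E) ht₁) (Metric.ball_mem_nhds _ one_pos), ?_⟩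
  refine LipschitzOnWith.of_dist_le_mul fun p hp q hq => ?_
  have hp1 : ‖p‖ ≤ 1 := by simpa using (Metric.mem_ball.1 hp.2).le
  have hq1 : ‖q‖ ≤ 1 := by simpa using (Metric.mem_ball.1 hq.2).le
  rw [dist_eq_norm, dist_eq_norm]
  refine ContinuousLinearMap.opNorm_le_bound _ (by positivity) fun z => ?_
  have a1 : ‖fderiv ℝ σ p.1 - fderiv ℝ σ q.1‖ ≤ K₁ * ‖p - q‖ := by
    refine (hL₁.norm_sub_le hp.1 hq.1).trans ?_
    gcongr; exact norm_fst_le (p - q)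
  have a2 : ‖fderiv ℝ (fderiv ℝ σ) p.1 - fderiv ℝ (fderiv ℝ σ) q.1‖ ≤ K * ‖p - q‖ := by
    refine (hK.norm_sub_le _ _).trans ?_
    gcongr; exact norm_fst_le (p - q)
  have a3 : ‖fderiv ℝ (fderiv ℝ σ) q.1‖ ≤ N + K := by
    have : ‖fderiv ℝ (fderiv ℝ σ) q.1 - fderiv ℝ (fderiv ℝ σ) 0‖ ≤ K * 1 := by
      refine (hK.norm_sub_le _ _).trans ?_
      gcongr; rw [sub_zero]; exact (norm_fst_le q).trans hq1
    calc _ = ‖fderiv ℝ (fderiv ℝ σ) 0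
          + (fderiv ℝ (fderiv ℝ σ) q.1 - fderiv ℝ (fderiv ℝ σ) 0)‖ := by rw [add_sub_cancel]
      _ ≤ ‖fderiv ℝ (fderiv ℝ σ) 0‖ + ‖fderiv ℝ (fderiv ℝ σ) q.1 - fderiv ℝ (fderiv ℝ σ) 0‖ :=
          ContinuousLinearMap.opNorm_add_le _ _
      _ ≤ N + K := add_le_add le_rfl (this.trans_eq (mul_one _))
  have z1 := norm_fst_le z
  have z2 := norm_snd_le z
  rw [sub_apply, fderiv_tmap_apply hσ, fderiv_tmap_apply hσ, Prod.mk_sub_mk,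
    Prod.norm_mk]
  have b1 : ∀ y : E, ‖y‖ ≤ ‖z‖ → ‖fderiv ℝ σ p.1 y - fderiv ℝ σ q.1 y‖ ≤ K₁ * ‖p - q‖ * ‖z‖ := by
    intro y hy
    rw [← sub_apply]
    refine (ContinuousLinearMap.le_opNorm _ _).trans ?_
    gcongr
  have b2 : ‖fderiv ℝ (fderiv ℝ σ) p.1 z.1 p.2 - fderiv ℝ (fderiv ℝ σ) q.1 z.1 q.2‖
      ≤ (K + (N + K)) * ‖p - q‖ * ‖z‖ := by
    have e : fderiv ℝ (fderiv ℝ σ) p.1 z.1 p.2 - fderiv ℝ (fderiv ℝ σ) q.1 z.1 q.2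
        = (fderiv ℝ (fderiv ℝ σ) p.1 - fderiv ℝ (fderiv ℝ σ) q.1) z.1 p.2
          + fderiv ℝ (fderiv ℝ σ) q.1 z.1 (p.2 - q.2) := by simp
    rw [e]
    calc _ ≤ ‖fderiv ℝ (fderiv ℝ σ) p.1 - fderiv ℝ (fderiv ℝ σ) q.1‖ * ‖z.1‖ * ‖p.2‖
          + ‖fderiv ℝ (fderiv ℝ σ) q.1‖ * ‖z.1‖ * ‖p.2 - q.2‖ :=
          (norm_add_le _ _).trans (add_le_add (ContinuousLinearMap.le_opNorm₂ _ _ _)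
            (ContinuousLinearMap.le_opNorm₂ _ _ _))
      _ ≤ K * ‖p - q‖ * ‖z‖ * 1 + (N + K) * ‖z‖ * ‖p - q‖ := by
          gcongr
          · exact (norm_snd_le p).trans hp1
          · exact norm_snd_le (p - q)
      _ = _ := by ring
  refine max_le ((b1 _ z1).trans ?_) ?_
  · push_cast
    have : 0 ≤ ((K : ℝ) + (N + K) + K₁) * ‖p - q‖ * ‖z‖ := by positivity
    nlinarith
  · rw [add_sub_add_comm]
    refine ((norm_add_le _ _).trans (add_le_add b2 (b1 _ z2))).trans ?_
    push_cast
    have : 0 ≤ (K₁ : ℝ) * ‖p - q‖ * ‖z‖ := by positivity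
    nlinarith

end Tangent

/-- Products carry the maximum norm, so the contraction constant `1/4` survives the passage to
tangent maps without loss. -/
theorem ContinuousLinearMap.norm_prodMap_le {E E' G G' : Type*} [NormedAddCommGroup E]
    [NormedSpace ℝ E] [NormedAddCommGroup E'] [NormedSpace ℝ E'] [NormedAddCommGroup G]
    [NormedSpace ℝ G] [NormedAddCommGroup G'] [NormedSpace ℝ G'] {A : E →L[ℝ] G} {B : E' →L[ℝ] G'}
    {c : ℝ} (hA : ‖A‖ ≤ c) (hB : ‖B‖ ≤ c) : ‖A.prodMap B‖ ≤ c := by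
  have hc : 0 ≤ c := (norm_nonneg A).trans hA
  refine ContinuousLinearMap.opNorm_le_bound _ hc fun z => max_le ?_ ?_
  · exact (A.le_opNorm z.1).trans (by gcongr; exact _root_.norm_fst_le z)
  · exact (B.le_opNorm z.2).trans (by gcongr; exact _root_.norm_snd_le z)

/-! ### The projection along stable fibers is twice differentiable -/

section Fibers
variable {E Y : Type*} [NormedAddCommGroup E] [NormedSpace ℝ E] [CompleteSpace E]
  [NormedAddCommGroup Y] [NormedSpace ℝ Y] [CompleteSpace Y]

/-- The map `l ∘ σ` has the identity as derivative at `0`; the inverse function theorem gives `k`,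
so that `k ∘ l` is a chart that recovers the parameter of a point of the manifold. -/
theorem exists_contDiffAt_leftInverse {σ : Y → E} {l : E →L[ℝ] Y} (hσ : ContDiff ℝ 2 σ)
    (hσ0 : σ 0 = 0) (hls : ∀ η, l (fderiv ℝ σ 0 η) = η) :
    ∃ k : Y → Y, ContDiffAt ℝ 2 k 0 ∧ ∀ᶠ η in 𝓝 0, k (l (σ η)) = η := by
  have hg : ContDiffAt ℝ 2 (fun η => l (σ η)) 0 := (l.contDiff.comp hσ).contDiffAt
  have hd : HasFDerivAt (fun η => l (σ η))
      ((ContinuousLinearEquiv.refl ℝ Y : Y ≃L[ℝ] Y) : Y →L[ℝ] Y) 0 := by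
    refine (l.hasFDerivAt.comp 0 (hσ.differentiable (by norm_num) 0).hasFDerivAt).congr_fderiv ?_
    ext η; simp [hls]
  refine ⟨hg.localInverse hd (by norm_num), ?_, ?_⟩
  · have := hg.to_localInverse hd (by norm_num)
    simp only [hσ0, map_zero] at this
    exact this
  · exact (hg.hasStrictFDerivAt' hd (by norm_num)).eventually_left_inverse

/-- The attraction estimate of `exists_geometric_attraction` for the second tangent map. -/
theorem exists_geometric_attraction_tmap {F : E → E} {σ : Y → E} {l : E →L[ℝ] Y} {K : ℝ≥0}
    (hF : ContDiff ℝ 3 F) (hσ : ContDiff ℝ 2 σ) (hK : LipschitzWith K (fderiv ℝ (fderiv ℝ σ)))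
    (hσ0 : σ 0 = 0) (hfix : ∀ η, F (σ η) = σ η) (hls : ∀ η, l (fderiv ℝ σ 0 η) = η)
    (hlQ : ∀ x, l (fderiv ℝ F 0 x) = l x)
    (hV : ‖fderiv ℝ F 0 - (fderiv ℝ σ 0).comp l‖ ≤ 1 / 4) :
    ∃ r > 0, ∃ C ≥ 0, ∀ z, ‖z‖ < r → ∃ p, ‖p‖ ≤ C * ‖z‖ ∧
      ∀ n, ‖tmap (tmap F^[n]) z - tmap (tmap σ) p‖ ≤ C * (1 / 2) ^ n * ‖z‖ := by
  have hF2 : ContDiff ℝ 2 F := hF.of_le (by norm_num)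
  have hF1 : Differentiable ℝ F := hF.differentiable (by norm_num)
  have hσ1 : Differentiable ℝ σ := hσ.differentiable (by norm_num)
  have ht : ContDiff ℝ 2 (tmap F) := contDiff_tmap (n := 2) (by norm_num; exact hF)
  have ht1 : Differentiable ℝ (tmap F) := ht.differentiable (by norm_num)
  have htt : ContDiff ℝ 1 (tmap (tmap F)) := contDiff_tmap (n := 1) (by norm_num; exact ht)
  have hs : ContDiff ℝ 1 (tmap σ) := contDiff_tmap (n := 1) (by norm_num; exact hσ)
  have hs1 : Differentiable ℝ (tmap σ) := hs.differentiable (by norm_num)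
  have dF : HasStrictFDerivAt (tmap (tmap F))
      (((fderiv ℝ F 0).prodMap (fderiv ℝ F 0)).prodMap
        ((fderiv ℝ F 0).prodMap (fderiv ℝ F 0))) 0 := by
    have := htt.contDiffAt.hasStrictFDerivAt (x := 0) (by norm_num)
    rwa [fderiv_tmap_zero ht, fderiv_tmap_zero hF2] at this
  have dσ : HasStrictFDerivAt (tmap (tmap σ))
      (((fderiv ℝ σ 0).prodMap (fderiv ℝ σ 0)).prodMap
        ((fderiv ℝ σ 0).prodMap (fderiv ℝ σ 0))) 0 := by
    obtain ⟨K', t, ht, hL⟩ := exists_lipschitzOnWith_fderiv_tmap hσ hK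
    have := hasStrictFDerivAt_tmap (hs.contDiffAt.hasStrictFDerivAt (x := 0) (by norm_num)) ht hL
    rwa [fderiv_tmap_zero hσ] at this
  -- Functoriality of `tmap` turns the identity `F ∘ σ = σ` into the statement that the second
  -- tangent map of `σ` parametrizes fixed points of the second tangent map of `F`.
  have hc : F ∘ σ = σ := funext hfix
  have hc1 : tmap F ∘ tmap σ = tmap σ := by rw [← tmap_comp hF1 hσ1, hc]
  have hc2 : tmap (tmap F) ∘ tmap (tmap σ) = tmap (tmap σ) := by rw [← tmap_comp ht1 hs1, hc1]
  have h0 : tmap (tmap σ) 0 = 0 := by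
    ext <;> simp [tmap, hσ0]
  have hfx : ∀ η, tmap (tmap F) (tmap (tmap σ) η) = tmap (tmap σ) η := by
    intro η
    have := congrFun hc2 η
    rwa [Function.comp_apply] at this
  let l₄ : (E × E) × (E × E) →L[ℝ] (Y × Y) × (Y × Y) := (l.prodMap l).prodMap (l.prodMap l)
  have hV₄ : ‖((fderiv ℝ F 0).prodMap (fderiv ℝ F 0)).prodMap
        ((fderiv ℝ F 0).prodMap (fderiv ℝ F 0)) - (((fderiv ℝ σ 0).prodMap (fderiv ℝ σ 0)).prodMap
        ((fderiv ℝ σ 0).prodMap (fderiv ℝ σ 0))).comp l₄‖ ≤ 1 / 4 := by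
    have e : ((fderiv ℝ F 0).prodMap (fderiv ℝ F 0)).prodMap
        ((fderiv ℝ F 0).prodMap (fderiv ℝ F 0)) - (((fderiv ℝ σ 0).prodMap (fderiv ℝ σ 0)).prodMap
        ((fderiv ℝ σ 0).prodMap (fderiv ℝ σ 0))).comp l₄ =
        (((fderiv ℝ F 0 - (fderiv ℝ σ 0).comp l).prodMap
          (fderiv ℝ F 0 - (fderiv ℝ σ 0).comp l)).prodMap
        ((fderiv ℝ F 0 - (fderiv ℝ σ 0).comp l).prodMap
          (fderiv ℝ F 0 - (fderiv ℝ σ 0).comp l))) := by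
      refine ContinuousLinearMap.ext ?_
      rintro ⟨⟨a, b⟩, c, d⟩
      rfl
    rw [e]
    exact ContinuousLinearMap.norm_prodMap_le (ContinuousLinearMap.norm_prodMap_le hV hV)
      (ContinuousLinearMap.norm_prodMap_le hV hV)
  obtain ⟨r, hr, C, hC, h⟩ := exists_geometric_attraction dF dσ h0 hfx
    (l := l₄) (by rintro ⟨⟨a, b⟩, c, d⟩; simp [l₄, hls])
    (by rintro ⟨⟨a, b⟩, c, d⟩; simp [l₄, hlQ]) hV₄
  refine ⟨r, hr, C, hC, fun z hz => ?_⟩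
  obtain ⟨p, hp, hn⟩ := h z hz
  refine ⟨p, hp, fun n => ?_⟩
  rw [tmap_iterate hF1, tmap_iterate ht1]
  exact hn n

/-- The projection along the stable fibers of a normally attracting manifold of fixed points is
twice continuously differentiable. -/
theorem exists_fiber_projection {F : E → E} {σ : Y → E} {l : E →L[ℝ] Y} {K : ℝ≥0}
    (hF : ContDiff ℝ 3 F) (hσ : ContDiff ℝ 2 σ) (hK : LipschitzWith K (fderiv ℝ (fderiv ℝ σ)))
    (hσ0 : σ 0 = 0) (hfix : ∀ η, F (σ η) = σ η) (hls : ∀ η, l (fderiv ℝ σ 0 η) = η)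
    (hlQ : ∀ x, l (fderiv ℝ F 0 x) = l x)
    (hV : ‖fderiv ℝ F 0 - (fderiv ℝ σ 0).comp l‖ ≤ 1 / 4) :
    ∃ r > 0, ∃ C ≥ 0, ∃ Θ : E → Y, ContDiffOn ℝ 2 Θ (Metric.ball 0 r) ∧
      ∀ x ∈ Metric.ball (0 : E) r, ‖Θ x‖ ≤ C * ‖x‖ ∧
        (∀ n, ‖F^[n] x - σ (Θ x)‖ ≤ C * (1 / 2) ^ n * ‖x‖) ∧
        ∀ n, ‖fderiv ℝ (F^[n]) x‖ ≤ C := by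
  have hF1 : Differentiable ℝ F := hF.differentiable (by norm_num)
  obtain ⟨r, hr, C, hC, h⟩ := exists_geometric_attraction_tmap hF hσ hK hσ0 hfix hls hlQ hV
  have hFn : ∀ n, ContDiff ℝ 2 (F^[n]) := by
    intro n
    induction n with
    | zero => exact contDiff_id
    | succ n ih =>
      rw [Function.iterate_succ']
      exact (hF.of_le (by norm_num)).comp ih
  -- At such points the four components of the second tangent map are the value, two first
  -- derivatives and, as the last slot is zero, the pure second derivative of the iterate.
  have hval : ∀ n x a b, tmap (tmap F^[n]) ((x, a), (b, 0)) =
      ((F^[n] x, fderiv ℝ (F^[n]) x a), (fderiv ℝ (F^[n]) x b,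
        fderiv ℝ (fderiv ℝ (F^[n])) x b a)) := by
    intro n x a b
    ext <;> simp [tmap, fderiv_tmap_apply (hFn n)]
  have hstep : ∀ z, ‖z‖ < r → ∀ n, ‖tmap (tmap F^[n]) z - tmap (tmap F^[n + 1]) z‖
      ≤ 2 * C * r * (1 / 2) ^ n := by
    intro z hz n
    obtain ⟨p, -, hp⟩ := h z hz
    have hle : (1 / 2 : ℝ) ^ (n + 1) ≤ (1 / 2) ^ n :=
      pow_le_pow_of_le_one (by norm_num) (by norm_num) (Nat.le_succ n)
    calc _ = ‖(tmap (tmap F^[n]) z - tmap (tmap σ) p)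
          - (tmap (tmap F^[n + 1]) z - tmap (tmap σ) p)‖ := by rw [sub_sub_sub_cancel_right]
      _ ≤ C * (1 / 2) ^ n * ‖z‖ + C * (1 / 2) ^ (n + 1) * ‖z‖ :=
          (norm_sub_le _ _).trans (add_le_add (hp n) (hp (n + 1)))
      _ ≤ C * (1 / 2) ^ n * r + C * (1 / 2) ^ n * r := by gcongr
      _ = _ := by ring
  have hbdd : ∀ z, ‖z‖ < r → ∀ n, ‖tmap (tmap F^[n]) z‖ ≤ (1 + 2 * C) * r := by
    intro z hz n
    obtain ⟨p, -, hp⟩ := h z hz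
    have hle : (1 / 2 : ℝ) ^ n ≤ 1 := pow_le_one₀ (by norm_num) (by norm_num)
    have h0 : ‖z - tmap (tmap σ) p‖ ≤ C * ‖z‖ := by
      have := hp 0
      have e : tmap (tmap (F^[0])) z = z := by
        rw [tmap_iterate hF1, Function.iterate_zero]
        ext <;> simp [tmap]
      rw [e] at this
      simpa using this
    calc _ = ‖(tmap (tmap F^[n]) z - tmap (tmap σ) p) - (z - tmap (tmap σ) p) + z‖ := by
            congr 1; abel
      _ ≤ C * (1 / 2) ^ n * ‖z‖ + C * ‖z‖ + ‖z‖ :=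
          (norm_add_le _ _).trans (add_le_add ((norm_sub_le _ _).trans (add_le_add (hp n) h0))
            le_rfl)
      _ ≤ C * 1 * r + C * r + r := by gcongr
      _ = _ := by ring
  -- Unit vectors are scaled by `r / 2` to bring the argument into the ball of radius `r`; the
  -- divisions by `r / 2` in the constants undo this scaling.
  have hz : ∀ x a b : E, ‖x‖ < r → ‖a‖ = 1 → ‖b‖ = 1 →
      ‖((x, (r / 2) • a), ((r / 2) • b, (0 : E)))‖ < r := by
    intro x a b hx ha hb
    have h2 : ‖(r / 2) • a‖ < r := by
      rw [norm_smul, ha, Real.norm_of_nonneg (by positivity)]; linarith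
    have h3 : ‖(r / 2) • b‖ < r := by
      rw [norm_smul, hb, Real.norm_of_nonneg (by positivity)]; linarith
    simp only [Prod.norm_mk, norm_zero]
    exact max_lt (max_lt hx h2) (max_lt h3 hr)
  have hz0 : ∀ x : E, ‖((x, (0 : E)), ((0 : E), (0 : E)))‖ = ‖x‖ := by
    intro x; simp [Prod.norm_mk]
  have hrn : ‖r / 2‖ = r / 2 := Real.norm_of_nonneg (by positivity)
  set K₀ : ℝ := 2 * C * r
  have hK₀ : 0 ≤ K₀ := by positivity
  set K₁ : ℝ := K₀ + K₀ / (r / 2) + K₀ / (r / 2) / (r / 2)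
  have k0 : K₀ ≤ K₁ := by
    have : 0 ≤ K₀ / (r / 2) + K₀ / (r / 2) / (r / 2) := by positivity
    simp only [K₁]; linarith
  have k1 : K₀ / (r / 2) ≤ K₁ := by
    have : 0 ≤ K₀ / (r / 2) / (r / 2) := by positivity
    simp only [K₁]; linarith
  have k2 : K₀ / (r / 2) / (r / 2) ≤ K₁ := by
    have : 0 ≤ K₀ / (r / 2) := by positivity
    simp only [K₁]; linarith
  have h0 : ∀ x ∈ Metric.ball (0 : E) r, ∀ n, ‖F^[n] x - F^[n + 1] x‖ ≤ K₁ * (1 / 2) ^ n := by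
    intro x hx n
    have := hstep ((x, 0), (0, 0)) (by rw [hz0]; simpa using hx) n
    rw [hval, hval] at this
    refine ((norm_fst_le _).trans ((norm_fst_le _).trans this)).trans ?_
    gcongr
  have h1 : ∀ x ∈ Metric.ball (0 : E) r, ∀ n,
      ‖fderiv ℝ (F^[n]) x - fderiv ℝ (F^[n + 1]) x‖ ≤ K₁ * (1 / 2) ^ n := by
    intro x hx n
    refine ContinuousLinearMap.opNorm_le_of_unit_norm (by positivity) fun a ha => ?_
    have := hstep _ (hz x a a (by simpa using hx) ha ha) n
    rw [hval, hval] at this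
    have := (norm_snd_le _).trans ((norm_fst_le _).trans this)
    simp only [Prod.fst_sub, Prod.snd_sub, map_smul, ← smul_sub, norm_smul, hrn] at this
    rw [← le_div_iff₀' (by positivity)] at this
    refine (this.trans_eq ?_).trans (mul_le_mul_of_nonneg_right k1 (by positivity))
    ring
  have h2 : ∀ x ∈ Metric.ball (0 : E) r, ∀ n,
      ‖fderiv ℝ (fderiv ℝ (F^[n])) x - fderiv ℝ (fderiv ℝ (F^[n + 1])) x‖ ≤ K₁ * (1 / 2) ^ n := by
    intro x hx n
    refine ContinuousLinearMap.opNorm_le_of_unit_norm (by positivity) fun b hb => ?_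
    refine ContinuousLinearMap.opNorm_le_of_unit_norm (by positivity) fun a ha => ?_
    have := hstep _ (hz x a b (by simpa using hx) ha hb) n
    rw [hval, hval] at this
    have := (norm_snd_le _).trans ((norm_snd_le _).trans this)
    simp only [Prod.snd_sub, map_smul, smul_apply, ← smul_sub, norm_smul,
      hrn] at this
    rw [← le_div_iff₀' (by positivity), ← le_div_iff₀' (by positivity)] at this
    refine (this.trans_eq ?_).trans (mul_le_mul_of_nonneg_right k2 (by positivity))
    ring
  obtain ⟨Φ, hΦ, hΦn⟩ := exists_contDiffOn_two_of_geometric Metric.isOpen_ball hFn h0 h1 h2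
  obtain ⟨k, hk, hkl⟩ := exists_contDiffAt_leftInverse (l := l) hσ hσ0 hls
  have hp : ∀ x ∈ Metric.ball (0 : E) r, ∃ η, ‖η‖ ≤ C * ‖x‖ ∧ Φ x = σ η ∧
      ∀ n, ‖F^[n] x - σ η‖ ≤ C * (1 / 2) ^ n * ‖x‖ := by
    intro x hx
    obtain ⟨p, hp, hn⟩ := h ((x, 0), (0, 0)) (by rw [hz0]; simpa using hx)
    rw [hz0] at hp hn
    have hn' : ∀ n, ‖F^[n] x - σ p.1.1‖ ≤ C * (1 / 2) ^ n * ‖x‖ := by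
      intro n
      have := hn n
      rw [hval] at this
      exact (norm_fst_le _).trans ((norm_fst_le _).trans this)
    refine ⟨p.1.1, (norm_fst_le _).trans ((norm_fst_le _).trans hp), ?_, hn'⟩
    have hg : Tendsto (fun n => (1 / 2 : ℝ) ^ n) atTop (𝓝 0) :=
      tendsto_pow_atTop_nhds_zero_of_lt_one (by norm_num) (by norm_num)
    have l1 : Tendsto (fun n => F^[n] x) atTop (𝓝 (Φ x)) := by
      rw [tendsto_iff_norm_sub_tendsto_zero]
      exact squeeze_zero (fun _ => norm_nonneg _) (fun n => (hΦn x hx n).1)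
        (by simpa using hg.const_mul (2 * K₁))
    have l2 : Tendsto (fun n => F^[n] x) atTop (𝓝 (σ p.1.1)) := by
      rw [tendsto_iff_norm_sub_tendsto_zero]
      exact squeeze_zero (fun _ => norm_nonneg _) hn'
        (by simpa using (hg.const_mul C).mul_const ‖x‖)
    exact tendsto_nhds_unique l1 l2
  choose! P hP using hp
  have hPc : Tendsto P (𝓝 0) (𝓝 0) := by
    rw [tendsto_zero_iff_norm_tendsto_zero]
    refine squeeze_zero' (.of_forall fun _ => norm_nonneg _) ?_
      (by simpa using (continuous_norm.tendsto (0 : E)).const_mul C)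
    filter_upwards [Metric.ball_mem_nhds (0 : E) hr] with x hx using (hP x hx).1
  have hΦ0 : Φ 0 = 0 := by
    have h0 : (0 : E) ∈ Metric.ball (0 : E) r := Metric.mem_ball_self hr
    have : P 0 = 0 := by simpa using (hP 0 h0).1
    rw [(hP 0 h0).2.1, this, hσ0]
  have hΦc : Tendsto (fun x => l (Φ x)) (𝓝 0) (𝓝 0) := by
    have := (l.continuous.continuousAt.comp (hΦ.continuousOn.continuousAt
      (Metric.ball_mem_nhds (0 : E) hr))).tendsto
    simpa [hΦ0, Function.comp_def] using this
  have hev : ∀ᶠ x in 𝓝 (0 : E), x ∈ Metric.ball (0 : E) r ∧ k (l (σ (P x))) = P x ∧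
      ContDiffAt ℝ 2 k (l (Φ x)) :=
    Filter.Eventually.and (Metric.ball_mem_nhds (0 : E) hr) (.and (hPc.eventually hkl)
      (hΦc.eventually (hk.eventually (by norm_num))))
  obtain ⟨r', hr', hball⟩ := Metric.eventually_nhds_iff_ball.1 hev
  -- The phase is the limit `Φ` of the iterates read in the chart `k ∘ l`. The constant is the bound
  -- `(1 + 2 * C) * r` of the second tangent iterates divided by `r / 2`.
  refine ⟨r', hr', 2 * (1 + 2 * C), by positivity, fun x => k (l (Φ x)), fun x hx => ?_,
    fun x hx => ?_⟩
  · obtain ⟨e1, -, e3⟩ := hball x hx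
    have : ContDiffAt ℝ 2 Φ x := hΦ.contDiffAt (Metric.isOpen_ball.mem_nhds e1)
    exact (e3.comp x (l.contDiff.contDiffAt.comp x this)).contDiffWithinAt
  · obtain ⟨e1, e2, -⟩ := hball x hx
    obtain ⟨p1, p2, p3⟩ := hP x e1
    have e : k (l (Φ x)) = P x := by rw [p2, e2]
    have hC' : C ≤ 2 * (1 + 2 * C) := by linarith
    refine ⟨?_, fun n => ?_, fun n => ?_⟩
    · simp only [e]; exact p1.trans (by gcongr)
    · simp only [e]; exact (p3 n).trans (by gcongr)
    · refine ContinuousLinearMap.opNorm_le_of_unit_norm (by positivity) fun a ha => ?_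
      have := hbdd _ (hz x a a (by simpa using e1) ha ha) n
      rw [hval] at this
      have := (norm_snd_le _).trans ((norm_fst_le _).trans this)
      simp only [map_smul, norm_smul, hrn] at this
      rw [← le_div_iff₀' (by positivity)] at this
      refine this.trans_eq ?_
      field_simp

end Fibers

/-! ### Lipschitz dependence of the derivatives along a stable leaf -/

section Leaf
variable {E Y : Type*} [NormedAddCommGroup E] [NormedSpace ℝ E]
  [NormedAddCommGroup Y] [NormedSpace ℝ Y]

/-- Perturbations `T n` of `Q` that decay geometrically have, up to the size of the perturbation,
the same iterates as `Q`. -/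
theorem exists_cocycle_bounds {Q : E →L[ℝ] E} {s : Y →L[ℝ] E} {l : E →L[ℝ] Y}
    (hls : ∀ η, l (s η) = η) (hlQ : ∀ x, l (Q x) = l x) (hQs : ∀ η, Q (s η) = s η)
    (hV : ‖Q - s.comp l‖ ≤ 1 / 4) {κ C : ℝ} (hκ : 0 ≤ κ) (hC : 0 ≤ C) :
    ∃ A ≥ 0, ∀ (ε ω : ℝ) (T : ℕ → E →L[ℝ] E) (a : ℕ → E), 0 ≤ ε → ε ≤ 1 → 0 ≤ ω →
      (∀ n, a (n + 1) = T n (a n)) → (∀ n, ‖T n - Q‖ ≤ κ * ε * (1 / 2) ^ n) →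
      (∀ n, ‖a n‖ ≤ C * ω) → ∀ n, ‖a n - s (l (a n))‖ ≤ A * ω * (1 / 2) ^ n ∧
        ‖a n - Q^[n] (a 0)‖ ≤ A * ε * ω ∧
        ‖(a n - Q^[n] (a 0)) - s (l (a n - Q^[n] (a 0)))‖ ≤ A * ε * ω * (1 / 2) ^ n := by
  -- `R` projects onto the stable directions, the kernel of `l`, along the range of `s`.
  let R : E →L[ℝ] E := ContinuousLinearMap.id ℝ E - s.comp l
  have hR : ∀ x, R x = x - s (l x) := fun x => by simp [R]
  have hRQ : ∀ x, ‖R (Q x)‖ ≤ 1 / 4 * ‖R x‖ := by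
    intro x
    have : R (Q x) = (Q - s.comp l) (R x) := by simp [hR, hlQ, hls, hQs]
    rw [this]
    exact (ContinuousLinearMap.le_opNorm _ _).trans (by gcongr)
  set p : ℝ := ‖R‖
  have hp : 0 ≤ p := norm_nonneg _
  -- Chosen to close the induction: `p * κ * C + A₀ / 4 ≤ A₀ / 2`, with `p * C` covering the start.
  set A₀ : ℝ := p * C + 4 * (p * κ * C) with hA₀
  set A₁ : ℝ := 2 * (‖l‖ * κ * C) with hA₁
  have hA₀' : 0 ≤ A₀ := by positivity
  have hA₁' : 0 ≤ A₁ := by positivity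
  refine ⟨A₀ + ‖s‖ * A₁, by positivity, fun ε ω T a hε hε1 hω ha hT haC => ?_⟩
  have hTa : ∀ n, ‖(T n - Q) (a n)‖ ≤ κ * C * ε * ω * (1 / 2) ^ n := by
    intro n
    calc _ ≤ κ * ε * (1 / 2) ^ n * (C * ω) :=
          ((T n - Q).le_opNorm _).trans (mul_le_mul (hT n) (haC n) (norm_nonneg _) (by positivity))
      _ = _ := by ring
  have e : ∀ n, a (n + 1) = (T n - Q) (a n) + Q (a n) := fun n => by simp [ha]
  have b1 : ∀ n, ‖R (a n)‖ ≤ A₀ * ω * (1 / 2) ^ n := by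
    intro n
    induction n with
    | zero =>
      calc _ ≤ p * (C * ω) := (R.le_opNorm _).trans (by gcongr; exact haC 0)
        _ ≤ A₀ * ω * (1 / 2) ^ 0 := by
          have : 0 ≤ 4 * (p * κ * C) * ω := by positivity
          rw [hA₀]; linarith
    | succ n ih =>
      rw [e n, map_add]
      calc _ ≤ p * (κ * C * ε * ω * (1 / 2) ^ n) + 1 / 4 * (A₀ * ω * (1 / 2) ^ n) :=
            (norm_add_le _ _).trans (add_le_add ((R.le_opNorm _).trans (by gcongr; exact hTa n))
              ((hRQ _).trans (by gcongr)))
        _ ≤ p * (κ * C * 1 * ω * (1 / 2) ^ n) + 1 / 4 * (A₀ * ω * (1 / 2) ^ n) := by gcongr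
        _ ≤ A₀ * ω * (1 / 2) ^ (n + 1) := by
          have : 0 ≤ p * C * ω * (1 / 2) ^ n := by positivity
          rw [hA₀, pow_succ]; nlinarith
  let q : ℕ → E := fun n => Q^[n] (a 0)
  have hq : ∀ n, q (n + 1) = Q (q n) := fun n => Function.iterate_succ_apply' _ _ _
  have e' : ∀ n, a (n + 1) - q (n + 1) = (T n - Q) (a n) + Q (a n - q n) := fun n => by
    simp [ha, hq]
  have q0 : q 0 = a 0 := rfl
  have b2 : ∀ n, ‖R (a n - q n)‖ ≤ A₀ * ε * ω * (1 / 2) ^ n := by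
    intro n
    induction n with
    | zero => rw [q0]; simp; positivity
    | succ n ih =>
      rw [e' n, map_add]
      calc _ ≤ p * (κ * C * ε * ω * (1 / 2) ^ n) + 1 / 4 * (A₀ * ε * ω * (1 / 2) ^ n) :=
            (norm_add_le _ _).trans (add_le_add ((R.le_opNorm _).trans (by gcongr; exact hTa n))
              ((hRQ _).trans (by gcongr)))
        _ ≤ A₀ * ε * ω * (1 / 2) ^ (n + 1) := by
          have : 0 ≤ p * C * ε * ω * (1 / 2) ^ n := by positivity
          rw [hA₀, pow_succ]; nlinarith
  -- The neutral component is not contracted, but `l ∘ Q = l`, so it changes only by the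
  -- perturbation, whose contributions are summable.
  have b3 : ∀ n, ‖l (a n - q n)‖ ≤ A₁ * ε * ω * (1 - (1 / 2) ^ n) := by
    intro n
    induction n with
    | zero => rw [q0]; simp
    | succ n ih =>
      rw [e' n, map_add, hlQ]
      calc _ ≤ ‖l‖ * (κ * C * ε * ω * (1 / 2) ^ n) + A₁ * ε * ω * (1 - (1 / 2) ^ n) :=
            (norm_add_le _ _).trans (add_le_add ((l.le_opNorm _).trans (by gcongr; exact hTa n)) ih)
        _ = _ := by rw [hA₁, pow_succ]; ring
  intro n
  have hpow : (0 : ℝ) ≤ (1 / 2) ^ n := by positivity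
  have hpow1 : (1 / 2 : ℝ) ^ n ≤ 1 := pow_le_one₀ (by norm_num) (by norm_num)
  have hsA : 0 ≤ ‖s‖ * A₁ := by positivity
  refine ⟨?_, ?_, ?_⟩
  · rw [← hR]; refine (b1 n).trans ?_
    gcongr; linarith
  · have : a n - q n = R (a n - q n) + s (l (a n - q n)) := by simp [hR]
    change ‖a n - q n‖ ≤ _
    rw [this]
    calc _ ≤ A₀ * ε * ω * (1 / 2) ^ n + ‖s‖ * (A₁ * ε * ω * (1 - (1 / 2) ^ n)) :=
          (norm_add_le _ _).trans (add_le_add (b2 n) ((s.le_opNorm _).trans (by gcongr; exact b3 n)))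
      _ ≤ A₀ * ε * ω * 1 + ‖s‖ * (A₁ * ε * ω * 1) := by gcongr; linarith
      _ = _ := by ring
  · rw [← hR]; refine (b2 n).trans ?_
    gcongr; linarith

theorem fderiv_fderiv_comp {G : Type*} [NormedAddCommGroup G] [NormedSpace ℝ G] {f : E → G}
    {F : Y → E} {x : Y} (hf : ContDiffAt ℝ 2 f (F x)) (hF : ContDiffAt ℝ 2 F x) (a b : Y) :
    fderiv ℝ (fderiv ℝ fun y => f (F y)) x a b =
      fderiv ℝ (fderiv ℝ f) (F x) (fderiv ℝ F x a) (fderiv ℝ F x b)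
        + fderiv ℝ f (F x) (fderiv ℝ (fderiv ℝ F) x a b) := by
  have hF1 : HasFDerivAt F (fderiv ℝ F x) x := (hF.differentiableAt (by norm_num)).hasFDerivAt
  have hF2 : HasFDerivAt (fderiv ℝ F) (fderiv ℝ (fderiv ℝ F) x) x :=
    ((hF.fderiv_right (m := 1) (by norm_num)).differentiableAt (by norm_num)).hasFDerivAt
  have hf2 : HasFDerivAt (fderiv ℝ f) (fderiv ℝ (fderiv ℝ f) (F x)) (F x) :=
    ((hf.fderiv_right (m := 1) (by norm_num)).differentiableAt (by norm_num)).hasFDerivAt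
  have hev : (fderiv ℝ fun y => f (F y)) =ᶠ[𝓝 x] fun y => (fderiv ℝ f (F y)).comp (fderiv ℝ F y) := by
    have h1 := hF.continuousAt.eventually (hf.eventually (by norm_num))
    have h2 := hF.eventually (by norm_num)
    filter_upwards [h1, h2] with y hy1 hy2
    exact fderiv_comp y (hy1.differentiableAt (by norm_num)) (hy2.differentiableAt (by norm_num))
  have h3 : HasFDerivAt (fun y => fderiv ℝ f (F y))
      ((fderiv ℝ (fderiv ℝ f) (F x)).comp (fderiv ℝ F x)) x := hf2.comp x hF1
  rw [hev.fderiv_eq, (h3.clm_comp hF2).fderiv]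
  simp [add_comm]

theorem dist_bilinear_le {G : Type*} [NormedAddCommGroup G] [NormedSpace ℝ G]
    (B : E →L[ℝ] E →L[ℝ] G) (a q : E) :
    B a a - B q q = B (a - q) a + B q (a - q) := by simp

/-- Splitting `x` and then `y` into neutral and stable parts leaves only terms with at least one
stable argument. Along orbits this stable argument decays geometrically, even though the other does
not. -/
theorem norm_bilinear_le_of_center {G : Type*} [NormedAddCommGroup G] [NormedSpace ℝ G]
    {β : E →L[ℝ] E →L[ℝ] G} {s : Y →L[ℝ] E} {l : E →L[ℝ] Y}
    (hβ : ∀ η η', β (s η) (s η') = 0) (x y : E) :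
    ‖β x y‖ ≤ ‖β‖ * ‖s‖ * ‖l‖ * ‖x‖ * ‖y - s (l y)‖ + ‖β‖ * ‖x - s (l x)‖ * ‖y‖ := by
  have e : β x y = β (s (l x)) (y - s (l y)) + β (x - s (l x)) y := by simp [hβ]
  rw [e]
  refine (norm_add_le _ _).trans (add_le_add ((β.le_opNorm₂ _ _).trans ?_) (β.le_opNorm₂ _ _))
  have : ‖s (l x)‖ ≤ ‖s‖ * (‖l‖ * ‖x‖) :=
    (s.le_opNorm _).trans (by gcongr; exact l.le_opNorm x)
  calc _ ≤ ‖β‖ * (‖s‖ * (‖l‖ * ‖x‖)) * ‖y - s (l y)‖ := by gcongr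
    _ = _ := by ring

theorem exists_ball_lipschitzOnWith {G : Type*} [NormedAddCommGroup G] [NormedSpace ℝ G]
    {f : E → G} (hf : ContDiffAt ℝ 1 f 0) :
    ∃ K : ℝ, 0 ≤ K ∧ ∃ r > 0, ∀ x ∈ Metric.ball (0 : E) r, ‖f x - f 0‖ ≤ K * ‖x‖ := by
  obtain ⟨K, t, ht, hL⟩ := hf.exists_lipschitzOnWith
  obtain ⟨r, hr, hb⟩ := Metric.mem_nhds_iff.1 ht
  refine ⟨K, K.2, r, hr, fun x hx => ?_⟩
  simpa using hL.norm_sub_le (hb hx) (mem_of_mem_nhds ht)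

set_option maxHeartbeats 1000000 in
/-- Derivatives of an invariant map are Lipschitz along the stable fiber of the fixed point. -/
theorem exists_leaf_lipschitz {F : E → E} {Θ : E → Y} {s : Y →L[ℝ] E} {l : E →L[ℝ] Y} {r C : ℝ}
    (hF : ContDiff ℝ 3 F) (hF0 : F 0 = 0) (hls : ∀ η, l (s η) = η)
    (hlQ : ∀ x, l (fderiv ℝ F 0 x) = l x) (hQs : ∀ η, fderiv ℝ F 0 (s η) = s η)
    (hV : ‖fderiv ℝ F 0 - s.comp l‖ ≤ 1 / 4) (hr : 0 < r) (hC : 0 ≤ C)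
    (hΘ : ContDiffOn ℝ 2 Θ (Metric.ball 0 r))
    (hΘF : ∀ x ∈ Metric.ball (0 : E) r, F x ∈ Metric.ball (0 : E) r → Θ (F x) = Θ x)
    (hl : fderiv ℝ Θ 0 = l)
    (hx : ∀ x ∈ Metric.ball (0 : E) r, Θ x = 0 → ∀ n, ‖F^[n] x‖ ≤ C * (1 / 2) ^ n * ‖x‖)
    (hW : ∀ x ∈ Metric.ball (0 : E) r, ∀ n, ‖fderiv ℝ (F^[n]) x‖ ≤ C) :
    ∃ r' > 0, ∃ C' ≥ 0, ∀ x ∈ Metric.ball (0 : E) r', Θ x = 0 →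
      ‖fderiv ℝ Θ x - l‖ ≤ C' * ‖x‖ ∧
      ∀ w, ‖fderiv ℝ (fderiv ℝ Θ) x w w - fderiv ℝ (fderiv ℝ Θ) 0 w w‖ ≤ C' * ‖x‖ * ‖w‖ ^ 2 := by
  have hF1 : ContDiff ℝ 2 (fderiv ℝ F) := hF.fderiv_right (by norm_num)
  have hF2 : ContDiff ℝ 1 (fderiv ℝ (fderiv ℝ F)) := hF1.fderiv_right (by norm_num)
  have hFd : Differentiable ℝ F := hF.differentiable (by norm_num)
  have hΘat : ∀ x ∈ Metric.ball (0 : E) r, ContDiffAt ℝ 2 Θ x := fun x hx =>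
    hΘ.contDiffAt (Metric.isOpen_ball.mem_nhds hx)
  have h0r : (0 : E) ∈ Metric.ball (0 : E) r := Metric.mem_ball_self hr
  have hΘ1 : ContDiffAt ℝ 1 (fderiv ℝ Θ) 0 := (hΘat 0 h0r).fderiv_right (by norm_num)
  have hΘ2 : ContinuousAt (fderiv ℝ (fderiv ℝ Θ)) 0 :=
    (hΘ1.fderiv_right (m := 0) (by norm_num)).continuousAt
  have hinv : ∀ x ∈ Metric.ball (0 : E) r, F x ∈ Metric.ball (0 : E) r → ∀ a b,
      fderiv ℝ (fderiv ℝ Θ) x a b =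
        fderiv ℝ (fderiv ℝ Θ) (F x) (fderiv ℝ F x a) (fderiv ℝ F x b)
          + fderiv ℝ Θ (F x) (fderiv ℝ (fderiv ℝ F) x a b) := by
    intro x h1 h2 a b
    have hev : (fun y => Θ (F y)) =ᶠ[𝓝 x] Θ := by
      filter_upwards [Metric.isOpen_ball.mem_nhds h1,
        hFd.continuous.continuousAt (Metric.isOpen_ball.mem_nhds h2)] with y hy1 hy2
      exact hΘF y hy1 hy2
    rw [← fderiv_fderiv_comp (hΘat _ h2) (hF.of_le (by norm_num)).contDiffAt, hev.fderiv.fderiv_eq]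
  obtain ⟨K₁, hK₁, r₁, hr₁, hL₁⟩ := exists_ball_lipschitzOnWith (hF1.of_le (by norm_num)).contDiffAt
  obtain ⟨K₂, hK₂, r₂, hr₂, hL₂⟩ := exists_ball_lipschitzOnWith hF2.contDiffAt
  obtain ⟨K₃, hK₃, r₃, hr₃, hL₃⟩ := exists_ball_lipschitzOnWith hΘ1
  set Q := fderiv ℝ F 0
  set F₂ := fderiv ℝ (fderiv ℝ F) 0
  set B := fderiv ℝ (fderiv ℝ Θ) 0
  let β : E →L[ℝ] E →L[ℝ] Y := (ContinuousLinearMap.compL ℝ E E Y l).comp F₂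
  have hβv : ∀ a b, β a b = l (F₂ a b) := fun a b => rfl
  -- At the fixed point the invariance of `Θ` reads `B a b = B (Q a) (Q b) + β a b`, and `Q` is the
  -- identity on neutral vectors.
  have hβ : ∀ η η', β (s η) (s η') = 0 := by
    intro η η'
    have := hinv 0 h0r (by rw [hF0]; exact h0r) (s η) (s η')
    rw [hF0, hl] at this
    change B _ _ = B (Q _) (Q _) + _ at this
    rw [hQs, hQs] at this
    rw [hβv]
    simpa using this
  obtain ⟨A, hA, hcoc⟩ := exists_cocycle_bounds hls hlQ hQs hV (κ := K₁ * C) (C := C)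
    (by positivity) hC
  obtain ⟨ρ, hρ, hρr, hρ1, hρ2, hρ3⟩ : ∃ ρ > 0, ρ ≤ r ∧ ρ ≤ r₁ ∧ ρ ≤ r₂ ∧ ρ ≤ r₃ :=
    ⟨min (min r r₁) (min r₂ r₃), by positivity, by simp, by simp, by simp, by simp⟩
  set M : ℝ := ‖F₂‖ + K₂ * ρ
  have hM : 0 ≤ M := by positivity
  set J : ℝ := K₃ * C * M * C ^ 2 + ‖l‖ * K₂ * C * C ^ 2
    + ((‖β‖ * ‖s‖ * ‖l‖ * A * A + ‖β‖ * A * C)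
      + (‖β‖ * ‖s‖ * ‖l‖ * (C + A) * A + ‖β‖ * (2 * A) * A)) with hJ
  have hJ0 : 0 ≤ J := by positivity
  set J' : ℝ := ‖B‖ * A * C + ‖B‖ * (C + A) * A with hJ'
  have hJ'0 : 0 ≤ J' := by positivity
  refine ⟨min (min ρ 1) (ρ / (C + 1)), by positivity, K₃ + (2 * J + J'), by positivity,
    fun x hxb hΘx => ?_⟩
  have hxn : ‖x‖ < min (min ρ 1) (ρ / (C + 1)) := by simpa using hxb
  have hxρ : ‖x‖ < ρ := hxn.trans_le ((min_le_left _ _).trans (min_le_left _ _))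
  have hx1 : ‖x‖ ≤ 1 := (hxn.trans_le ((min_le_left _ _).trans (min_le_right _ _))).le
  have hxC : (C + 1) * ‖x‖ < ρ := by
    have := hxn.trans_le (min_le_right _ _)
    rwa [lt_div_iff₀' (by positivity)] at this
  have hxr : x ∈ Metric.ball (0 : E) r := by simpa using hxρ.trans_le hρr
  set d := ‖x‖ with hd
  have hd0 : 0 ≤ d := norm_nonneg x
  have hxN := hx x hxr hΘx
  have hWN := hW x hxr
  have hpw : ∀ n : ℕ, (0 : ℝ) ≤ (1 / 2) ^ n := fun n => by positivity
  have hpw1 : ∀ n : ℕ, (1 / 2 : ℝ) ^ n ≤ 1 := fun n => pow_le_one₀ (by norm_num) (by norm_num)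
  have hxNρ : ∀ n, ‖F^[n] x‖ < ρ := by
    intro n
    calc _ ≤ C * (1 / 2) ^ n * d := hxN n
      _ ≤ C * 1 * d := by gcongr; exact hpw1 n
      _ ≤ (C + 1) * d := by linarith
      _ < ρ := hxC
  have hin : ∀ {r'}, ρ ≤ r' → ∀ n, F^[n] x ∈ Metric.ball (0 : E) r' := fun h n => by
    simpa using (hxNρ n).trans_le h
  constructor
  · have := hL₃ x (by simpa using hxρ.trans_le hρ3)
    rw [hl] at this
    refine this.trans ?_
    gcongr
    linarith [mul_nonneg zero_le_two hJ0]
  intro w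
  set ω := ‖w‖
  have hω : 0 ≤ ω := norm_nonneg w
  let a : ℕ → E := fun n => fderiv ℝ (F^[n]) x w
  have ha0 : a 0 = w := by simp [a]
  have ha : ∀ n, a (n + 1) = fderiv ℝ F (F^[n] x) (a n) := by
    intro n
    simp only [a]
    rw [Function.iterate_succ', fderiv_comp x (hFd _) (hFd.iterate n _)]
    rfl
  have haC : ∀ n, ‖a n‖ ≤ C * ω := fun n =>
    (ContinuousLinearMap.le_opNorm _ _).trans (by gcongr; exact hWN n)
  have hcoc' := hcoc d ω (fun n => fderiv ℝ F (F^[n] x)) a hd0 hx1 hω ha (fun n => by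
    refine (hL₁ _ (hin hρ1 n)).trans ?_
    calc _ ≤ K₁ * (C * (1 / 2) ^ n * d) := by gcongr; exact hxN n
      _ = _ := by ring) haC
  rw [ha0] at hcoc'
  let q : ℕ → E := fun n => Q^[n] w
  have hq : ∀ n, q (n + 1) = Q (q n) := fun n => Function.iterate_succ_apply' _ _ _
  have c1 : ∀ n, ‖a n - s (l (a n))‖ ≤ A * ω * (1 / 2) ^ n := fun n => (hcoc' n).1
  have c2 : ∀ n, ‖a n - q n‖ ≤ A * d * ω := fun n => (hcoc' n).2.1
  have c3 : ∀ n, ‖(a n - q n) - s (l (a n - q n))‖ ≤ A * d * ω * (1 / 2) ^ n :=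
    fun n => (hcoc' n).2.2
  have c4 : ∀ n, ‖q n‖ ≤ (C + A) * ω := by
    intro n
    calc _ = ‖a n - (a n - q n)‖ := by rw [sub_sub_cancel]
      _ ≤ C * ω + A * d * ω := (norm_sub_le _ _).trans (add_le_add (haC n) (c2 n))
      _ ≤ C * ω + A * 1 * ω := by gcongr
      _ = _ := by ring
  have c5 : ∀ n, ‖q n - s (l (q n))‖ ≤ 2 * A * ω * (1 / 2) ^ n := by
    intro n
    have : q n - s (l (q n)) = (a n - s (l (a n))) - ((a n - q n) - s (l (a n - q n))) := by
      simp only [map_sub]; abel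
    rw [this]
    calc _ ≤ A * ω * (1 / 2) ^ n + A * d * ω * (1 / 2) ^ n :=
          (norm_sub_le _ _).trans (add_le_add (c1 n) (c3 n))
      _ ≤ A * ω * (1 / 2) ^ n + A * 1 * ω * (1 / 2) ^ n := by gcongr
      _ = _ := by ring
  -- The discrepancy to be estimated is `e 0`. Invariance of `Θ` relates `e n` to `e (n + 1)`
  -- through terms of size `2⁻ⁿ ‖x‖ ‖w‖²`: the orbit `F^[n] x` tends to `0` geometrically, and the
  -- part of `β` that survives involves a decaying stable component.
  let e : ℕ → Y := fun n => fderiv ℝ (fderiv ℝ Θ) (F^[n] x) (a n) (a n) - B (q n) (q n)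
  have hstep : ∀ n, ‖e n - e (n + 1)‖ ≤ J * d * ω ^ 2 * (1 / 2) ^ n := by
    intro n
    have hnext : F (F^[n] x) = F^[n + 1] x := (Function.iterate_succ_apply' _ _ _).symm
    have i1 := hinv (F^[n] x) (hin hρr n) (by rw [hnext]; exact hin hρr (n + 1)) (a n) (a n)
    have i2 := hinv 0 h0r (by rw [hF0]; exact h0r) (q n) (q n)
    rw [← ha, hnext] at i1
    rw [hF0, hl] at i2
    change B _ _ = B (Q _) (Q _) + l (F₂ _ _) at i2
    rw [← hq] at i2
    have i3 : e n - e (n + 1) = (fderiv ℝ Θ (F^[n + 1] x) - l)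
          (fderiv ℝ (fderiv ℝ F) (F^[n] x) (a n) (a n))
        + l ((fderiv ℝ (fderiv ℝ F) (F^[n] x) - F₂) (a n) (a n))
        + (β (a n - q n) (a n) + β (q n) (a n - q n)) := by
      rw [← dist_bilinear_le, hβv, hβv]
      simp only [e]
      rw [i1, i2]
      simp only [sub_apply, map_sub]
      abel
    rw [i3]
    have j1 : ‖fderiv ℝ Θ (F^[n + 1] x) - l‖ ≤ K₃ * (C * (1 / 2) ^ n * d) := by
      have := hL₃ _ (hin hρ3 (n + 1))
      rw [hl] at this
      refine this.trans ?_
      gcongr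
      refine (hxN (n + 1)).trans ?_
      gcongr ?_ * ?_ * ?_
      exact pow_le_pow_of_le_one (by norm_num) (by norm_num) (Nat.le_succ n)
    have j2 : ‖fderiv ℝ (fderiv ℝ F) (F^[n] x) - F₂‖ ≤ K₂ * (C * (1 / 2) ^ n * d) :=
      (hL₂ _ (hin hρ2 n)).trans (by gcongr; exact hxN n)
    have j3 : ‖fderiv ℝ (fderiv ℝ F) (F^[n] x)‖ ≤ M := by
      have j4 : ‖fderiv ℝ (fderiv ℝ F) (F^[n] x) - F₂‖ ≤ K₂ * ρ :=
        (hL₂ _ (hin hρ2 n)).trans (by gcongr; exact (hxNρ n).le)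
      calc _ = ‖F₂ + (fderiv ℝ (fderiv ℝ F) (F^[n] x) - F₂)‖ := by rw [add_sub_cancel]
        _ ≤ ‖F₂‖ + ‖fderiv ℝ (fderiv ℝ F) (F^[n] x) - F₂‖ :=
          ContinuousLinearMap.opNorm_add_le _ _
        _ ≤ M := add_le_add le_rfl j4
    have t1 : ‖(fderiv ℝ Θ (F^[n + 1] x) - l) (fderiv ℝ (fderiv ℝ F) (F^[n] x) (a n) (a n))‖
        ≤ K₃ * (C * (1 / 2) ^ n * d) * (M * (C * ω) * (C * ω)) := by
      refine (ContinuousLinearMap.le_opNorm _ _).trans ?_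
      gcongr
      refine (ContinuousLinearMap.le_opNorm₂ _ _ _).trans ?_
      gcongr
      · exact haC n
      · exact haC n
    have t2 : ‖l ((fderiv ℝ (fderiv ℝ F) (F^[n] x) - F₂) (a n) (a n))‖
        ≤ ‖l‖ * (K₂ * (C * (1 / 2) ^ n * d) * (C * ω) * (C * ω)) := by
      refine (ContinuousLinearMap.le_opNorm _ _).trans ?_
      gcongr
      refine (ContinuousLinearMap.le_opNorm₂ _ _ _).trans ?_
      gcongr
      · exact haC n
      · exact haC n
    have t3 : ‖β (a n - q n) (a n)‖ ≤ ‖β‖ * ‖s‖ * ‖l‖ * (A * d * ω) * (A * ω * (1 / 2) ^ n)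
        + ‖β‖ * (A * d * ω * (1 / 2) ^ n) * (C * ω) := by
      refine (norm_bilinear_le_of_center (l := l) hβ _ _).trans ?_
      gcongr
      · exact c2 n
      · exact c1 n
      · exact c3 n
      · exact haC n
    have t4 : ‖β (q n) (a n - q n)‖ ≤ ‖β‖ * ‖s‖ * ‖l‖ * ((C + A) * ω) * (A * d * ω * (1 / 2) ^ n)
        + ‖β‖ * (2 * A * ω * (1 / 2) ^ n) * (A * d * ω) := by
      refine (norm_bilinear_le_of_center (l := l) hβ _ _).trans ?_
      gcongr
      · exact c4 n
      · exact c3 n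
      · exact c5 n
      · exact c2 n
    refine ((norm_add_le _ _).trans (add_le_add ((norm_add_le _ _).trans (add_le_add t1 t2))
      ((norm_add_le _ _).trans (add_le_add t3 t4)))).trans_eq ?_
    rw [hJ]; ring
  have hsum : ∀ n, ‖e 0 - e n‖ ≤ J * d * ω ^ 2 * (2 - 2 * (1 / 2) ^ n) := by
    intro n
    induction n with
    | zero => simp
    | succ n ih =>
      calc _ = ‖(e 0 - e n) + (e n - e (n + 1))‖ := by rw [sub_add_sub_cancel]
        _ ≤ _ := (norm_add_le _ _).trans (add_le_add ih (hstep n))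
        _ = _ := by rw [pow_succ]; ring
  -- What remains at time `n` contains the oscillation of `D²Θ` between `F^[n] x` and `0`, which
  -- tends to zero by mere continuity, and a part already proportional to `‖x‖`.
  have hlim : ∀ n, ‖e 0‖ ≤ (2 * J + J') * d * ω ^ 2
      + ‖fderiv ℝ (fderiv ℝ Θ) (F^[n] x) - B‖ * (C * ω) * (C * ω) := by
    intro n
    have e1 : e n = (fderiv ℝ (fderiv ℝ Θ) (F^[n] x) - B) (a n) (a n)
        + (B (a n - q n) (a n) + B (q n) (a n - q n)) := by
      rw [← dist_bilinear_le]
      simp only [e, sub_apply]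
      abel
    have u1 : ‖(fderiv ℝ (fderiv ℝ Θ) (F^[n] x) - B) (a n) (a n)‖
        ≤ ‖fderiv ℝ (fderiv ℝ Θ) (F^[n] x) - B‖ * (C * ω) * (C * ω) := by
      refine (ContinuousLinearMap.le_opNorm₂ _ _ _).trans ?_
      gcongr
      · exact haC n
      · exact haC n
    have u2 : ‖B (a n - q n) (a n)‖ ≤ ‖B‖ * (A * d * ω) * (C * ω) := by
      refine (ContinuousLinearMap.le_opNorm₂ _ _ _).trans ?_
      gcongr
      · exact c2 n
      · exact haC n
    have u3 : ‖B (q n) (a n - q n)‖ ≤ ‖B‖ * ((C + A) * ω) * (A * d * ω) := by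
      refine (ContinuousLinearMap.le_opNorm₂ _ _ _).trans ?_
      gcongr
      · exact c4 n
      · exact c2 n
    have u4 : ‖e n‖ ≤ ‖fderiv ℝ (fderiv ℝ Θ) (F^[n] x) - B‖ * (C * ω) * (C * ω)
        + (‖B‖ * (A * d * ω) * (C * ω) + ‖B‖ * ((C + A) * ω) * (A * d * ω)) := by
      rw [e1]
      exact (norm_add_le _ _).trans (add_le_add u1 ((norm_add_le _ _).trans (add_le_add u2 u3)))
    have u5 : J * d * ω ^ 2 * (2 - 2 * (1 / 2) ^ n) ≤ J * d * ω ^ 2 * 2 := by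
      gcongr; linarith [hpw n]
    calc ‖e 0‖ = ‖(e 0 - e n) + e n‖ := by rw [sub_add_cancel]
      _ ≤ J * d * ω ^ 2 * 2 + (‖fderiv ℝ (fderiv ℝ Θ) (F^[n] x) - B‖ * (C * ω) * (C * ω)
        + (‖B‖ * (A * d * ω) * (C * ω) + ‖B‖ * ((C + A) * ω) * (A * d * ω))) :=
          (norm_add_le _ _).trans (add_le_add ((hsum n).trans u5) u4)
      _ = _ := by rw [hJ']; ring
  have hxlim : Tendsto (fun n => F^[n] x) atTop (𝓝 0) := by
    refine squeeze_zero_norm hxN ?_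
    have hg : Tendsto (fun n => (1 / 2 : ℝ) ^ n) atTop (𝓝 0) :=
      tendsto_pow_atTop_nhds_zero_of_lt_one (by norm_num) (by norm_num)
    simpa using (hg.const_mul C).mul_const d
  have hBlim : Tendsto (fun n => ‖fderiv ℝ (fderiv ℝ Θ) (F^[n] x) - B‖) atTop (𝓝 0) := by
    have h1 : Tendsto (fun n => fderiv ℝ (fderiv ℝ Θ) (F^[n] x)) atTop (𝓝 B) :=
      hΘ2.tendsto.comp hxlim
    exact (tendsto_iff_norm_sub_tendsto_zero (E := E →L[ℝ] E →L[ℝ] Y)).1 h1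
  have hfin : ‖e 0‖ ≤ (2 * J + J') * d * ω ^ 2 := by
    have : Tendsto (fun n => (2 * J + J') * d * ω ^ 2
        + ‖fderiv ℝ (fderiv ℝ Θ) (F^[n] x) - B‖ * (C * ω) * (C * ω)) atTop
        (𝓝 ((2 * J + J') * d * ω ^ 2 + 0 * (C * ω) * (C * ω))) :=
      ((hBlim.mul_const _).mul_const _).const_add _
    have := ge_of_tendsto' this hlim
    simpa using this
  have he0 : e 0 = fderiv ℝ (fderiv ℝ Θ) x w w - B w w := by
    simp only [e, ha0, q, Function.iterate_zero, id_eq]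
  rw [← he0]
  refine hfin.trans ?_
  have : 0 ≤ K₃ * d * ω ^ 2 := by positivity
  linarith

end Leaf

/-! ### The local phase map of an attracting manifold of fixed points -/

section Isochron
variable {E Y : Type*} [NormedAddCommGroup E] [NormedSpace ℝ E] [CompleteSpace E]
  [NormedAddCommGroup Y] [NormedSpace ℝ Y] [CompleteSpace Y]

/-- The local phase map of a normally attracting manifold of fixed points, with the properties of
its derivatives. -/
theorem exists_isochron_map {F : E → E} {σ : Y → E} {l : E →L[ℝ] Y} {K : ℝ≥0}
    (hF : ContDiff ℝ 3 F) (hσ : ContDiff ℝ 2 σ) (hK : LipschitzWith K (fderiv ℝ (fderiv ℝ σ)))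
    (hσ0 : σ 0 = 0) (hfix : ∀ η, F (σ η) = σ η) (hls : ∀ η, l (fderiv ℝ σ 0 η) = η)
    (hlQ : ∀ x, l (fderiv ℝ F 0 x) = l x)
    (hV : ‖fderiv ℝ F 0 - (fderiv ℝ σ 0).comp l‖ ≤ 1 / 4) :
    ∃ r > 0, ∃ C ≥ 0, ∃ Θ : E → Y, ContDiffOn ℝ 2 Θ (Metric.ball 0 r) ∧ fderiv ℝ Θ 0 = l ∧
      (∀ x ∈ Metric.ball (0 : E) r, ‖Θ x‖ ≤ C * ‖x‖ ∧
        ∀ n, ‖F^[n] x - σ (Θ x)‖ ≤ C * (1 / 2) ^ n * ‖x‖) ∧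
      (∀ᶠ η in 𝓝 0, Θ (σ η) = η) ∧ (∀ n, ∀ᶠ x in 𝓝 0, Θ (F^[n] x) = Θ x) ∧
      ∀ x ∈ Metric.ball (0 : E) r, Θ x = 0 → ‖fderiv ℝ Θ x - l‖ ≤ C * ‖x‖ ∧
        ∀ w, ‖fderiv ℝ (fderiv ℝ Θ) x w w - fderiv ℝ (fderiv ℝ Θ) 0 w w‖
          ≤ C * ‖x‖ * ‖w‖ ^ 2 := by
  have hF0 : F 0 = 0 := by have := hfix 0; rwa [hσ0] at this
  have hFd : Differentiable ℝ F := hF.differentiable (by norm_num)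
  have hσd : Differentiable ℝ σ := hσ.differentiable (by norm_num)
  obtain ⟨r₀, hr₀, C, hC, Θ, hΘ, hΘb⟩ := exists_fiber_projection hF hσ hK hσ0 hfix hls hlQ hV
  obtain ⟨k, -, hk⟩ := exists_contDiffAt_leftInverse (l := l) hσ hσ0 hls
  obtain ⟨ρ, hρ, hkρ⟩ := Metric.eventually_nhds_iff_ball.1 hk
  have hinj : ∀ η ∈ Metric.ball (0 : Y) ρ, ∀ η' ∈ Metric.ball (0 : Y) ρ, σ η = σ η' → η = η' := by
    intro η h η' h' e
    rw [← hkρ η h, ← hkρ η' h', e]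
  -- Phases of points of this ball stay where `σ` is injective, so equal limits force equal phases;
  -- invariance under `F` and the identity `Θ ∘ σ = id` follow.
  set r₁ : ℝ := min r₀ (ρ / (C + 1))
  have hr₁ : 0 < r₁ := by positivity
  have hb₀ : ∀ x ∈ Metric.ball (0 : E) r₁, x ∈ Metric.ball (0 : E) r₀ := fun x hx =>
    Metric.ball_subset_ball (min_le_left _ _) hx
  have hbρ : ∀ x ∈ Metric.ball (0 : E) r₁, Θ x ∈ Metric.ball (0 : Y) ρ := by
    intro x hx
    have h1 : ‖x‖ < ρ / (C + 1) := by
      have : ‖x‖ < r₁ := by simpa using hx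
      exact this.trans_le (min_le_right _ _)
    rw [lt_div_iff₀' (by positivity)] at h1
    rw [mem_ball_zero_iff]
    refine ((hΘb x (hb₀ x hx)).1).trans_lt (lt_of_le_of_lt ?_ h1)
    gcongr; linarith
  have hlim : ∀ x ∈ Metric.ball (0 : E) r₁, Tendsto (fun n => F^[n] x) atTop (𝓝 (σ (Θ x))) := by
    intro x hx
    rw [tendsto_iff_norm_sub_tendsto_zero]
    have hg : Tendsto (fun n => (1 / 2 : ℝ) ^ n) atTop (𝓝 0) :=
      tendsto_pow_atTop_nhds_zero_of_lt_one (by norm_num) (by norm_num)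
    exact squeeze_zero (fun _ => norm_nonneg _) (hΘb x (hb₀ x hx)).2.1
      (by simpa using (hg.const_mul C).mul_const ‖x‖)
  have hΘn : ∀ n, ∀ x ∈ Metric.ball (0 : E) r₁, F^[n] x ∈ Metric.ball (0 : E) r₁ →
      Θ (F^[n] x) = Θ x := by
    intro n x h1 h2
    refine hinj _ (hbρ _ h2) _ (hbρ _ h1) (tendsto_nhds_unique (hlim _ h2) ?_)
    refine ((hlim x h1).comp (tendsto_add_atTop_nat n)).congr fun j => ?_
    rw [← Function.iterate_add_apply]; rfl
  have hΘσ : ∀ᶠ η in 𝓝 0, Θ (σ η) = η := by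
    have h1 : Tendsto σ (𝓝 0) (𝓝 0) := by
      have := hσd.continuous.tendsto 0; rwa [hσ0] at this
    filter_upwards [Metric.ball_mem_nhds 0 hρ, h1 (Metric.ball_mem_nhds 0 hr₁)] with η h2 h3
    refine hinj _ (hbρ _ h3) _ h2 (tendsto_nhds_unique (hlim _ h3) ?_)
    refine tendsto_const_nhds.congr fun n => ?_
    exact (Function.iterate_fixed (hfix η) n).symm
  have hev : ∀ n, ∀ᶠ x in 𝓝 0, Θ (F^[n] x) = Θ x := by
    intro n
    have h1 : Tendsto (F^[n]) (𝓝 0) (𝓝 0) := by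
      have := (hFd.iterate n).continuous.tendsto 0
      rwa [Function.iterate_fixed hF0] at this
    filter_upwards [Metric.ball_mem_nhds 0 hr₁, h1 (Metric.ball_mem_nhds 0 hr₁)] with x h2 h3
      using hΘn n x h2 h3
  have hΘd : HasFDerivAt Θ (fderiv ℝ Θ 0) 0 :=
    ((hΘ.contDiffAt (Metric.ball_mem_nhds 0 hr₀)).differentiableAt (by norm_num)).hasFDerivAt
  have hdσ : HasFDerivAt σ (fderiv ℝ σ 0) 0 := (hσd 0).hasFDerivAt
  have hdF : HasFDerivAt F (fderiv ℝ F 0) 0 := (hFd 0).hasFDerivAt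
  set D := fderiv ℝ Θ 0
  set s := fderiv ℝ σ 0
  set Q := fderiv ℝ F 0
  have hDs : ∀ η, D (s η) = η := by
    intro η
    have h1 : HasFDerivAt Θ D (σ 0) := by rwa [hσ0]
    have h2 := h1.comp 0 hdσ
    have h3 : HasFDerivAt (fun η : Y => η) (D.comp s) 0 :=
      h2.congr_of_eventuallyEq (by filter_upwards [hΘσ] with η h using h.symm)
    exact DFunLike.congr_fun (h3.unique (hasFDerivAt_id 0)) η
  have hDQ : ∀ x, D (Q x) = D x := by
    intro x
    have h1 : HasFDerivAt Θ D (F 0) := by rwa [hF0]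
    have h2 := h1.comp 0 hdF
    have h3 : HasFDerivAt Θ (D.comp Q) 0 :=
      h2.congr_of_eventuallyEq (by filter_upwards [hev 1] with x h using h.symm)
    exact DFunLike.congr_fun (h3.unique hΘd) x
  have hQs : ∀ η, Q (s η) = s η := by
    intro η
    have h1 : HasFDerivAt F Q (σ 0) := by rwa [hσ0]
    have h3 : HasFDerivAt σ (Q.comp s) 0 :=
      (h1.comp 0 hdσ).congr_of_eventuallyEq (.of_forall fun η => (hfix η).symm)
    exact DFunLike.congr_fun (h3.unique hdσ) η
  have hDl : D = l := by
    -- Both functionals are invariant under `Q` and agree on the range of `s`. Their difference is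
    -- thus reproduced by a factor of norm at most `1/4` and must vanish.
    have e : D - l = (D - l).comp (Q - s.comp l) := by
      ext x
      simp [hDs, hDQ, hlQ, hls]
    have h1 : ‖D - l‖ ≤ ‖D - l‖ * (1 / 4) := by
      calc _ = ‖(D - l).comp (Q - s.comp l)‖ := by rw [← e]
        _ ≤ _ := (ContinuousLinearMap.opNorm_comp_le _ _).trans (by gcongr)
    have h2 : ‖D - l‖ = 0 := by linarith [norm_nonneg (D - l)]
    exact sub_eq_zero.1 (norm_eq_zero.1 h2)
  obtain ⟨r₂, hr₂, C', hC', hleaf⟩ := exists_leaf_lipschitz (s := s) (l := l) (r := r₁) (C := C)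
    hF hF0 hls hlQ hQs hV hr₁ hC (hΘ.mono (Metric.ball_subset_ball (min_le_left _ _)))
    (fun x h1 h2 => hΘn 1 x h1 h2) hDl
    (fun x hx h0 n => by
      have := (hΘb x (hb₀ x hx)).2.1 n
      rwa [h0, hσ0, sub_zero] at this)
    (fun x hx => (hΘb x (hb₀ x hx)).2.2)
  refine ⟨min r₁ r₂, by positivity, C + C', by positivity, Θ,
    hΘ.mono (Metric.ball_subset_ball ((min_le_left _ _).trans (min_le_left _ _))), hDl,
    fun x hx => ?_, hΘσ, hev, fun x hx h0 => ?_⟩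
  · obtain ⟨h1, h2, -⟩ := hΘb x (hb₀ x (Metric.ball_subset_ball (min_le_left _ _) hx))
    refine ⟨h1.trans ?_, fun n => (h2 n).trans ?_⟩
    · gcongr; linarith
    · gcongr; linarith
  · obtain ⟨h1, h2⟩ := hleaf x (Metric.ball_subset_ball (min_le_right _ _) hx) h0
    refine ⟨h1.trans ?_, fun w => (h2 w).trans ?_⟩
    · gcongr; linarith
    · gcongr; linarith

end Isochron

/-- The push-forward of a semigroup under an isometry. -/
theorem IsC0SemigroupWithGenerator.conj {H : Type*} [NormedAddCommGroup H] [NormedSpace ℝ H]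
    {S : ℝ → H →L[ℝ] H} {G : H → H → Prop} (h : IsC0SemigroupWithGenerator S G)
    (e : H ≃ₗᵢ[ℝ] H) :
    IsC0SemigroupWithGenerator
      (fun t => ((e : H ≃L[ℝ] H) : H →L[ℝ] H).comp ((S t).comp ((e.symm : H ≃L[ℝ] H) : H →L[ℝ] H)))
      (fun x y => G (e.symm x) (e.symm y)) where
  zero := by ext x; simp [h.zero]
  add s t hs ht := by ext x; simp [h.add s t hs ht]
  cont x := e.continuous.comp_continuousOn (h.cont (e.symm x))
  gen x y := by
    rw [h.gen]
    constructor
    · intro h1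
      have h2 := (e.continuous.tendsto _).comp h1
      rw [e.apply_symm_apply] at h2
      refine h2.congr fun t => ?_
      simp
    · intro h1
      have h2 := (e.symm.continuous.tendsto _).comp h1
      refine h2.congr fun t => ?_
      simp

/-! ### Symmetries in coordinates -/

namespace PatternSystem
variable {m : ℕ} {H X : Type*} [NormedAddCommGroup H] [InnerProductSpace ℝ H]
  [AddCommGroup X] [Module ℝ X]

/-- The affine action of the symmetry `T_α` in the coordinate `v` of `φ₀ + v`. -/
noncomputable def shift (S : PatternSystem m H X) (α : Phase m) (v : H) : H :=
  S.shape α + S.TH α v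

namespace Assumptions
variable {S : PatternSystem m H X} {b : ℝ}

theorem toH_incl (hS : S.Assumptions b) (v : H) : S.toH (S.incl v) = v :=
  Function.leftInverse_invFun hS.incl_injective v

theorem incl_TH (hS : S.Assumptions b) (α : Phase m) (v : H) :
    S.incl (S.TH α v) = S.T α (S.incl v) := by
  obtain ⟨w, hw, -⟩ := hS.T_isometry α v
  rw [TH, hw, hS.toH_incl]

theorem norm_TH (hS : S.Assumptions b) (α : Phase m) (v : H) : ‖S.TH α v‖ = ‖v‖ := by
  obtain ⟨w, hw, h⟩ := hS.T_isometry α v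
  rw [TH, hw, hS.toH_incl, h]

theorem TH_add (hS : S.Assumptions b) (α : Phase m) (v w : H) :
    S.TH α (v + w) = S.TH α v + S.TH α w :=
  hS.incl_injective (by simp [hS.incl_TH])

theorem TH_smul (hS : S.Assumptions b) (α : Phase m) (c : ℝ) (v : H) :
    S.TH α (c • v) = c • S.TH α v :=
  hS.incl_injective (by simp [hS.incl_TH])

theorem TH_phase_add (hS : S.Assumptions b) (α β : Phase m) (v : H) :
    S.TH (α + β) v = S.TH α (S.TH β v) :=
  hS.incl_injective (by simp [hS.incl_TH, hS.T_add])

/-- The group law only makes `T₀` idempotent. On `H` it is also isometric, hence injective, hence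
the identity. -/
theorem TH_zero (hS : S.Assumptions b) (v : H) : S.TH 0 v = v := by
  have h1 : S.TH 0 (S.TH 0 v) = S.TH 0 v := by rw [← hS.TH_phase_add, add_zero]
  have h2 : S.TH 0 (S.TH 0 v + (-1 : ℝ) • v) = 0 := by
    rw [hS.TH_add, hS.TH_smul, h1]; simp
  have h3 : ‖S.TH 0 v + (-1 : ℝ) • v‖ = 0 := by rw [← hS.norm_TH 0, h2, norm_zero]
  rw [norm_eq_zero] at h3
  have : S.TH 0 v - v = 0 := by simpa [sub_eq_add_neg] using h3
  exact sub_eq_zero.1 this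

/-- The symmetry `T_α` on `H` as a linear isometry. -/
noncomputable def THe (hS : S.Assumptions b) (α : Phase m) : H ≃ₗᵢ[ℝ] H where
  toFun := S.TH α
  map_add' := hS.TH_add α
  map_smul' := hS.TH_smul α
  invFun := S.TH (-α)
  left_inv v := by rw [← hS.TH_phase_add, neg_add_cancel, hS.TH_zero]
  right_inv v := by rw [← hS.TH_phase_add, add_neg_cancel, hS.TH_zero]
  norm_map' := hS.norm_TH α

theorem THe_apply (hS : S.Assumptions b) (α : Phase m) (v : H) : hS.THe α v = S.TH α v := rfl

theorem incl_shape (hS : S.Assumptions b) (α : Phase m) : S.incl (S.shape α) = S.φ α - S.φ₀ := by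
  obtain ⟨v, hv⟩ := hS.φ_mem α
  rw [shape, hv, hS.toH_incl]

/-- The group law shows that `T₀` annihilates the difference `T₀ φ₀ - φ₀`. This difference lies in
`H`, where `T₀` is the identity. -/
theorem φ_zero (hS : S.Assumptions b) : S.φ 0 = S.φ₀ := by
  have h1 : S.T 0 (S.incl (S.shape 0)) = 0 := by
    rw [hS.incl_shape, map_sub, φ, ← hS.T_add, add_zero, sub_self]
  rw [← hS.incl_TH, hS.TH_zero, hS.incl_shape] at h1
  exact sub_eq_zero.1 h1

theorem shape_zero (hS : S.Assumptions b) : S.shape 0 = 0 :=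
  hS.incl_injective (by rw [hS.incl_shape, hS.φ_zero, sub_self, map_zero])

theorem point_injective (hS : S.Assumptions b) : Function.Injective S.point := fun _ _ h =>
  hS.incl_injective (add_left_cancel h)

theorem point_shift (hS : S.Assumptions b) (α : Phase m) (v : H) :
    S.point (S.shift α v) = S.T α (S.point v) := by
  simp only [point, shift, map_add, hS.incl_shape, hS.incl_TH, φ]; abel

theorem point_shape (hS : S.Assumptions b) (α : Phase m) : S.point (S.shape α) = S.φ α := by
  rw [point, hS.incl_shape]; abel

theorem shape_eq_iff (hS : S.Assumptions b) {α β : Phase m} :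
    S.shape α = S.shape β ↔ S.φ α = S.φ β := by
  rw [← hS.point_injective.eq_iff, hS.point_shape, hS.point_shape]

theorem shift_add (hS : S.Assumptions b) (α β : Phase m) (v : H) :
    S.shift (α + β) v = S.shift α (S.shift β v) :=
  hS.point_injective (by simp only [hS.point_shift, hS.T_add])

theorem shift_zero_right (hS : S.Assumptions b) (α : Phase m) : S.shift α 0 = S.shape α := by
  have : S.TH α 0 = 0 := by simpa using hS.TH_smul α 0 0
  rw [shift, this, add_zero]

theorem shift_zero_left (hS : S.Assumptions b) (v : H) : S.shift 0 v = v := by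
  rw [shift, hS.shape_zero, hS.TH_zero, zero_add]

theorem shift_shape (hS : S.Assumptions b) (α β : Phase m) :
    S.shift α (S.shape β) = S.shape (α + β) := by
  rw [← hS.shift_zero_right β, ← hS.shift_add, hS.shift_zero_right]

theorem shift_shift_neg (hS : S.Assumptions b) (α : Phase m) (v : H) :
    S.shift α (S.shift (-α) v) = v := by
  rw [← hS.shift_add, add_neg_cancel, hS.shift_zero_left]

theorem shift_sub_shift (hS : S.Assumptions b) (α : Phase m) (v w : H) :
    S.shift α v - S.shift α w = S.TH α (v - w) := by
  rw [← hS.THe_apply, map_sub, hS.THe_apply, hS.THe_apply, shift, shift]; abel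

theorem norm_shift_sub_shift (hS : S.Assumptions b) (α : Phase m) (v w : H) :
    ‖S.shift α v - S.shift α w‖ = ‖v - w‖ := by
  rw [hS.shift_sub_shift, hS.norm_TH]

theorem norm_shift_neg (hS : S.Assumptions b) (α : Phase m) (v : H) :
    ‖S.shift (-α) v‖ = ‖v - S.shape α‖ := by
  have := hS.norm_shift_sub_shift (-α) v (S.shape α)
  rwa [hS.shift_shape, neg_add_cancel, hS.shape_zero, sub_zero] at this

theorem contDiff_shift (hS : S.Assumptions b) (α : Phase m) {n : WithTop ℕ∞} :
    ContDiff ℝ n (S.shift α) :=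
  contDiff_const.add (hS.THe α).contDiff

theorem hasFDerivAt_shift (hS : S.Assumptions b) (α : Phase m) (v : H) :
    HasFDerivAt (S.shift α) (((hS.THe α : H ≃L[ℝ] H)) : H →L[ℝ] H) v :=
  ((hS.THe α : H ≃L[ℝ] H).hasFDerivAt).const_add (S.shape α)

theorem incl_nonlin (hS : S.Assumptions b) (v : H) :
    S.incl (S.nonlin v) = S.f (S.point v) - S.f S.φ₀ := by
  obtain ⟨w, hw⟩ := hS.f_mem v
  rw [nonlin, hw, hS.toH_incl]

theorem nonlin_zero (hS : S.Assumptions b) : S.nonlin 0 = 0 :=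
  hS.incl_injective (by simp [hS.incl_nonlin, point])

/-- Equivariance of `f` in coordinates centred at `φ₀`. The constant `S.nonlin (S.shape α)` appears
because the symmetry moves the centre. -/
theorem nonlin_shift (hS : S.Assumptions b) (α : Phase m) (v : H) :
    S.nonlin (S.shift α v) = S.nonlin (S.shape α) + S.TH α (S.nonlin v) := by
  refine hS.incl_injective ?_
  rw [map_add, hS.incl_TH]
  simp only [hS.incl_nonlin]
  rw [← hS.shift_zero_right α, hS.point_shift, hS.point_shift, hS.f_T, hS.f_T, map_sub]
  simp [point]

theorem exists_lipschitzWith_nonlin (hS : S.Assumptions b) :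
    ∃ K : ℝ≥0, LipschitzWith K S.nonlin := by
  obtain ⟨K, hK⟩ := hS.f_bound
  refine ⟨K.toNNReal, lipschitzWith_of_nnnorm_fderiv_le
    (hS.f_smooth.differentiable (by norm_num)) fun v => ?_⟩
  rw [← NNReal.coe_le_coe, coe_nnnorm, Real.coe_toNNReal']
  exact (hK v).1.trans (le_max_left _ _)

theorem fderiv_nonlin_shift (hS : S.Assumptions b) (α : Phase m) (v w : H) :
    fderiv ℝ S.nonlin (S.shift α v) (S.TH α w) = S.TH α (fderiv ℝ S.nonlin v w) := by
  have hd := hS.f_smooth.differentiable (by norm_num)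
  have h1 := (hd (S.shift α v)).hasFDerivAt.comp v (hS.hasFDerivAt_shift α v)
  have h2 : HasFDerivAt (S.nonlin ∘ S.shift α)
      (((hS.THe α : H ≃L[ℝ] H) : H →L[ℝ] H).comp (fderiv ℝ S.nonlin v)) v := by
    have := ((hS.THe α : H ≃L[ℝ] H).hasFDerivAt.comp v (hd v).hasFDerivAt).const_add
      (S.nonlin (S.shape α))
    refine this.congr_of_eventuallyEq (.of_forall fun u => ?_)
    exact hS.nonlin_shift α u
  exact DFunLike.congr_fun (h1.unique h2) w

theorem fderiv_fderiv_nonlin_shift (hS : S.Assumptions b) (α : Phase m) (v w w' : H) :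
    fderiv ℝ (fderiv ℝ S.nonlin) (S.shift α v) (S.TH α w) (S.TH α w')
      = S.TH α (fderiv ℝ (fderiv ℝ S.nonlin) v w w') := by
  have hd := (hS.f_smooth.fderiv_right (m := 2) (by norm_num)).differentiable (by norm_num)
  have h1 : HasFDerivAt (fun u => fderiv ℝ S.nonlin (S.shift α u) (S.TH α w')) _ v :=
    ((hd (S.shift α v)).hasFDerivAt.comp v (hS.hasFDerivAt_shift α v)).apply_const (S.TH α w')
  have h2 : HasFDerivAt (fun u => fderiv ℝ S.nonlin (S.shift α u) (S.TH α w')) _ v :=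
    ((hS.THe α : H ≃L[ℝ] H).hasFDerivAt.comp v ((hd v).hasFDerivAt.apply_const w')).congr_of_eventuallyEq
      (.of_forall fun u => hS.fderiv_nonlin_shift α u w')
  exact DFunLike.congr_fun (h1.unique h2) w

theorem Df_TH (hS : S.Assumptions b) (α : Phase m) (w : H) :
    S.Df α (S.TH α w) = S.TH α (S.Df 0 w) := by
  have := hS.fderiv_nonlin_shift α 0 w
  rwa [hS.shift_zero_right, ← hS.shape_zero] at this

theorem D2f_TH (hS : S.Assumptions b) (α : Phase m) (w w' : H) :
    S.D2f α (S.TH α w) (S.TH α w') = S.TH α (S.D2f 0 w w') := by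
  have := hS.fderiv_fderiv_nonlin_shift α 0 w w'
  rwa [hS.shift_zero_right, ← hS.shape_zero] at this

theorem AH_TH (hS : S.Assumptions b) (α : Phase m) {x y : H} (h : S.AH x y) :
    S.AH (S.TH α x) (S.TH α y) := by
  obtain ⟨hx, e⟩ := h
  obtain ⟨hx', e'⟩ := hS.A_T α _ hx
  have hx'' : S.incl (S.TH α x) ∈ S.A.domain := by rwa [hS.incl_TH]
  refine ⟨hx'', ?_⟩
  have : (⟨S.incl (S.TH α x), hx''⟩ : S.A.domain) = ⟨S.T α (S.incl x), hx'⟩ :=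
    Subtype.ext (hS.incl_TH α x)
  rw [this, e', e, hS.incl_TH]

theorem AH_TH_iff (hS : S.Assumptions b) (α : Phase m) {x y : H} :
    S.AH (S.TH α x) (S.TH α y) ↔ S.AH x y := by
  refine ⟨fun h => ?_, hS.AH_TH α⟩
  have := hS.AH_TH (-α) h
  rwa [← hS.TH_phase_add, ← hS.TH_phase_add, neg_add_cancel, hS.TH_zero, hS.TH_zero] at this

theorem L_TH_iff (hS : S.Assumptions b) (α : Phase m) {x y : H} :
    S.L α (S.TH α x) (S.TH α y) ↔ S.L 0 x y := by
  rw [L, L, hS.Df_TH, ← hS.AH_TH_iff α (x := x)]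
  have : S.TH α y - S.TH α (S.Df 0 x) = S.TH α (y - S.Df 0 x) := by
    simp only [← hS.THe_apply, map_sub]
  rw [this]

theorem AH_shape (hS : S.Assumptions b) (α : Phase m) :
    S.AH (S.shape α) (-S.nonlin (S.shape α)) := by
  obtain ⟨h1, e1⟩ := hS.stationary α
  obtain ⟨h0, e0⟩ := hS.stationary 0
  have hx : S.incl (S.shape α) ∈ S.A.domain := by
    rw [hS.incl_shape, ← hS.φ_zero]; exact S.A.domain.sub_mem h1 h0
  refine ⟨hx, ?_⟩
  have : (⟨S.incl (S.shape α), hx⟩ : S.A.domain) = ⟨S.φ α, h1⟩ - ⟨S.φ 0, h0⟩ :=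
    Subtype.ext (by simp only [AddSubgroupClass.coe_sub]; rw [hS.incl_shape, hS.φ_zero])
  rw [this, LinearPMap.map_sub, eq_neg_of_add_eq_zero_left e1, eq_neg_of_add_eq_zero_left e0,
    map_neg, hS.incl_nonlin, hS.point_shape, hS.φ_zero]
  abel

end Assumptions
end PatternSystem

/-! ### Linearization, spectral projection and flow -/

namespace PatternSystem
variable {m : ℕ} {H X : Type*} [NormedAddCommGroup H] [InnerProductSpace ℝ H] [CompleteSpace H]
  [AddCommGroup X] [Module ℝ X]

theorem Phase_eq_sum (η : Phase m) : η = ∑ i, η i • EuclideanSpace.single i (1 : ℝ) := by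
  have := (EuclideanSpace.basisFun (Fin m) ℝ).sum_repr η
  simpa using this.symm

/-- The functionals `⟨ψ^i_0, ·⟩`, as one map to the phases. -/
noncomputable def modes (S : PatternSystem m H X) : H →L[ℝ] Phase m :=
  ((EuclideanSpace.equiv (Fin m) ℝ).symm : (Fin m → ℝ) →L[ℝ] Phase m).comp
    (ContinuousLinearMap.pi fun i => innerSL ℝ (S.ψ i 0))

theorem modes_apply (S : PatternSystem m H X) (w : H) (i : Fin m) :
    S.modes w i = inner ℝ (S.ψ i 0) w := rfl

theorem proj_apply (S : PatternSystem m H X) (α : Phase m) (w : H) :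
    S.proj α w = ∑ i, inner ℝ (S.ψ i α) w • S.dφ i α := by
  simp [proj]

theorem fderiv_shape_apply (S : PatternSystem m H X) (α η : Phase m) :
    fderiv ℝ S.shape α η = ∑ i, η i • S.dφ i α := by
  conv_lhs => rw [Phase_eq_sum η, map_sum]
  simp [dφ, partialD]

theorem proj_zero_apply (S : PatternSystem m H X) (w : H) :
    S.proj 0 w = fderiv ℝ S.shape 0 (S.modes w) := by
  rw [proj_apply, fderiv_shape_apply]; rfl

namespace Assumptions
variable {S : PatternSystem m H X} {b : ℝ}

theorem isC0_PA (hS : S.Assumptions b) : IsC0SemigroupWithGenerator S.PA S.AH :=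
  semigroupOf_spec hS.A_generates

theorem isC0_U (hS : S.Assumptions b) (α : Phase m) :
    IsC0SemigroupWithGenerator (S.U α) (S.L α) := by
  obtain ⟨U, hU, -⟩ := hS.isC0_PA.exists_perturbation (S.Df α)
  exact semigroupOf_spec ⟨U, hU⟩

theorem U_duhamel (hS : S.Assumptions b) (α : Phase m) {t : ℝ} (ht : 0 ≤ t) (x : H) :
    S.U α t x = S.PA t x + ∫ s in (0 : ℝ)..t, S.PA (t - s) (S.Df α (S.U α s x)) := by
  obtain ⟨U, hU, h⟩ := hS.isC0_PA.exists_perturbation (S.Df α)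
  have e : ∀ s, 0 ≤ s → S.U α s = U s := fun s hs => (hS.isC0_U α).eq_of_generator hU hs
  rw [e t ht, h t ht]
  congr 1
  refine intervalIntegral.integral_congr fun s hs => ?_
  rw [uIcc_of_le ht] at hs
  simp only [e s hs.1]

/-- The conjugated semigroup has the same generator because `A` commutes with the symmetry, and a
semigroup is determined by its generator. -/
theorem PA_TH (hS : S.Assumptions b) (α : Phase m) {t : ℝ} (ht : 0 ≤ t) (x : H) :
    S.PA t (S.TH α x) = S.TH α (S.PA t x) := by
  have h1 := hS.isC0_PA.conj (hS.THe α)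
  have e : (fun x y => S.AH ((hS.THe α).symm x) ((hS.THe α).symm y)) = S.AH := by
    ext x y
    exact hS.AH_TH_iff (-α)
  rw [e] at h1
  refine (DFunLike.congr_fun (hS.isC0_PA.eq_of_generator h1 ht) (S.TH α x)).trans ?_
  change hS.THe α (S.PA t ((hS.THe α).symm (hS.THe α x))) = _
  rw [LinearIsometryEquiv.symm_apply_apply]; rfl

theorem U_TH (hS : S.Assumptions b) (α : Phase m) {t : ℝ} (ht : 0 ≤ t) (x : H) :
    S.U α t (S.TH α x) = S.TH α (S.U 0 t x) := by
  have h1 := (hS.isC0_U 0).conj (hS.THe α)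
  have e : (fun x y => S.L 0 ((hS.THe α).symm x) ((hS.THe α).symm y)) = S.L α := by
    ext x y
    rw [← hS.L_TH_iff α, ← hS.THe_apply, ← hS.THe_apply, LinearIsometryEquiv.apply_symm_apply,
      LinearIsometryEquiv.apply_symm_apply]
  rw [e] at h1
  rw [(hS.isC0_U α).eq_of_generator h1 ht]
  change hS.THe α (S.U 0 t ((hS.THe α).symm (hS.THe α x))) = _
  rw [LinearIsometryEquiv.symm_apply_apply]; rfl

theorem differentiable_shape (hS : S.Assumptions b) : Differentiable ℝ S.shape :=
  hS.φ_smooth.differentiable (by norm_num)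

theorem fderiv_shape_TH (hS : S.Assumptions b) (α η : Phase m) :
    fderiv ℝ S.shape α η = S.TH α (fderiv ℝ S.shape 0 η) := by
  have h1 : HasFDerivAt (fun β => S.shape (α + β)) (fderiv ℝ S.shape α) 0 := by
    have h : HasFDerivAt S.shape (fderiv ℝ S.shape α) (α + 0) := by
      rw [add_zero]; exact (hS.differentiable_shape α).hasFDerivAt
    exact (hasFDerivAt_comp_add_left α).2 h
  have h2 : HasFDerivAt (fun β => S.shape (α + β))
      (((hS.THe α : H ≃L[ℝ] H) : H →L[ℝ] H).comp (fderiv ℝ S.shape 0)) 0 :=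
    ((hS.hasFDerivAt_shift α _).comp 0 (hS.differentiable_shape 0).hasFDerivAt).congr_of_eventuallyEq
      (.of_forall fun β => (hS.shift_shape α β).symm)
  exact DFunLike.congr_fun (h1.unique h2) η

theorem dφ_TH (hS : S.Assumptions b) (i : Fin m) (α : Phase m) :
    S.dφ i α = S.TH α (S.dφ i 0) :=
  hS.fderiv_shape_TH α _

theorem ψ_add (hS : S.Assumptions b) (i : Fin m) (α β : Phase m) :
    S.ψ i (α + β) = S.TH α (S.ψ i β) := by
  rw [hS.ψ_T, hS.TH_phase_add, ← hS.ψ_T]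

theorem differentiable_ψ (hS : S.Assumptions b) (i : Fin m) : Differentiable ℝ (S.ψ i) :=
  (hS.ψ_smooth i).differentiable (by norm_num)

theorem fderiv_ψ_TH (hS : S.Assumptions b) (i : Fin m) (α η : Phase m) :
    fderiv ℝ (S.ψ i) α η = S.TH α (fderiv ℝ (S.ψ i) 0 η) := by
  have h1 : HasFDerivAt (fun β => S.ψ i (α + β)) (fderiv ℝ (S.ψ i) α) 0 := by
    have h : HasFDerivAt (S.ψ i) (fderiv ℝ (S.ψ i) α) (α + 0) := by
      rw [add_zero]; exact (hS.differentiable_ψ i α).hasFDerivAt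
    exact (hasFDerivAt_comp_add_left α).2 h
  have h2 : HasFDerivAt (fun β => S.ψ i (α + β))
      (((hS.THe α : H ≃L[ℝ] H) : H →L[ℝ] H).comp (fderiv ℝ (S.ψ i) 0)) 0 :=
    ((hS.THe α : H ≃L[ℝ] H).hasFDerivAt.comp 0
      (hS.differentiable_ψ i 0).hasFDerivAt).congr_of_eventuallyEq
      (.of_forall fun β => hS.ψ_add i α β)
  exact DFunLike.congr_fun (h1.unique h2) η

theorem dψ_TH (hS : S.Assumptions b) (i j : Fin m) (α : Phase m) :
    S.dψ i j α = S.TH α (S.dψ i j 0) :=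
  hS.fderiv_ψ_TH i α _

theorem inner_TH (hS : S.Assumptions b) (α : Phase m) (v w : H) :
    inner ℝ (S.TH α v) (S.TH α w) = inner ℝ v w :=
  (hS.THe α).inner_map_map v w

theorem proj_TH (hS : S.Assumptions b) (α : Phase m) (x : H) :
    S.proj α (S.TH α x) = S.TH α (S.proj 0 x) := by
  rw [proj_apply, proj_apply, ← hS.THe_apply, ← hS.THe_apply, map_sum]
  refine Finset.sum_congr rfl fun i _ => ?_
  rw [hS.ψ_T i α, hS.dφ_TH i α, map_smul, hS.THe_apply, hS.THe_apply, hS.inner_TH]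

theorem V_TH (hS : S.Assumptions b) (α : Phase m) {t : ℝ} (ht : 0 ≤ t) (x : H) :
    S.V α t (S.TH α x) = S.TH α (S.V 0 t x) := by
  rw [V, V, sub_apply, sub_apply, hS.U_TH α ht, hS.proj_TH]
  simp only [← hS.THe_apply, map_sub]

theorem modes_fderiv_shape (hS : S.Assumptions b) (η : Phase m) :
    S.modes (fderiv ℝ S.shape 0 η) = η := by
  ext i
  rw [modes_apply, fderiv_shape_apply, inner_sum]
  simp [inner_smul_right, hS.ψ_dφ]

/-- Tangent vectors of the manifold of patterns lie in the kernel of `L₀`, so their orbits are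
constant. -/
theorem U_fderiv_shape (hS : S.Assumptions b) {t : ℝ} (ht : 0 ≤ t) (η : Phase m) :
    S.U 0 t (fderiv ℝ S.shape 0 η) = fderiv ℝ S.shape 0 η := by
  have h1 : S.L 0 (fderiv ℝ S.shape 0 η) 0 := by
    rw [hS.ker_L, fderiv_shape_apply]
    exact Submodule.sum_mem _ fun i _ => Submodule.smul_mem _ _ (Submodule.subset_span ⟨i, rfl⟩)
  have := (hS.isC0_U 0).integral_orbit h1 ht
  simp only [map_zero, intervalIntegral.integral_zero] at this
  exact (sub_eq_zero.1 this.symm)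

theorem modes_eq_zero_of_L (hS : S.Assumptions b) {x y : H} (h : S.L 0 x y) : S.modes y = 0 := by
  ext i; exact hS.ψ_ker i 0 x y h

/-- The `ψ^i_0` annihilate the range of `L₀`. Hence the modes of an orbit starting in the domain
have zero derivative, and density extends invariance to all of `H`. -/
theorem modes_U (hS : S.Assumptions b) {t : ℝ} (ht : 0 ≤ t) (x : H) :
    S.modes (S.U 0 t x) = S.modes x := by
  have h := hS.isC0_U 0
  refine congrFun (f := fun x => S.modes (S.U 0 t x)) (Continuous.ext_on h.dense_domain
    (S.modes.continuous.comp (S.U 0 t).continuous) S.modes.continuous ?_) x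
  rintro x ⟨y, hxy⟩
  have h1 := h.integral_orbit hxy ht
  have hc : ContinuousOn (fun s => S.U 0 s y) (uIcc 0 t) := by
    rw [uIcc_of_le ht]; exact (h.cont y).mono Icc_subset_Ici_self
  have h2 : S.modes (∫ s in (0 : ℝ)..t, S.U 0 s y) = 0 := by
    rw [← ContinuousLinearMap.intervalIntegral_comp_comm _ hc.intervalIntegrable]
    rw [intervalIntegral.integral_congr (g := fun _ => (0 : Phase m)), intervalIntegral.integral_zero]
    intro s hs
    rw [uIcc_of_le ht] at hs
    exact hS.modes_eq_zero_of_L (h.gen_apply hxy hs.1)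
  rw [h1, map_sub] at h2
  exact sub_eq_zero.1 h2

theorem V_zero_apply (hS : S.Assumptions b) {t : ℝ} (ht : 0 ≤ t) (x : H) :
    S.V 0 t x = S.U 0 t (x - S.proj 0 x) := by
  rw [V, sub_apply, map_sub, proj_zero_apply, hS.U_fderiv_shape ht]

theorem proj_zero_proj_zero (hS : S.Assumptions b) (x : H) :
    S.proj 0 (S.proj 0 x) = S.proj 0 x := by
  rw [proj_zero_apply, proj_zero_apply, hS.modes_fderiv_shape]

/-- Since `P₀` is invariant under the semigroup, `V₀(t)` is `U₀(t)` after the projection `Π₀`, and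
the Gearhart-Prüss theorem applies with `Q = Π₀`. The half plane `Re z ≥ 0` is enough; the rate
obtained is some positive `c`. -/
theorem exists_V_decay (hS : S.Assumptions b) (e : HilbertBasis ℕ ℝ H) :
    ∃ C c : ℝ, 0 ≤ C ∧ 0 < c ∧ ∀ t, 0 ≤ t → ‖S.V 0 t‖ ≤ C * Real.exp (-c * t) := by
  obtain ⟨M, hM, hres⟩ := hS.resolvent_bound
  obtain ⟨C, c, hC, hc, h⟩ := (hS.isC0_U 0).exists_exp_decay e
    (Q := ContinuousLinearMap.id ℝ H - S.proj 0)
    (fun x => by simp [hS.proj_zero_proj_zero])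
    (fun t ht x => by
      simp only [sub_apply, ContinuousLinearMap.id_apply, map_sub, proj_zero_apply, hS.modes_U ht,
        hS.U_fderiv_shape ht])
    (fun x y hxy => by
      refine ⟨y, ?_⟩
      have h1 : S.L 0 (S.proj 0 x) 0 := by
        rw [hS.ker_L, proj_apply]
        exact Submodule.sum_mem _ fun i _ =>
          Submodule.smul_mem _ _ (Submodule.subset_span ⟨i, rfl⟩)
      have := (hS.isC0_U 0).gen_add hxy ((hS.isC0_U 0).gen_smul (-1) h1)
      simpa [sub_eq_add_neg] using this)
    hM (fun z hz => hres 0 z (by linarith [hS.b_pos]))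
  refine ⟨C, c, hC, hc, fun t ht => ?_⟩
  have : S.V 0 t = (S.U 0 t).comp (ContinuousLinearMap.id ℝ H - S.proj 0) := by
    ext x; rw [hS.V_zero_apply ht]; simp
  rw [this]
  exact h t ht

theorem exists_lipschitzWith_fderiv_fderiv_shape (hS : S.Assumptions b) :
    ∃ K : ℝ≥0, LipschitzWith K (fderiv ℝ (fderiv ℝ S.shape)) := by
  obtain ⟨K, hK⟩ := hS.φ_lipschitz
  have hd : Differentiable ℝ (fderiv ℝ S.shape) :=
    (hS.φ_smooth.fderiv_right (m := 1) (by norm_num)).differentiable (by norm_num)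
  have e : ∀ i j α, partialD j (S.dφ i) α = fderiv ℝ (fderiv ℝ S.shape) α
      (EuclideanSpace.single j 1) (EuclideanSpace.single i 1) := by
    intro i j α
    have : HasFDerivAt (S.dφ i) _ α :=
      (hd α).hasFDerivAt.apply_const (EuclideanSpace.single i (1 : ℝ))
    rw [partialD, this.fderiv]; rfl
  refine ⟨∑ _i : Fin m, ∑ _j : Fin m, K, LipschitzWith.of_dist_le_mul fun α β => ?_⟩
  rw [dist_eq_norm, dist_eq_norm]
  refine ContinuousLinearMap.opNorm_le_bound₂ _ (by positivity) fun v w => ?_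
  have hv : ∀ (u : Phase m) i, ‖u i‖ ≤ ‖u‖ := fun u i => PiLp.norm_apply_le u i
  have hB : ∀ B : Phase m →L[ℝ] Phase m →L[ℝ] H, B v w = ∑ i, ∑ j, (w i * v j) •
      B (EuclideanSpace.single j 1) (EuclideanSpace.single i 1) := by
    intro B
    conv_lhs => rw [Phase_eq_sum w, map_sum]
    refine Finset.sum_congr rfl fun i _ => ?_
    conv_lhs => rw [Phase_eq_sum v, map_sum]
    simp only [map_smul, sum_apply, smul_apply, Finset.smul_sum, smul_smul]
  rw [hB]
  simp only [NNReal.coe_sum]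
  rw [Finset.sum_mul, Finset.sum_mul, Finset.sum_mul]
  refine norm_sum_le_of_le _ fun i _ => ?_
  rw [Finset.sum_mul, Finset.sum_mul, Finset.sum_mul]
  refine norm_sum_le_of_le _ fun j _ => ?_
  rw [show (fderiv ℝ (fderiv ℝ S.shape) α - fderiv ℝ (fderiv ℝ S.shape) β)
    (EuclideanSpace.single j 1) (EuclideanSpace.single i 1)
      = partialD j (S.dφ i) α - partialD j (S.dφ i) β by rw [e, e]; rfl, norm_smul, norm_mul]
  calc _ ≤ ‖w‖ * ‖v‖ * (K * ‖α - β‖) := by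
        gcongr
        · exact hv w i
        · exact hv v j
        · exact ((hK i j).2).norm_sub_le α β
    _ = _ := by ring

/-- The nonlinearity minus its linearization at `φ₀`. -/
noncomputable def remainder (hS : S.Assumptions b) : C(H, H) :=
  ⟨fun v => S.nonlin v - S.Df 0 v, hS.f_smooth.continuous.sub (S.Df 0).continuous⟩

theorem remainder_apply (hS : S.Assumptions b) (v : H) :
    hS.remainder v = S.nonlin v - S.Df 0 v := rfl

theorem contDiff_remainder (hS : S.Assumptions b) : ContDiff ℝ 3 hS.remainder :=
  hS.f_smooth.sub (S.Df 0).contDiff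

theorem exists_lipschitzWith_remainder (hS : S.Assumptions b) :
    ∃ K : ℝ≥0, LipschitzWith K hS.remainder := by
  obtain ⟨K, hK⟩ := hS.exists_lipschitzWith_nonlin
  exact ⟨_, hK.sub (S.Df 0).lipschitz⟩

theorem remainder_zero (hS : S.Assumptions b) : hS.remainder 0 = 0 := by
  rw [remainder_apply, hS.nonlin_zero, map_zero, sub_zero]

theorem fderiv_remainder (hS : S.Assumptions b) :
    fderiv ℝ hS.remainder = fun v => fderiv ℝ S.nonlin v - S.Df 0 := by
  ext1 v
  exact ((hS.f_smooth.differentiable (by norm_num) v).hasFDerivAt.sub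
    (S.Df 0).hasFDerivAt).fderiv

theorem fderiv_remainder_zero (hS : S.Assumptions b) : fderiv ℝ hS.remainder 0 = 0 := by
  rw [hS.fderiv_remainder]; simp only [Df, hS.shape_zero, sub_self]

theorem fderiv_fderiv_remainder_zero (hS : S.Assumptions b) :
    fderiv ℝ (fderiv ℝ hS.remainder) 0 = S.D2f 0 := by
  rw [hS.fderiv_remainder, fderiv_sub_const, D2f, hS.shape_zero]

/-- One flow, two descriptions. With `L₀` and the remainder its linearization at `0` is the
semigroup `U₀`; with `A` and the full nonlinearity it is the flow of the statement and is
equivariant. The variation of constants formula identifies them. -/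
theorem exists_flow (hS : S.Assumptions b) : ∃ Φ : ℝ → H → H,
    IsMildFlow (S.U 0) hS.remainder Φ ∧ IsMildFlow S.PA S.nonlin Φ := by
  obtain ⟨K, hK⟩ := hS.exists_lipschitzWith_remainder
  obtain ⟨K', hK'⟩ := hS.exists_lipschitzWith_nonlin
  obtain ⟨Φ, hΦ⟩ := exists_mildFlow (hS.isC0_U 0) hS.contDiff_remainder hK
  obtain ⟨Ψ, hΨ⟩ := exists_mildFlow hS.isC0_PA (N := ⟨S.nonlin, hS.f_smooth.continuous⟩)
    hS.f_smooth hK'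
  have hm : ∀ v, IsMild S.PA S.nonlin v fun t => Φ t v := fun v =>
    IsMild.of_perturbation hS.isC0_PA (hS.isC0_U 0) (fun t ht x => hS.U_duhamel 0 ht x)
      hS.f_smooth.continuous (hΦ.mild v)
  refine ⟨Φ, hΦ, hm, fun v x hx t ht => ?_⟩
  rw [hΨ.unique v x hx t ht, ← hΨ.unique v _ (hm v) t ht]

section Flow
variable {Φ : ℝ → H → H}

theorem convergesTo_iff (hΦ : IsMildFlow S.PA S.nonlin Φ) {v : H} {η : Phase m} :
    S.ConvergesTo v η ↔ Tendsto (fun t => Φ t v) atTop (𝓝 (S.shape η)) := by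
  refine ⟨fun ⟨x, hx, h⟩ => h.congr' ?_, fun h => ⟨_, hΦ.mild v, h⟩⟩
  filter_upwards [eventually_ge_atTop (0 : ℝ)] with t ht using hΦ.unique v x hx t ht

theorem continuous_PA_comp (hS : S.Assumptions b) {t : ℝ} {g : ℝ → H} (hg : Continuous g)
    (ht : 0 ≤ t) : IntervalIntegrable (fun s => S.PA (t - s) (g s)) MeasureTheory.volume 0 t := by
  have hc : Continuous fun s => S.PA (max (t - s) 0) (g s) :=
    hS.isC0_PA.continuous_comp (by fun_prop) hg
  refine ContinuousOn.intervalIntegrable (hc.continuousOn.congr fun s hs => ?_)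
  rw [uIcc_of_le ht] at hs
  simp only [max_eq_left (sub_nonneg.2 hs.2)]

/-- Stationary patterns are constant mild solutions: the generator sends `shape α` to `-nonlin
(shape α)`, and integrating its orbit gives the formula. -/
theorem PA_shape (hS : S.Assumptions b) (α : Phase m) {t : ℝ} (ht : 0 ≤ t) :
    S.PA t (S.shape α) + ∫ s in (0 : ℝ)..t, S.PA (t - s) (S.nonlin (S.shape α)) = S.shape α := by
  have h1 := hS.isC0_PA.integral_orbit (hS.AH_shape α) ht
  rw [intervalIntegral.integral_comp_sub_left (fun s => S.PA s (S.nonlin (S.shape α))) t]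
  simp only [map_neg, intervalIntegral.integral_neg] at h1
  simp only [sub_self, sub_zero]
  rw [← neg_neg (∫ s in (0 : ℝ)..t, S.PA s (S.nonlin (S.shape α))), h1]
  abel

theorem isMild_shift (hS : S.Assumptions b) (α : Phase m) {v : H} {x : ℝ → H}
    (hx : IsMild S.PA S.nonlin v x) :
    IsMild S.PA S.nonlin (S.shift α v) fun t => S.shift α (x t) := by
  refine ⟨(hS.contDiff_shift α (n := 0)).continuous.comp_continuousOn hx.1, fun t ht => ?_⟩
  have hg : Continuous fun s => S.nonlin (x (max s 0)) :=
    hS.f_smooth.continuous.comp hx.1.comp_max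
  have i1 := hS.continuous_PA_comp (continuous_const (y := S.nonlin (S.shape α))) ht
  have i2 := hS.continuous_PA_comp hg ht
  have i3 : IntervalIntegrable (fun s => S.TH α (S.PA (t - s) (S.nonlin (x (max s 0)))))
      MeasureTheory.volume 0 t :=
    ⟨((hS.THe α : H ≃L[ℝ] H) : H →L[ℝ] H).integrable_comp i2.1,
      ((hS.THe α : H ≃L[ℝ] H) : H →L[ℝ] H).integrable_comp i2.2⟩
  have e1 : ∫ s in (0 : ℝ)..t, S.PA (t - s) (S.nonlin (S.shift α (x s)))
      = (∫ s in (0 : ℝ)..t, S.PA (t - s) (S.nonlin (S.shape α)))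
        + S.TH α (∫ s in (0 : ℝ)..t, S.PA (t - s) (S.nonlin (x (max s 0)))) := by
    have e2 : S.TH α (∫ s in (0 : ℝ)..t, S.PA (t - s) (S.nonlin (x (max s 0))))
        = ∫ s in (0 : ℝ)..t, S.TH α (S.PA (t - s) (S.nonlin (x (max s 0)))) :=
      (((hS.THe α : H ≃L[ℝ] H) : H →L[ℝ] H).intervalIntegral_comp_comm i2).symm
    rw [e2, ← intervalIntegral.integral_add i1 i3]
    refine intervalIntegral.integral_congr fun s hs => ?_
    rw [uIcc_of_le ht] at hs
    rw [hS.nonlin_shift, map_add, hS.PA_TH α (sub_nonneg.2 hs.2), max_eq_left hs.1]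
  beta_reduce
  rw [e1, hx.2 t ht, integral_congr_max ht]
  simp only [shift, hS.TH_add, map_add, hS.PA_TH α ht]
  conv_lhs => rw [← hS.PA_shape α ht]
  abel

theorem flow_shift (hS : S.Assumptions b) (hΦ : IsMildFlow S.PA S.nonlin Φ) (α : Phase m) (v : H)
    {t : ℝ} (ht : 0 ≤ t) : Φ t (S.shift α v) = S.shift α (Φ t v) :=
  (hΦ.unique _ _ (hS.isMild_shift α (hΦ.mild v)) t ht).symm

theorem flow_zero (hS : S.Assumptions b) (hΦ : IsMildFlow S.PA S.nonlin Φ) {t : ℝ} (ht : 0 ≤ t) :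
    Φ t 0 = 0 := by
  refine (hΦ.unique 0 (fun _ => 0) ⟨continuousOn_const, fun t _ => ?_⟩ t ht).symm
  simp [hS.nonlin_zero]

theorem flow_shape (hS : S.Assumptions b) (hΦ : IsMildFlow S.PA S.nonlin Φ) (η : Phase m)
    {t : ℝ} (ht : 0 ≤ t) : Φ t (S.shape η) = S.shape η := by
  rw [← hS.shift_zero_right, hS.flow_shift hΦ η 0 ht, hS.flow_zero hΦ ht]

end Flow
end Assumptions
end PatternSystem

/-! ### The phase map near the reference pattern and its second derivative -/

namespace PatternSystem
variable {m : ℕ} {H X : Type*} [NormedAddCommGroup H] [InnerProductSpace ℝ H] [CompleteSpace H]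
  [AddCommGroup X] [Module ℝ X]

/-- The `i`-th component of the second derivative of the isochronal phase at `φ_α`. -/
noncomputable def secondOrder (S : PatternSystem m H X) (i : Fin m) (α : Phase m) (w : H) : ℝ :=
  2 * ∑ j : Fin m, inner ℝ (S.ψ j α) w * inner ℝ (S.dψ i j α) w
    - ∑ j : Fin m, ∑ k : Fin m,
        inner ℝ (S.dφ j α) (S.dψ i k α) * inner ℝ (S.ψ j α) w * inner ℝ (S.ψ k α) w
    + ∫ s in Ioi (0 : ℝ), inner ℝ (S.ψ i α) (S.D2f α (S.V α s w) (S.V α s w))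

/-- `Θ` is a phase map on the ball of radius `r` around the pattern `φ₀`. -/
structure IsLocalPhase (S : PatternSystem m H X) (Θ : H → Phase m) (r C : ℝ) : Prop where
  r_pos : 0 < r
  C_nonneg : 0 ≤ C
  contDiffOn : ContDiffOn ℝ 2 Θ (Metric.ball 0 r)
  norm_le : ∀ x ∈ Metric.ball (0 : H) r, ‖Θ x‖ ≤ C * ‖x‖
  convergesTo : ∀ x ∈ Metric.ball (0 : H) r, S.ConvergesTo x (Θ x)
  fderiv_sub_le : ∀ x ∈ Metric.ball (0 : H) r, Θ x = 0 → ∀ (w : H) (i : Fin m),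
    |(fderiv ℝ Θ x w) i - inner ℝ (S.ψ i 0) w| ≤ C * ‖x‖ * ‖w‖
  fderiv_fderiv_sub_le : ∀ x ∈ Metric.ball (0 : H) r, Θ x = 0 → ∀ (w : H) (i : Fin m),
    |(fderiv ℝ (fderiv ℝ Θ) x w w) i - S.secondOrder i 0 w| ≤ C * ‖x‖ * ‖w‖ ^ 2

namespace Assumptions
variable {S : PatternSystem m H X} {b : ℝ} {Φ : ℝ → H → H}

theorem exists_shape_injOn (hS : S.Assumptions b) :
    ∃ ρ > 0, ∀ η ∈ Metric.ball (0 : Phase m) ρ, ∀ η' ∈ Metric.ball (0 : Phase m) ρ,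
      S.shape η = S.shape η' → η = η' := by
  obtain ⟨k, -, hk⟩ := exists_contDiffAt_leftInverse (l := S.modes) hS.φ_smooth hS.shape_zero
    hS.modes_fderiv_shape
  obtain ⟨ρ, hρ, hkρ⟩ := Metric.eventually_nhds_iff_ball.1 hk
  refine ⟨ρ, hρ, fun η h η' h' e => ?_⟩
  rw [← hkρ η h, ← hkρ η' h', e]

theorem iterate_flow (hS : S.Assumptions b) (hΦ : IsMildFlow (S.U 0) hS.remainder Φ)
    {T : ℝ} (hT : 0 ≤ T) (n : ℕ) (x : H) : (Φ T)^[n] x = Φ (n * T) x := by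
  induction n with
  | zero => simp [hΦ.apply_zero (hS.isC0_U 0)]
  | succ n ih =>
    rw [Function.iterate_succ_apply', ih, ← hΦ.apply_add (hS.isC0_U 0) (by positivity) hT]
    congr 1; push_cast; ring

/-- Between consecutive multiples of `T` the orbit stays near the limiting pattern, by continuity of
the flow on `[0, T]` at this fixed point, uniformly in time. -/
theorem tendsto_flow_of_nat (hS : S.Assumptions b) (hΦ : IsMildFlow (S.U 0) hS.remainder Φ)
    (hΦ' : IsMildFlow S.PA S.nonlin Φ) {T : ℝ} (hT : 0 < T) {x : H} {η : Phase m}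
    (h : Tendsto (fun n : ℕ => Φ (n * T) x) atTop (𝓝 (S.shape η))) :
    Tendsto (fun t => Φ t x) atTop (𝓝 (S.shape η)) := by
  obtain ⟨K, hK⟩ := hS.exists_lipschitzWith_remainder
  rw [Metric.tendsto_nhds]
  intro ε hε
  have h1 := h.eventually (hΦ.eventually_forall_dist_lt (hS.isC0_U 0) hS.contDiff_remainder hK
    hT.le (S.shape η) hε)
  have h2 : Tendsto (fun t : ℝ => ⌊t / T⌋₊) atTop atTop :=
    tendsto_nat_floor_atTop.comp (tendsto_id.atTop_div_const hT)
  filter_upwards [h2.eventually h1, eventually_ge_atTop (0 : ℝ)] with t ht ht0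
  have hn : (⌊t / T⌋₊ : ℝ) * T ≤ t := by
    rw [← le_div_iff₀ hT]; exact Nat.floor_le (by positivity)
  have hn' : t < (⌊t / T⌋₊ + 1 : ℝ) * T := by
    rw [← div_lt_iff₀ hT]; exact Nat.lt_floor_add_one _
  have hs : t - ⌊t / T⌋₊ * T ∈ Icc (0 : ℝ) T := ⟨by linarith, by linarith⟩
  have := ht _ hs
  rwa [← hΦ.apply_add (hS.isC0_U 0) (by positivity) hs.1, add_sub_cancel,
    hS.flow_shape hΦ' η hs.1] at this

theorem integrableOn_secondOrder (hS : S.Assumptions b) (e : HilbertBasis ℕ ℝ H) (i : Fin m)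
    (w : H) : MeasureTheory.IntegrableOn
      (fun s : ℝ => inner ℝ (S.ψ i 0) (S.D2f 0 (S.V 0 s w) (S.V 0 s w))) (Ioi 0) := by
  obtain ⟨C, c, hC, hc, hV⟩ := hS.exists_V_decay e
  have hcV : ContinuousOn (fun s => S.V 0 s w) (Ioi 0) := by
    have : ContinuousOn (fun s => S.U 0 s w - S.proj 0 w) (Ioi 0) :=
      (((hS.isC0_U 0).cont w).mono Ioi_subset_Ici_self).sub continuousOn_const
    exact this
  have hcont : ContinuousOn
      (fun s : ℝ => (inner ℝ (S.ψ i 0) (S.D2f 0 (S.V 0 s w) (S.V 0 s w)) : ℝ)) (Ioi 0) := by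
    have h1 : ContinuousOn (fun s => S.D2f 0 (S.V 0 s w)) (Ioi 0) :=
      (S.D2f 0).continuous.comp_continuousOn hcV
    exact continuousOn_const.inner (h1.clm_apply hcV)
  refine MeasureTheory.Integrable.mono' ((exp_neg_integrableOn_Ioi 0 hc).const_mul
    (‖S.ψ i 0‖ * (‖S.D2f 0‖ * (C * ‖w‖) * (C * ‖w‖))))
    (hcont.aestronglyMeasurable measurableSet_Ioi) ?_
  filter_upwards [MeasureTheory.ae_restrict_mem measurableSet_Ioi] with s hs
  have hs0 : (0 : ℝ) ≤ s := le_of_lt hs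
  have h1 : ‖S.V 0 s w‖ ≤ C * Real.exp (-c * s) * ‖w‖ :=
    (ContinuousLinearMap.le_opNorm _ _).trans (by gcongr; exact hV s hs0)
  have h2 : Real.exp (-c * s) ≤ 1 := Real.exp_le_one_iff.2 (by nlinarith)
  have h3 : ‖S.V 0 s w‖ ≤ C * ‖w‖ := by
    refine h1.trans ?_
    calc _ ≤ C * 1 * ‖w‖ := by gcongr
      _ = _ := by ring
  calc _ ≤ ‖S.ψ i 0‖ * (‖S.D2f 0‖ * ‖S.V 0 s w‖ * ‖S.V 0 s w‖) := by
        refine (norm_inner_le_norm _ _).trans ?_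
        gcongr
        exact ContinuousLinearMap.le_opNorm₂ _ _ _
    _ ≤ ‖S.ψ i 0‖ * (‖S.D2f 0‖ * (C * ‖w‖) * (C * Real.exp (-c * s) * ‖w‖)) := by gcongr
    _ = _ := by ring

section Formula
variable {Θ : H → Phase m} {r C T : ℝ}

/-- The second derivative of the phase map in stable directions. -/
theorem fderiv_fderiv_phase_stable (hS : S.Assumptions b) (e : HilbertBasis ℕ ℝ H)
    (hΦ : IsMildFlow (S.U 0) hS.remainder Φ) (hΦ' : IsMildFlow S.PA S.nonlin Φ) (hT : 0 < T)
    (hΘ : ContDiffAt ℝ 2 Θ 0) (hl : fderiv ℝ Θ 0 = S.modes)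
    (hinv : ∀ n : ℕ, ∀ᶠ x in 𝓝 0, Θ (Φ (n * T) x) = Θ x) (i : Fin m) (w : H) :
    (fderiv ℝ (fderiv ℝ Θ) 0 (w - S.proj 0 w) (w - S.proj 0 w)) i =
      ∫ s in Ioi (0 : ℝ), inner ℝ (S.ψ i 0) (S.D2f 0 (S.V 0 s w) (S.V 0 s w)) := by
  obtain ⟨K, hK⟩ := hS.exists_lipschitzWith_remainder
  obtain ⟨C, c, hC, hc, hV⟩ := hS.exists_V_decay e
  set B := fderiv ℝ (fderiv ℝ Θ) 0 with hB
  set ws := w - S.proj 0 w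
  have hUV : ∀ t, 0 ≤ t → S.U 0 t ws = S.V 0 t w := fun t ht => (hS.V_zero_apply ht w).symm
  -- Second derivative at `0` of the identity `Θ ∘ Φ = Θ` at time `n * T`. The first-order term is
  -- the modes of a Duhamel integral, and the modes do not see the outer semigroup `U₀(nT - s)`. As
  -- `n → ∞` the stable direction decays and only the integral is left.
  have key : ∀ n : ℕ, (B ws ws) i = (B (S.V 0 (n * T) w) (S.V 0 (n * T) w)) i
      + ∫ s in (0 : ℝ)..n * T, inner ℝ (S.ψ i 0) (S.D2f 0 (S.V 0 s w) (S.V 0 s w)) := by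
    intro n
    have ht : 0 ≤ n * T := by positivity
    have hΦ0 := hS.flow_zero hΦ' ht
    obtain ⟨f1, f2⟩ := hΦ.fderiv_at_zero (hS.isC0_U 0) hS.contDiff_remainder hK hS.remainder_zero
      hS.fderiv_remainder_zero ht
    have hc3 := hΦ.contDiff (hS.isC0_U 0) hS.contDiff_remainder hK ht
    have hev : (fun x => Θ (Φ (n * T) x)) =ᶠ[𝓝 0] Θ := hinv n
    have h1 := fderiv_fderiv_comp (f := Θ) (F := Φ (n * T)) (x := 0) (by rwa [hΦ0])
      (hc3.of_le (by norm_num)).contDiffAt ws ws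
    rw [hev.fderiv.fderiv_eq, hΦ0, f1, f2, hl, hS.fderiv_fderiv_remainder_zero, ← hB] at h1
    rw [h1, hUV _ ht, PiLp.add_apply, modes_apply]
    congr 1
    have hcV : Continuous fun s => S.U 0 (max s 0) ws := (hS.isC0_U 0).continuous_apply ws
    have hcD : Continuous fun s => S.D2f 0 (S.U 0 (max s 0) ws) (S.U 0 (max s 0) ws) :=
      ((S.D2f 0).continuous.comp hcV).clm_apply hcV
    have hci : Continuous fun s => S.U 0 (max (n * T - s) 0)
        (S.D2f 0 (S.U 0 (max s 0) ws) (S.U 0 (max s 0) ws)) :=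
      (hS.isC0_U 0).continuous_comp (by fun_prop) hcD
    have hI : IntervalIntegrable (fun s => S.U 0 (n * T - s) (S.D2f 0 (S.U 0 s ws) (S.U 0 s ws)))
        MeasureTheory.volume 0 (n * T) := by
      refine ContinuousOn.intervalIntegrable (hci.continuousOn.congr fun s hs => ?_)
      rw [uIcc_of_le ht] at hs
      simp only [max_eq_left (sub_nonneg.2 hs.2), max_eq_left hs.1]
    have := (innerSL ℝ (S.ψ i 0)).intervalIntegral_comp_comm hI
    simp only [innerSL_apply_apply] at this
    rw [← this]
    refine intervalIntegral.integral_congr fun s hs => ?_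
    rw [uIcc_of_le ht] at hs
    beta_reduce
    rw [← modes_apply, hS.modes_U (sub_nonneg.2 hs.2), modes_apply, hUV s hs.1]
  have hTn : Tendsto (fun n : ℕ => (n : ℝ) * T) atTop atTop :=
    tendsto_natCast_atTop_atTop.atTop_mul_const hT
  have hexp : Tendsto (fun n : ℕ => C * Real.exp (-c * (n * T)) * ‖w‖) atTop (𝓝 0) := by
    have h1 : Tendsto (fun n : ℕ => Real.exp (-c * (n * T))) atTop (𝓝 0) := by
      refine Real.tendsto_exp_atBot.comp ?_
      exact (tendsto_const_mul_atBot_of_neg (neg_lt_zero.2 hc)).2 hTn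
    simpa using (h1.const_mul C).mul_const ‖w‖
  have hVl : Tendsto (fun n : ℕ => S.V 0 (n * T) w) atTop (𝓝 0) :=
    squeeze_zero_norm (fun n => (ContinuousLinearMap.le_opNorm _ _).trans (by
      gcongr; exact hV _ (by positivity))) hexp
  have hBl : Tendsto (fun n : ℕ => (B (S.V 0 (n * T) w) (S.V 0 (n * T) w)) i) atTop (𝓝 0) := by
    have hc : Continuous fun v : H => (B v v) i := by
      have h1 : Continuous fun v : H => B v v := B.continuous.clm_apply continuous_id
      exact (EuclideanSpace.proj (𝕜 := ℝ) i).continuous.comp h1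
    have := (hc.tendsto 0).comp hVl
    simpa [Function.comp_def] using this
  have hIl := MeasureTheory.intervalIntegral_tendsto_integral_Ioi 0
    (hS.integrableOn_secondOrder e i w) hTn
  have := hBl.add hIl
  rw [zero_add] at this
  exact tendsto_nhds_unique (tendsto_const_nhds.congr key) this

/-- The first derivative of the phase map along the manifold of patterns. -/
theorem fderiv_phase_shape (hS : S.Assumptions b) (hr : 0 < r)
    (hΘ : ContDiffOn ℝ 2 Θ (Metric.ball 0 r)) (hl : fderiv ℝ Θ 0 = S.modes)
    (hΘn : ∀ x ∈ Metric.ball (0 : H) r, ‖Θ x‖ ≤ C * ‖x‖)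
    (hΘc : ∀ x ∈ Metric.ball (0 : H) r, S.ConvergesTo x (Θ x)) :
    ∀ᶠ α in 𝓝 (0 : Phase m), ∀ w i, (fderiv ℝ Θ (S.shape α) w) i = inner ℝ (S.ψ i α) w := by
  obtain ⟨Φ, -, hΦ⟩ := hS.exists_flow
  obtain ⟨ρ, hρ, hinj⟩ := hS.exists_shape_injOn
  have hΘat : ∀ x ∈ Metric.ball (0 : H) r, ContDiffAt ℝ 2 Θ x := fun x hx =>
    hΘ.contDiffAt (Metric.isOpen_ball.mem_nhds hx)
  have h0 : (0 : H) ∈ Metric.ball (0 : H) r := Metric.mem_ball_self hr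
  have hΘ0 : Θ 0 = 0 := by simpa using hΘn 0 h0
  have hsc : Tendsto S.shape (𝓝 0) (𝓝 0) := by
    have := hS.differentiable_shape.continuous.tendsto 0; rwa [hS.shape_zero] at this
  have hΘs : Tendsto (fun α => Θ (S.shape α)) (𝓝 0) (𝓝 0) := by
    have := (hΘat 0 h0).continuousAt.tendsto
    rw [hΘ0] at this
    exact this.comp hsc
  filter_upwards [Metric.ball_mem_nhds 0 hρ, hsc (Metric.ball_mem_nhds 0 hr),
    hΘs (Metric.ball_mem_nhds 0 hρ)] with α hα hαr hΘα w i
  have hτ : Tendsto (S.shift α) (𝓝 0) (𝓝 (S.shape α)) := by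
    have := (hS.contDiff_shift α (n := 0)).continuous.tendsto 0
    rwa [hS.shift_zero_right] at this
  -- Both sides are phases of the same point by equivariance of the flow; they coincide because both
  -- lie where `shape` is injective.
  have hev : (fun v => Θ (S.shift α v)) =ᶠ[𝓝 0] fun v => α + Θ v := by
    have h1 : ∀ᶠ v in 𝓝 (0 : H), S.shift α v ∈ Metric.ball (0 : H) r :=
      hτ (Metric.isOpen_ball.mem_nhds hαr)
    have h2 : ∀ᶠ v in 𝓝 (0 : H), Θ (S.shift α v) ∈ Metric.ball (0 : Phase m) ρ :=
      ((hΘat _ hαr).continuousAt.tendsto.comp hτ) (Metric.isOpen_ball.mem_nhds hΘα)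
    have h3 : ∀ᶠ v in 𝓝 (0 : H), α + Θ v ∈ Metric.ball (0 : Phase m) ρ := by
      have : Tendsto (fun v => α + Θ v) (𝓝 0) (𝓝 (α + Θ 0)) :=
        (hΘat 0 h0).continuousAt.tendsto.const_add α
      rw [hΘ0, add_zero] at this
      exact this (Metric.isOpen_ball.mem_nhds hα)
    filter_upwards [h1, h2, h3, Metric.ball_mem_nhds (0 : H) hr] with v v1 v2 v3 v4
    refine hinj _ v2 _ v3 (tendsto_nhds_unique ((convergesTo_iff hΦ).1 (hΘc _ v1)) ?_)
    rw [← hS.shift_shape]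
    have h5 := ((hS.contDiff_shift α (n := 0)).continuous.tendsto _).comp
      ((convergesTo_iff hΦ).1 (hΘc _ v4))
    refine h5.congr' ?_
    filter_upwards [eventually_ge_atTop (0 : ℝ)] with t ht
      using (hS.flow_shift hΦ α v ht).symm
  have h1 : HasFDerivAt (fun v => Θ (S.shift α v))
      ((fderiv ℝ Θ (S.shape α)).comp ((hS.THe α : H ≃L[ℝ] H) : H →L[ℝ] H)) 0 := by
    have : HasFDerivAt Θ (fderiv ℝ Θ (S.shape α)) (S.shift α 0) := by
      rw [hS.shift_zero_right]
      exact ((hΘat _ hαr).differentiableAt (by norm_num)).hasFDerivAt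
    exact this.comp 0 (hS.hasFDerivAt_shift α 0)
  have h2 : HasFDerivAt (fun v => Θ (S.shift α v)) S.modes 0 := by
    have : HasFDerivAt Θ S.modes 0 := by
      rw [← hl]; exact ((hΘat _ h0).differentiableAt (by norm_num)).hasFDerivAt
    have h : HasFDerivAt (fun v => α + Θ v) S.modes 0 := this.const_add α
    exact h.congr_of_eventuallyEq hev
  have h3 := DFunLike.congr_fun (h1.unique h2) (S.TH (-α) w)
  have h4 : S.TH α (S.TH (-α) w) = w := (hS.THe α).apply_symm_apply w
  have h5 : fderiv ℝ Θ (S.shape α) (S.TH α (S.TH (-α) w)) = S.modes (S.TH (-α) w) := h3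
  rw [h4] at h5
  rw [h5, modes_apply, ← hS.inner_TH α, h4, ← hS.ψ_T]

/-- The derivative in `α` of the identity `DΘ(φ_α) w = ⟨ψ_α, w⟩`, by the chain rule on one side and
directly on the other. -/
theorem fderiv_fderiv_phase_center (hS : S.Assumptions b) (hΘ : ContDiffAt ℝ 2 Θ 0)
    (h : ∀ᶠ α in 𝓝 (0 : Phase m), ∀ w i, (fderiv ℝ Θ (S.shape α) w) i = inner ℝ (S.ψ i α) w)
    (η : Phase m) (w : H) (i : Fin m) :
    (fderiv ℝ (fderiv ℝ Θ) 0 (fderiv ℝ S.shape 0 η) w) i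
      = ∑ j, η j * inner ℝ (S.dψ i j 0) w := by
  have hd : HasFDerivAt (fderiv ℝ Θ) (fderiv ℝ (fderiv ℝ Θ) 0) (S.shape 0) := by
    rw [hS.shape_zero]
    exact ((hΘ.fderiv_right (m := 1) (by norm_num)).differentiableAt (by norm_num)).hasFDerivAt
  have h1 : HasFDerivAt (fun α => fderiv ℝ Θ (S.shape α) w) _ 0 :=
    (hd.comp 0 (hS.differentiable_shape 0).hasFDerivAt).apply_const w
  have h2 : HasFDerivAt (fun α => (fderiv ℝ Θ (S.shape α) w) i) _ 0 :=
    (EuclideanSpace.proj (𝕜 := ℝ) i : Phase m →L[ℝ] ℝ).hasFDerivAt.comp 0 h1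
  have h3 : HasFDerivAt (fun α => (fderiv ℝ Θ (S.shape α) w) i)
      ((innerSL ℝ w).comp (fderiv ℝ (S.ψ i) 0)) 0 := by
    refine ((innerSL ℝ w).hasFDerivAt.comp 0
      (hS.differentiable_ψ i 0).hasFDerivAt).congr_of_eventuallyEq ?_
    filter_upwards [h] with α hα
    rw [hα w i, real_inner_comm]; rfl
  have h4 := DFunLike.congr_fun (h2.unique h3) η
  refine Eq.trans h4 ?_
  change inner ℝ w (fderiv ℝ (S.ψ i) 0 η) = _
  conv_lhs => rw [Phase_eq_sum η, map_sum, inner_sum]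
  refine Finset.sum_congr rfl fun j _ => ?_
  rw [map_smul, inner_smul_right, real_inner_comm]; rfl

/-- With `c = P₀ w`, symmetry of the second derivative `B` gives `B w w = B (w - c) (w - c) + 2 B c
w - B c c`. The three terms are the integral, the single sum with its factor `2`, and the double sum
with its minus sign. -/
theorem fderiv_fderiv_phase_zero (hS : S.Assumptions b) (hΘ : ContDiffAt ℝ 2 Θ 0)
    (h : ∀ᶠ α in 𝓝 (0 : Phase m), ∀ w i, (fderiv ℝ Θ (S.shape α) w) i = inner ℝ (S.ψ i α) w)
    (i : Fin m) (w : H)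
    (hs : (fderiv ℝ (fderiv ℝ Θ) 0 (w - S.proj 0 w) (w - S.proj 0 w)) i =
      ∫ s in Ioi (0 : ℝ), inner ℝ (S.ψ i 0) (S.D2f 0 (S.V 0 s w) (S.V 0 s w))) :
    (fderiv ℝ (fderiv ℝ Θ) 0 w w) i = S.secondOrder i 0 w := by
  have hsym : IsSymmSndFDerivAt ℝ Θ 0 := hΘ.isSymmSndFDerivAt (by simp)
  set B := fderiv ℝ (fderiv ℝ Θ) 0
  set c := S.proj 0 w with hc
  have hcw : ∀ v, (B c v) i = ∑ j, inner ℝ (S.ψ j 0) w * inner ℝ (S.dψ i j 0) v := by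
    intro v
    rw [hc, proj_zero_apply]
    exact hS.fderiv_fderiv_phase_center hΘ h _ v i
  have e1 : B w w = B (w - c) (w - c) + (2 : ℝ) • B c w - B c c := by
    have : B w c = B c w := hsym w c
    simp only [map_sub, sub_apply, this, two_smul]
    abel
  have e2 : (B c c) i = ∑ j : Fin m, ∑ k : Fin m,
        inner ℝ (S.dφ j 0) (S.dψ i k 0) * inner ℝ (S.ψ j 0) w * inner ℝ (S.ψ k 0) w := by
    rw [hcw c, Finset.sum_comm]
    refine Finset.sum_congr rfl fun k _ => ?_
    rw [hc, proj_apply, inner_sum, Finset.mul_sum]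
    refine Finset.sum_congr rfl fun j _ => ?_
    rw [inner_smul_right, real_inner_comm (S.dψ i k 0)]
    ring
  rw [e1, PiLp.sub_apply, PiLp.add_apply, PiLp.smul_apply, hs, hcw w, e2, secondOrder, smul_eq_mul]
  ring

end Formula

theorem exists_isLocalPhase (hS : S.Assumptions b) (e : HilbertBasis ℕ ℝ H) :
    ∃ (Θ : H → Phase m) (r C : ℝ), S.IsLocalPhase Θ r C := by
  obtain ⟨Φ, hΦ, hΦ'⟩ := hS.exists_flow
  obtain ⟨K, hK⟩ := hS.exists_lipschitzWith_remainder
  obtain ⟨K', hK'⟩ := hS.exists_lipschitzWith_fderiv_fderiv_shape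
  obtain ⟨C₀, c, hC₀, hc, hV⟩ := hS.exists_V_decay e
  have hproj : S.proj 0 = (fderiv ℝ S.shape 0).comp S.modes := by
    ext w; exact S.proj_zero_apply w
  -- The time `T` is taken so long that the stable part of the linearized flow has norm at most
  -- `1/4`; the time-`T` map then satisfies the hypotheses of `exists_isochron_map`.
  obtain ⟨T, hT, hT4⟩ : ∃ T : ℝ, 0 < T ∧ ‖S.U 0 T - (fderiv ℝ S.shape 0).comp S.modes‖ ≤ 1 / 4 := by
    have h1 : Tendsto (fun t => C₀ * Real.exp (-c * t)) atTop (𝓝 0) := by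
      have h1 : Tendsto (fun t => Real.exp (-c * t)) atTop (𝓝 0) := by
        refine Real.tendsto_exp_atBot.comp ?_
        exact (tendsto_const_mul_atBot_of_neg (neg_lt_zero.2 hc)).2 tendsto_id
      simpa using h1.const_mul C₀
    obtain ⟨T, h2, h3⟩ := ((h1.eventually_lt_const (by norm_num : (0 : ℝ) < 1 / 4)).and
      (eventually_gt_atTop 0)).exists
    refine ⟨T, h3, ?_⟩
    rw [← hproj]
    exact (hV T h3.le).trans h2.le
  have hF := hΦ.contDiff (hS.isC0_U 0) hS.contDiff_remainder hK hT.le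
  have hF1 := (hΦ.fderiv_at_zero (hS.isC0_U 0) hS.contDiff_remainder hK hS.remainder_zero
      hS.fderiv_remainder_zero hT.le).1
  obtain ⟨r, hr, C, hC, Θ, hΘ, hl, hΘx, -, hinv, hleaf⟩ := exists_isochron_map hF hS.φ_smooth hK'
    hS.shape_zero (fun η => hS.flow_shape hΦ' η hT.le) hS.modes_fderiv_shape
    (fun x => by rw [hF1, hS.modes_U hT.le]) (by rwa [hF1])
  have hconv : ∀ x ∈ Metric.ball (0 : H) r, S.ConvergesTo x (Θ x) := by
    intro x hx
    rw [convergesTo_iff hΦ']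
    refine hS.tendsto_flow_of_nat hΦ hΦ' hT ?_
    rw [tendsto_iff_norm_sub_tendsto_zero]
    have hg : Tendsto (fun n => (1 / 2 : ℝ) ^ n) atTop (𝓝 0) :=
      tendsto_pow_atTop_nhds_zero_of_lt_one (by norm_num) (by norm_num)
    have hg' : Tendsto (fun n => C * (1 / 2 : ℝ) ^ n * ‖x‖) atTop (𝓝 0) := by
      simpa using (hg.const_mul C).mul_const ‖x‖
    refine squeeze_zero (fun _ => norm_nonneg _) (fun n => ?_) hg'
    rw [← hS.iterate_flow hΦ hT.le]
    exact (hΘx x hx).2 n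
  have hat : ContDiffAt ℝ 2 Θ 0 := hΘ.contDiffAt (Metric.ball_mem_nhds 0 hr)
  have hshape := hS.fderiv_phase_shape hr hΘ hl (fun x hx => (hΘx x hx).1) hconv
  have hinv' : ∀ n : ℕ, ∀ᶠ x in 𝓝 0, Θ (Φ (n * T) x) = Θ x := by
    intro n
    filter_upwards [hinv n] with x hx
    rwa [hS.iterate_flow hΦ hT.le] at hx
  refine ⟨Θ, r, C, hr, hC, hΘ, fun x hx => (hΘx x hx).1, hconv, fun x hx h0 w i => ?_,
    fun x hx h0 w i => ?_⟩
  · have h1 := (hleaf x hx h0).1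
    rw [← modes_apply, ← PiLp.sub_apply, ← sub_apply, ← Real.norm_eq_abs]
    refine (PiLp.norm_apply_le _ i).trans ((ContinuousLinearMap.le_opNorm _ _).trans ?_)
    gcongr
  · have h1 := (hleaf x hx h0).2 w
    rw [← hS.fderiv_fderiv_phase_zero hat hshape i w
      (hS.fderiv_fderiv_phase_stable e hΦ hΦ' hT hat hl hinv' i w), ← PiLp.sub_apply,
      ← Real.norm_eq_abs]
    exact (PiLp.norm_apply_le _ i).trans h1

end Assumptions
end PatternSystem

/-! ### Trace-type series -/

section Trace
variable {H : Type*} [NormedAddCommGroup H] [InnerProductSpace ℝ H]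
  {Y : Type*} [NormedAddCommGroup Y] [NormedSpace ℝ Y] [CompleteSpace Y]
  {B : H → H →L[ℝ] H} {e : HilbertBasis ℕ ℝ H}

theorem eventually_tsum_sq_le
    (htail : Tendsto (fun M : ℕ => ⨆ u : H, ∑' j : ℕ, ‖B u (e (M + j))‖ₑ ^ 2) atTop (𝓝 0))
    {ε : ℝ} (hε : 0 < ε) : ∀ᶠ M : ℕ in atTop, ∀ u, Summable (fun j => ‖B u (e (M + j))‖ ^ 2) ∧
      ∑' j, ‖B u (e (M + j))‖ ^ 2 ≤ ε := by
  filter_upwards [htail.eventually_lt_const (ENNReal.ofReal_pos.2 hε)] with M hM u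
  have h1 : ∑' j : ℕ, ‖B u (e (M + j))‖ₑ ^ 2 ≤ ENNReal.ofReal ε :=
    (le_iSup (fun u : H => ∑' j : ℕ, ‖B u (e (M + j))‖ₑ ^ 2) u).trans hM.le
  have h2 : ∑' j : ℕ, ‖B u (e (M + j))‖ₑ ^ 2 ≠ ⊤ := ne_top_of_le_ne_top ENNReal.ofReal_ne_top h1
  have h3 : ∀ j, (‖B u (e (M + j))‖ₑ ^ 2).toReal = ‖B u (e (M + j))‖ ^ 2 := fun j => by simp
  constructor
  · simpa only [h3] using ENNReal.summable_toReal h2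
  · have h4 := ENNReal.tsum_toReal_eq (f := fun j : ℕ => ‖B u (e (M + j))‖ₑ ^ 2)
      (fun j => by simp)
    simp only [h3] at h4
    rw [← h4]
    exact ENNReal.toReal_le_of_le_ofReal hε.le h1

theorem summable_trace
    (htail : Tendsto (fun M : ℕ => ⨆ u : H, ∑' j : ℕ, ‖B u (e (M + j))‖ₑ ^ 2) atTop (𝓝 0))
    (D : H →L[ℝ] H →L[ℝ] Y) (u : H) : Summable fun j => D (B u (e j)) (B u (e j)) := by
  obtain ⟨M, hM⟩ := (eventually_tsum_sq_le htail one_pos).exists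
  have h1 : Summable fun j => ‖B u (e (j + M))‖ ^ 2 := by
    simpa only [add_comm] using (hM u).1
  have h2 : Summable fun j => ‖B u (e j)‖ ^ 2 :=
    (summable_nat_add_iff (f := fun j => ‖B u (e j)‖ ^ 2) M).1 h1
  refine Summable.of_norm_bounded (h2.mul_left ‖D‖) fun j => ?_
  refine (D.le_opNorm₂ _ _).trans_eq ?_
  ring

/-- The partial sums are continuous, and they converge uniformly on `W` because the tails of `∑ ‖B u
e_j‖²` are small uniformly in `u` while `D` is bounded on `W`. -/
theorem continuousOn_trace
    (htail : Tendsto (fun M : ℕ => ⨆ u : H, ∑' j : ℕ, ‖B u (e (M + j))‖ₑ ^ 2) atTop (𝓝 0))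
    (hB : Continuous B) {W : Set H} {D : H → H →L[ℝ] H →L[ℝ] Y} (hD : ContinuousOn D W) {K : ℝ}
    (hK : ∀ u ∈ W, ‖D u‖ ≤ K) :
    ContinuousOn (fun u => ∑' j, D u (B u (e j)) (B u (e j))) W := by
  have hu : TendstoUniformlyOn
      (fun (M : ℕ) u => ∑ j ∈ Finset.range M, D u (B u (e j)) (B u (e j)))
      (fun u => ∑' j, D u (B u (e j)) (B u (e j))) atTop W := by
    rw [Metric.tendstoUniformlyOn_iff]
    intro ε hε
    have hK1 : 0 < |K| + 1 := by positivity
    filter_upwards [eventually_tsum_sq_le htail (div_pos hε (mul_pos two_pos hK1))] with M hM u huW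
    have hs := summable_trace htail (D u) u
    rw [dist_eq_norm, ← hs.sum_add_tsum_nat_add M, add_sub_cancel_left]
    have hb : ∀ j, ‖D u (B u (e (j + M))) (B u (e (j + M)))‖ ≤ (|K| + 1) * ‖B u (e (M + j))‖ ^ 2 := by
      intro j
      rw [add_comm j M]
      refine ((D u).le_opNorm₂ _ _).trans ?_
      rw [mul_assoc, ← pow_two]
      gcongr
      exact (hK u huW).trans ((le_abs_self K).trans (by linarith))
    have h1 := tsum_of_norm_bounded ((hM u).1.mul_left (|K| + 1)).hasSum hb
    rw [tsum_mul_left] at h1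
    refine h1.trans_lt ?_
    calc (|K| + 1) * ∑' j, ‖B u (e (M + j))‖ ^ 2 ≤ (|K| + 1) * (ε / (2 * (|K| + 1))) := by
          gcongr; exact (hM u).2
      _ = ε / 2 := by field_simp
      _ < ε := by linarith
  refine hu.continuousOn (Frequently.of_forall fun M => continuousOn_finsetSum _ fun j _ => ?_)
  have hBj : ContinuousOn (fun u => B u (e j)) W := (hB.clm_apply continuous_const).continuousOn
  exact (hD.clm_apply hBj).clm_apply hBj

end Trace

/-! ### Transport along the manifold and determinations of the phase -/

namespace PatternSystem
variable {m : ℕ} {H X : Type*} [NormedAddCommGroup H] [InnerProductSpace ℝ H] [CompleteSpace H]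
  [AddCommGroup X] [Module ℝ X]

/-- The phase map near `φ_η` that takes values near `η`, transported from `φ₀`. -/
noncomputable def localPhase (S : PatternSystem m H X) (Θ : H → Phase m) (η : Phase m) (v : H) :
    Phase m :=
  η + Θ (S.shift (-η) v)

/-- A local phase map whose values lie where the patterns are determined by their phase. -/
structure IsUniqueLocalPhase (S : PatternSystem m H X) (Θ : H → Phase m) (r C ρ : ℝ) : Prop
    extends S.IsLocalPhase Θ r C where
  ρ_pos : 0 < ρ
  mem_ball : ∀ x ∈ Metric.ball (0 : H) r, Θ x ∈ Metric.ball (0 : Phase m) ρ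
  injOn : ∀ η ∈ Metric.ball (0 : Phase m) ρ, ∀ η' ∈ Metric.ball (0 : Phase m) ρ,
    S.shape η = S.shape η' → η = η'

namespace Assumptions
variable {S : PatternSystem m H X} {b : ℝ}

theorem shape_eq_of_convergesTo (hS : S.Assumptions b) {v : H} {η η' : Phase m}
    (h : S.ConvergesTo v η) (h' : S.ConvergesTo v η') : S.shape η = S.shape η' := by
  obtain ⟨Φ, -, hΦ⟩ := hS.exists_flow
  exact tendsto_nhds_unique ((convergesTo_iff hΦ).1 h) ((convergesTo_iff hΦ).1 h')

theorem convergesTo_shift (hS : S.Assumptions b) (α : Phase m) {v : H} {η : Phase m}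
    (h : S.ConvergesTo v η) : S.ConvergesTo (S.shift α v) (α + η) := by
  obtain ⟨x, hx, h⟩ := h
  refine ⟨fun t => S.shift α (x t), hS.isMild_shift α hx, ?_⟩
  rw [← hS.shift_shape]
  exact ((hS.contDiff_shift α (n := 0)).continuous.tendsto _).comp h

theorem convergesTo_congr {v : H} {η η' : Phase m}
    (h : S.shape η = S.shape η') (hv : S.ConvergesTo v η) : S.ConvergesTo v η' := by
  obtain ⟨x, hx, hl⟩ := hv
  exact ⟨x, hx, h ▸ hl⟩

theorem shape_add_of_eq (hS : S.Assumptions b) {η η' : Phase m} (h : S.shape η = S.shape η')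
    (α : Phase m) : S.shape (α + η) = S.shape (α + η') := by
  rw [← hS.shift_shape, h, hS.shift_shape]

/-- The group structure turns a coincidence of two patterns into a period valid at every phase. -/
theorem shape_add_period (hS : S.Assumptions b) {η η' : Phase m} (h : S.shape η = S.shape η')
    (α : Phase m) : S.shape (α + (η' - η)) = S.shape α := by
  have h1 := hS.shape_add_of_eq h (α - η)
  rw [sub_add_cancel] at h1
  rw [h1]; congr 1; abel

theorem exists_isUniqueLocalPhase (hS : S.Assumptions b) (e : HilbertBasis ℕ ℝ H) :
    ∃ (Θ : H → Phase m) (r C ρ : ℝ), S.IsUniqueLocalPhase Θ r C ρ := by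
  obtain ⟨Θ, r, C, h⟩ := hS.exists_isLocalPhase e
  obtain ⟨ρ, hρ, hinj⟩ := hS.exists_shape_injOn
  have hC : 0 < C + 1 := by linarith [h.C_nonneg]
  have hsub : Metric.ball (0 : H) (min r (ρ / (C + 1))) ⊆ Metric.ball 0 r :=
    Metric.ball_subset_ball (min_le_left _ _)
  refine ⟨Θ, min r (ρ / (C + 1)), C, ρ, ⟨lt_min h.r_pos (div_pos hρ hC), h.C_nonneg,
    h.contDiffOn.mono hsub, fun x hx => h.norm_le x (hsub hx),
    fun x hx => h.convergesTo x (hsub hx), fun x hx => h.fderiv_sub_le x (hsub hx),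
    fun x hx => h.fderiv_fderiv_sub_le x (hsub hx)⟩, hρ, fun x hx => ?_, hinj⟩
  have hx1 : ‖x‖ < ρ / (C + 1) := (mem_ball_zero_iff.1 hx).trans_le (min_le_right _ _)
  rw [lt_div_iff₀' hC] at hx1
  rw [mem_ball_zero_iff]
  refine (h.norm_le x (hsub hx)).trans_lt (lt_of_le_of_lt ?_ hx1)
  gcongr; linarith

theorem shift_neg_mem_ball (hS : S.Assumptions b) {η : Phase m} {v : H} {r : ℝ} :
    S.shift (-η) v ∈ Metric.ball (0 : H) r ↔ v ∈ Metric.ball (S.shape η) r := by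
  rw [mem_ball_zero_iff, hS.norm_shift_neg, mem_ball_iff_norm]

section Local
variable {Θ₀ : H → Phase m} {r C ρ : ℝ}

theorem isPhaseMapOn_localPhase (hS : S.Assumptions b) (h : S.IsUniqueLocalPhase Θ₀ r C ρ)
    (η : Phase m) : S.IsPhaseMapOn (Metric.ball (S.shape η) r) (S.localPhase Θ₀ η) := by
  refine ⟨Metric.isOpen_ball, continuousOn_const.add (h.contDiffOn.continuousOn.comp
    (hS.contDiff_shift (-η) (n := 0)).continuous.continuousOn fun v hv =>
      hS.shift_neg_mem_ball.2 hv), fun v hv => ?_⟩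
  have h1 := hS.convergesTo_shift η (h.convergesTo _ (hS.shift_neg_mem_ball.2 hv))
  rwa [hS.shift_shift_neg] at h1

/-- Moving `u` back by its phase puts it on the leaf over `φ₀`. Hence the estimates for the local
phase map, proved only where it vanishes, cover every point of the tube. -/
theorem phase_shift_eq_zero (hS : S.Assumptions b) (h : S.IsUniqueLocalPhase Θ₀ r C ρ)
    {u : H} {η : Phase m} (hu : S.ConvergesTo u η) (hr : u ∈ Metric.ball (S.shape η) r) :
    Θ₀ (S.shift (-η) u) = 0 := by
  have hx := hS.shift_neg_mem_ball.2 hr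
  have h1 := hS.convergesTo_shift (-η) hu
  rw [neg_add_cancel] at h1
  exact h.injOn _ (h.mem_ball _ hx) _ (Metric.mem_ball_self h.ρ_pos)
    (hS.shape_eq_of_convergesTo (h.convergesTo _ hx) h1)

theorem localPhase_self (hS : S.Assumptions b) (h : S.IsUniqueLocalPhase Θ₀ r C ρ)
    {u : H} {η : Phase m} (hu : S.ConvergesTo u η) (hr : u ∈ Metric.ball (S.shape η) r) :
    S.localPhase Θ₀ η u = η := by
  rw [localPhase, hS.phase_shift_eq_zero h hu hr, add_zero]

/-- Continuous determinations of the phase are locally unique. -/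
theorem eventuallyEq_localPhase (hS : S.Assumptions b) (h : S.IsUniqueLocalPhase Θ₀ r C ρ)
    {O : Set H} {Θ : H → Phase m} (hΘ : S.IsPhaseMapOn O Θ) {u : H} (hu : u ∈ O)
    (hr : u ∈ Metric.ball (S.shape (Θ u)) r) : Θ =ᶠ[𝓝 u] S.localPhase Θ₀ (Θ u) := by
  obtain ⟨hO, hc, hconv⟩ := hΘ
  set η := Θ u with hη
  have h1 : Tendsto (fun v => Θ v - η) (𝓝 u) (𝓝 0) := by
    have := ((hc.continuousAt (hO.mem_nhds hu)).tendsto).sub_const η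
    rwa [← hη, sub_self] at this
  filter_upwards [hO.mem_nhds hu, h1 (Metric.ball_mem_nhds 0 h.ρ_pos),
    Metric.isOpen_ball.mem_nhds hr] with v v1 v2 v3
  have hx := hS.shift_neg_mem_ball.2 v3
  have h2 := hS.convergesTo_shift (-η) (hconv v v1)
  rw [neg_add_eq_sub] at h2
  have h3 := h.injOn _ v2 _ (h.mem_ball _ hx)
    (hS.shape_eq_of_convergesTo h2 (h.convergesTo _ hx))
  rw [localPhase, ← h3, add_sub_cancel]

theorem contDiffAt_localPhase (hS : S.Assumptions b) (h : S.IsUniqueLocalPhase Θ₀ r C ρ)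
    {η : Phase m} {u : H} (hr : u ∈ Metric.ball (S.shape η) r) :
    ContDiffAt ℝ 2 (S.localPhase Θ₀ η) u :=
  contDiffAt_const.add ((h.contDiffOn.contDiffAt
    (Metric.isOpen_ball.mem_nhds (hS.shift_neg_mem_ball.2 hr))).comp u
      (hS.contDiff_shift (-η)).contDiffAt)

theorem fderiv_localPhase (hS : S.Assumptions b) (h : S.IsUniqueLocalPhase Θ₀ r C ρ)
    {η : Phase m} {u : H} (hr : u ∈ Metric.ball (S.shape η) r) (w : H) :
    fderiv ℝ (S.localPhase Θ₀ η) u w = fderiv ℝ Θ₀ (S.shift (-η) u) (S.TH (-η) w) := by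
  have h1 : HasFDerivAt Θ₀ _ (S.shift (-η) u) := ((h.contDiffOn.contDiffAt
    (Metric.isOpen_ball.mem_nhds (hS.shift_neg_mem_ball.2 hr))).differentiableAt
      (by norm_num)).hasFDerivAt
  have h2 : HasFDerivAt (S.localPhase Θ₀ η) ((fderiv ℝ Θ₀ (S.shift (-η) u)).comp
      ((hS.THe (-η) : H ≃L[ℝ] H) : H →L[ℝ] H)) u :=
    (h1.comp u (hS.hasFDerivAt_shift (-η) u)).const_add η
  rw [h2.fderiv]; rfl

theorem fderiv_fderiv_localPhase (hS : S.Assumptions b) (h : S.IsUniqueLocalPhase Θ₀ r C ρ)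
    {η : Phase m} {u : H} (hr : u ∈ Metric.ball (S.shape η) r) (w w' : H) :
    fderiv ℝ (fderiv ℝ (S.localPhase Θ₀ η)) u w w' =
      fderiv ℝ (fderiv ℝ Θ₀) (S.shift (-η) u) (S.TH (-η) w) (S.TH (-η) w') := by
  have hx := Metric.isOpen_ball.mem_nhds (hS.shift_neg_mem_ball.2 hr)
  have hd : fderiv ℝ (S.shift (-η)) = fun _ => ((hS.THe (-η) : H ≃L[ℝ] H) : H →L[ℝ] H) :=
    funext fun v => (hS.hasFDerivAt_shift (-η) v).fderiv
  have e1 : fderiv ℝ (S.localPhase Θ₀ η) = fderiv ℝ fun v => Θ₀ (S.shift (-η) v) := by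
    ext1 v; exact fderiv_const_add η
  rw [e1, fderiv_fderiv_comp (h.contDiffOn.contDiffAt hx) (hS.contDiff_shift (-η)).contDiffAt, hd]
  simp only [fderiv_fun_const, Pi.zero_apply, zero_apply, map_zero, add_zero]
  rfl

/-- The derivatives of the phase do not depend on the determination. -/
theorem fderiv_fderiv_localPhase_eq (hS : S.Assumptions b) (h : S.IsUniqueLocalPhase Θ₀ r C ρ)
    {η η' : Phase m} {u : H} (hu : S.ConvergesTo u η) (hu' : S.ConvergesTo u η')
    (hr : u ∈ Metric.ball (S.shape η) r) :
    fderiv ℝ (fderiv ℝ (S.localPhase Θ₀ η')) u = fderiv ℝ (fderiv ℝ (S.localPhase Θ₀ η)) u := by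
  have hs := hS.shape_eq_of_convergesTo hu hu'
  obtain ⟨hO, hc, hconv⟩ := hS.isPhaseMapOn_localPhase h η
  -- Adding the period `η' - η` to the determination with value `η` at `u` gives one with value
  -- `η'`. By local uniqueness it is the local phase map of `η'`, and a constant does not affect
  -- derivatives.
  have hΘ : S.IsPhaseMapOn (Metric.ball (S.shape η) r)
      fun v => S.localPhase Θ₀ η v + (η' - η) :=
    ⟨hO, hc.add continuousOn_const, fun v hv =>
      convergesTo_congr (hS.shape_add_period hs _).symm (hconv v hv)⟩
  have e : S.localPhase Θ₀ η u + (η' - η) = η' := by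
    rw [hS.localPhase_self h hu hr, add_sub_cancel]
  have h1 := hS.eventuallyEq_localPhase h hΘ hr (by rw [e, ← hs]; exact hr)
  simp only [e] at h1
  rw [← h1.fderiv.fderiv_eq]
  congr 1
  ext1 v
  exact fderiv_add_const (η' - η)

/-- Near `φ₀` a point is close to the pattern of its phase, by continuity; moving `u` to `φ₀` by an
isometry makes the radius independent of the place on the manifold. -/
theorem exists_tube_radius (hS : S.Assumptions b) (h : S.IsUniqueLocalPhase Θ₀ r C ρ) :
    ∃ δ₀ > 0, ∀ u ∈ S.tube δ₀, (∃ η, S.ConvergesTo u η) ∧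
      ∀ η, S.ConvergesTo u η → u ∈ Metric.ball (S.shape η) r := by
  have h0 : (0 : H) ∈ Metric.ball (0 : H) r := Metric.mem_ball_self h.r_pos
  have hΘ0 : Θ₀ 0 = 0 := by simpa using h.norm_le 0 h0
  have hc : Tendsto (fun x => ‖x - S.shape (Θ₀ x)‖) (𝓝 0) (𝓝 0) := by
    have h1 : ContinuousAt Θ₀ 0 :=
      h.contDiffOn.continuousOn.continuousAt (Metric.ball_mem_nhds 0 h.r_pos)
    have h2 : ContinuousAt (fun x => S.shape (Θ₀ x)) 0 :=
      hS.differentiable_shape.continuous.continuousAt.comp h1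
    have h3 := (continuousAt_id.sub h2).norm.tendsto
    simpa [hΘ0, hS.shape_zero] using h3
  obtain ⟨δ, hδ, hb⟩ := Metric.eventually_nhds_iff_ball.1
    ((hc.eventually_lt_const h.r_pos).and (Metric.ball_mem_nhds (0 : H) h.r_pos))
  -- Half the radius, since the tube is closed in the distance while the ball is open.
  refine ⟨δ / 2, by positivity, fun u hu => ?_⟩
  obtain ⟨β, -, hβ⟩ := hu
  have hxδ : S.shift (-β) u ∈ Metric.ball (0 : H) δ := by
    rw [mem_ball_zero_iff, hS.norm_shift_neg]; linarith
  obtain ⟨b1, b2⟩ := hb _ hxδ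
  have hconv := hS.convergesTo_shift β (h.convergesTo _ b2)
  rw [hS.shift_shift_neg] at hconv
  refine ⟨⟨_, hconv⟩, fun η hη => ?_⟩
  rw [mem_ball_iff_norm, hS.shape_eq_of_convergesTo hη hconv, ← hS.shift_shape]
  have := hS.norm_shift_sub_shift β (S.shift (-β) u) (S.shape (Θ₀ (S.shift (-β) u)))
  rw [hS.shift_shift_neg] at this
  rw [this]
  exact b1

end Local

theorem secondOrder_TH (hS : S.Assumptions b) (i : Fin m) (α : Phase m) (w : H) :
    S.secondOrder i α (S.TH α w) = S.secondOrder i 0 w := by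
  have h1 : ∀ s ∈ Ioi (0 : ℝ), inner ℝ (S.ψ i α)
      (S.D2f α (S.V α s (S.TH α w)) (S.V α s (S.TH α w)))
      = inner ℝ (S.ψ i 0) (S.D2f 0 (S.V 0 s w) (S.V 0 s w)) := fun s hs => by
    rw [hS.V_TH α (le_of_lt hs), hS.D2f_TH, hS.ψ_T, hS.inner_TH]
  rw [secondOrder, secondOrder, MeasureTheory.setIntegral_congr_fun measurableSet_Ioi h1]
  simp only [hS.ψ_T _ α, hS.dφ_TH _ α, hS.dψ_TH _ _ α, hS.inner_TH]

theorem integrableOn_TH (hS : S.Assumptions b) (e : HilbertBasis ℕ ℝ H) (i : Fin m)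
    (α : Phase m) (w : H) : MeasureTheory.IntegrableOn
      (fun s : ℝ => inner ℝ (S.ψ i α) (S.D2f α (S.V α s w) (S.V α s w))) (Ioi 0) := by
  refine (hS.integrableOn_secondOrder e i (S.TH (-α) w)).congr_fun (fun s hs => ?_)
    measurableSet_Ioi
  have hw : S.TH α (S.TH (-α) w) = w := (hS.THe α).apply_symm_apply w
  beta_reduce
  rw [← hS.inner_TH α, ← hS.ψ_T, ← hS.D2f_TH, ← hS.V_TH α (le_of_lt hs), hw]

end Assumptions
end PatternSystem

/-! ### Assembly of the statement -/

theorem lemma4p5 {m : ℕ} {H X : Type*} [NormedAddCommGroup H] [InnerProductSpace ℝ H]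
    [CompleteSpace H] [AddCommGroup X] [Module ℝ X]
    (S : PatternSystem m H X) (b : ℝ) (hS : S.Assumptions b)
    -- the noise operator
    (B : H → H →L[ℝ] H) (CB : ℝ) (hB_lip : ∀ u v : H, ‖B u - B v‖ ≤ CB * ‖u - v‖)
    (hB_bdd : ∀ u : H, ‖B u‖ ≤ CB) (e : HilbertBasis ℕ ℝ H)
    (hB_tail : Tendsto (fun M : ℕ => ⨆ u : H, ∑' j : ℕ, ‖B u (e (M + j))‖ₑ ^ 2) atTop (𝓝 0)) :
    ∃ δ₀ : ℝ, 0 < δ₀ ∧ ∀ δ : ℝ, 0 < δ → δ ≤ δ₀ →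
      -- the isochronal phase exists on `R`, and has a continuous determination near each point
      (∀ u ∈ S.tube δ, ∃ η : Phase m, S.ConvergesTo u η) ∧
      (∀ u ∈ S.tube δ, ∀ η : Phase m, S.ConvergesTo u η →
        ∃ (O : Set H) (Θ : H → Phase m), S.IsPhaseMapOn O Θ ∧ u ∈ O ∧ Θ u = η) ∧
      -- it is unique, and continuous around all of `R`, if the patterns `φ_α` are distinct
      (Function.Injective S.φ →
        (∀ u ∈ S.tube δ, ∃! η : Phase m, S.ConvergesTo u η) ∧
        ∃ (O : Set H) (Θ : H → Phase m), S.IsPhaseMapOn O Θ ∧ S.tube δ ⊆ O) ∧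
      -- (i) `Θ` is twice continuously differentiable
      (∀ (O : Set H) (Θ : H → Phase m), S.IsPhaseMapOn O Θ →
        ∀ u ∈ O ∩ S.tube δ, ContDiffAt ℝ 2 Θ u) ∧
      -- (ii) continuity of the trace-type map
      (∃ G : H → Phase m, ContinuousOn G (S.tube δ) ∧
        ∀ (O : Set H) (Θ : H → Phase m), S.IsPhaseMapOn O Θ → ∀ u ∈ O ∩ S.tube δ,
          HasSum (fun j : ℕ => fderiv ℝ (fderiv ℝ Θ) u (B u (e j)) (B u (e j))) (G u)) ∧
      -- (iii) leading order of the first and second derivatives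
      (∃ C : ℝ, ∀ (O : Set H) (Θ : H → Phase m), S.IsPhaseMapOn O Θ →
        ∀ u ∈ O ∩ S.tube δ, ∀ α : Phase m, α = Θ u → ∀ (w : H) (i : Fin m),
          |(fderiv ℝ Θ u w) i - inner ℝ (S.ψ i α) w| ≤ C * ‖u - S.shape α‖ * ‖w‖ ∧
          MeasureTheory.IntegrableOn
            (fun s : ℝ => inner ℝ (S.ψ i α) (S.D2f α (S.V α s w) (S.V α s w))) (Ioi 0) ∧
          |(fderiv ℝ (fderiv ℝ Θ) u w w) i
              - 2 * ∑ j : Fin m, inner ℝ (S.ψ j α) w * inner ℝ (S.dψ i j α) w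
              + ∑ j : Fin m, ∑ k : Fin m,
                  inner ℝ (S.dφ j α) (S.dψ i k α) * inner ℝ (S.ψ j α) w * inner ℝ (S.ψ k α) w
              - ∫ s in Ioi (0 : ℝ), inner ℝ (S.ψ i α) (S.D2f α (S.V α s w) (S.V α s w))|
            ≤ C * ‖u - S.shape α‖ * ‖w‖ ^ 2) := by
  obtain ⟨Θ₀, r, C, ρ, h⟩ := hS.exists_isUniqueLocalPhase e
  obtain ⟨δ₀, hδ₀, hδ⟩ := hS.exists_tube_radius h
  refine ⟨δ₀, hδ₀, fun δ _ hle => ?_⟩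
  have htube : S.tube δ ⊆ S.tube δ₀ := fun u ⟨β, h1, h2⟩ => ⟨β, h1, h2.trans hle⟩
  have hex : ∀ u ∈ S.tube δ, ∃ η, S.ConvergesTo u η := fun u hu => (hδ u (htube hu)).1
  have hball : ∀ u ∈ S.tube δ, ∀ η, S.ConvergesTo u η → u ∈ Metric.ball (S.shape η) r :=
    fun u hu => (hδ u (htube hu)).2
  have hloc : ∀ (O : Set H) (Θ : H → Phase m), S.IsPhaseMapOn O Θ → ∀ u ∈ O ∩ S.tube δ,
      Θ =ᶠ[𝓝 u] S.localPhase Θ₀ (Θ u) := fun O Θ hΘ u hu =>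
    hS.eventuallyEq_localPhase h hΘ hu.1 (hball u hu.2 _ (hΘ.2.2 u hu.1))
  refine ⟨hex, fun u hu η hη => ⟨_, _, hS.isPhaseMapOn_localPhase h η, hball u hu η hη,
    hS.localPhase_self h hη (hball u hu η hη)⟩, fun hφ => ?_, fun O Θ hΘ u hu => ?_, ?_, ?_⟩
  · have huniq : ∀ v η η', S.ConvergesTo v η → S.ConvergesTo v η' → η = η' := fun v η η' h1 h2 =>
      hφ (hS.shape_eq_iff.1 (hS.shape_eq_of_convergesTo h1 h2))
    refine ⟨fun u hu => ?_, ?_⟩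
    · obtain ⟨η, hη⟩ := hex u hu
      exact ⟨η, hη, fun η' hη' => huniq u _ _ hη' hη⟩
    · classical
      -- When the patterns are distinct, the chosen phase agrees with every local determination, so
      -- continuity on the union of balls is a local matter.
      let Θ : H → Phase m := fun v => if hv : ∃ η, S.ConvergesTo v η then hv.choose else 0
      have hΘ : ∀ v η, S.ConvergesTo v η → Θ v = η := fun v η hv => by
        have hv' : ∃ η, S.ConvergesTo v η := ⟨η, hv⟩
        simp only [Θ, dif_pos hv']
        exact huniq v _ _ hv'.choose_spec hv
      refine ⟨⋃ η, Metric.ball (S.shape η) r, Θ, ⟨isOpen_iUnion fun η => Metric.isOpen_ball,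
        fun v hv => ?_, fun v hv => ?_⟩, fun u hu => ?_⟩
      · obtain ⟨η, hη⟩ := mem_iUnion.1 hv
        obtain ⟨hO, hc, hconv⟩ := hS.isPhaseMapOn_localPhase h η
        refine ContinuousAt.continuousWithinAt ?_
        refine (hc.continuousAt (hO.mem_nhds hη)).congr ?_
        filter_upwards [hO.mem_nhds hη] with v' hv' using (hΘ v' _ (hconv v' hv')).symm
      · obtain ⟨η, hη⟩ := mem_iUnion.1 hv
        have := (hS.isPhaseMapOn_localPhase h η).2.2 v hη
        rwa [hΘ v _ this]
      · obtain ⟨η, hη⟩ := hex u hu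
        exact mem_iUnion.2 ⟨η, hball u hu η hη⟩
  · exact (hS.contDiffAt_localPhase h (hball u hu.2 _ (hΘ.2.2 u hu.1))).congr_of_eventuallyEq
      (hloc O Θ hΘ u hu)
  · choose! η hη using hex
    have hBc : Continuous B := by
      have : LipschitzWith CB.toNNReal B := LipschitzWith.of_dist_le_mul fun u v => by
        rw [dist_eq_norm, dist_eq_norm]
        refine (hB_lip u v).trans ?_
        gcongr
        exact Real.le_coe_toNNReal CB
      exact this.continuous
    let D : Phase m → H → H →L[ℝ] H →L[ℝ] Phase m := fun α =>
      fderiv ℝ (fderiv ℝ (S.localPhase Θ₀ α))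
    have hD : ∀ u ∈ S.tube δ, ∀ α, S.ConvergesTo u α → D α u = D (η u) u := fun u hu α hα =>
      hS.fderiv_fderiv_localPhase_eq h (hη u hu) hα (hball u hu _ (hη u hu))
    -- The chosen phase `η u` need not depend continuously on `u`. By `hD` the second derivative
    -- does not depend on this choice, so near a given point it may be replaced by the derivative of
    -- one fixed local determination.
    refine ⟨fun u => ∑' j, D (η u) u (B u (e j)) (B u (e j)), fun u hu => ?_,
      fun O Θ hΘ u hu => ?_⟩
    · set α := η u
      have hur := hball u hu α (hη u hu)
      have hDc : ContinuousOn (D α) (Metric.ball (S.shape α) r) := fun v hv =>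
        (((hS.contDiffAt_localPhase h hv).fderiv_right (m := 1) (by norm_num)).fderiv_right
          (m := 0) (by norm_num)).continuousAt.continuousWithinAt
      -- The trace lemma asks for a bounded family of bilinear maps, so the ball is shrunk until
      -- continuity supplies the bound.
      have hnb : ∀ᶠ v in 𝓝 u, v ∈ Metric.ball (S.shape α) r ∧ ‖D α v‖ ≤ ‖D α u‖ + 1 := by
        have h1 : ContinuousAt (fun v => ‖D α v‖) u :=
          (continuous_norm (E := H →L[ℝ] H →L[ℝ] Phase m)).continuousAt.comp
            (hDc.continuousAt (Metric.isOpen_ball.mem_nhds hur))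
        filter_upwards [Metric.isOpen_ball.mem_nhds hur,
          h1.eventually (eventually_le_nhds (lt_add_one ‖D α u‖))] with v v1 v2 using ⟨v1, v2⟩
      obtain ⟨ε, hε, hW⟩ := Metric.eventually_nhds_iff_ball.1 hnb
      have hct := continuousOn_trace hB_tail hBc
        (hDc.mono fun v hv => (hW v hv).1) (fun v hv => (hW v hv).2)
      have h2 := (hct.continuousAt (Metric.ball_mem_nhds u hε)).continuousWithinAt
        (s := S.tube δ)
      refine h2.congr_of_eventuallyEq ?_ rfl
      filter_upwards [self_mem_nhdsWithin, mem_nhdsWithin_of_mem_nhds (Metric.ball_mem_nhds u hε)]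
        with v v1 v2
      have hΘα := hS.isPhaseMapOn_localPhase h α
      have hvα := (hW v v2).1
      have hconv := hΘα.2.2 v hvα
      have h4 : D α v = D (η v) v := by
        refine Eq.trans ?_ (hD v v1 _ hconv)
        exact (Filter.EventuallyEq.fderiv (𝕜 := ℝ) (hloc _ _ hΘα v ⟨hvα, v1⟩)).fderiv_eq
      simp only [h4]
    · have e1 : fderiv ℝ (fderiv ℝ Θ) u = D (η u) u := by
        rw [(hloc O Θ hΘ u hu).fderiv.fderiv_eq]
        exact hD u hu.2 _ (hΘ.2.2 u hu.1)
      rw [e1]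
      exact (summable_trace hB_tail (D (η u) u) u).hasSum
  · refine ⟨C, fun O Θ hΘ u hu α hα w i => ?_⟩
    have hconv : S.ConvergesTo u α := hα ▸ hΘ.2.2 u hu.1
    have hur := hball u hu.2 α hconv
    have hev : Θ =ᶠ[𝓝 u] S.localPhase Θ₀ α := hα ▸ hloc O Θ hΘ u hu
    have hx := hS.shift_neg_mem_ball.2 hur
    have h0 := hS.phase_shift_eq_zero h hconv hur
    have hw : S.TH α (S.TH (-α) w) = w := (hS.THe α).apply_symm_apply w
    refine ⟨?_, hS.integrableOn_TH e i α w, ?_⟩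
    · have h1 := h.fderiv_sub_le _ hx h0 (S.TH (-α) w) i
      rwa [hS.norm_shift_neg, hS.norm_TH, ← hS.fderiv_localPhase h hur, ← hev.fderiv_eq,
        ← hS.inner_TH α, hw, ← hS.ψ_T] at h1
    · have h1 := h.fderiv_fderiv_sub_le _ hx h0 (S.TH (-α) w) i
      rw [hS.norm_shift_neg, hS.norm_TH, ← hS.fderiv_fderiv_localPhase h hur,
        ← hev.fderiv.fderiv_eq, ← hS.secondOrder_TH i α, hw] at h1
      -- The estimate at `φ₀` was applied to the vector moved back by `-α`; equivariance of the
      -- second-order expression has brought it to `φ_α`, and only the grouping of its terms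
      -- differs.
      refine (congrArg _ ?_).trans_le h1
      rw [PatternSystem.secondOrder]; ring
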